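/- \textbf{Setting.} Let $n_1,n_2\ge 1$ and let $d_s,d_m,d_\theta\ge 0$ be fixed ranks, $d=d_s+d_m+d_\theta$. A pair $(M,\Theta)$ of real $n_1\times n_2$ matrices has the \emph{shared factor form} if $M=\Lambda_{m1}F_s^\top+\Lambda_{m2}F_m^\top$ and $\Theta=\Lambda_{\theta1}F_s^\top+\Lambda_{\theta2}F_\theta^\top$ for matrices with $d_s$, $d_m$, $d_\theta$ columns such that $\Lambda_{m1}^\top\Lambda_{m1}+\Lambda_{\theta1}^\top\Lambda_{\theta1}$, $\Lambda_{m2}^\top\Lambda_{m2}$, $\Lambda_{\theta2}^\top\Lambda_{\theta2}$ are diagonal, $\frac1{n_2}F_s^\top F_s=I$, $\frac1{n_2}F_m^\top F_m=I$, $\frac1{n_2}F_\theta^\top F_\theta=I$, $F_s^\top F_m=0$, $F_s^\top F_\theta=0$ and $\|\frac1{n_2}F_m^\top F_\theta\|<1$ (spectral norm). Write $H=(M^\top,\Theta^\top)^\top$, $\|\cdot\|_F$ for the Frobenius norm, $\|A\|_\infty=\max_{ij}|a_{ij}|$, $\|X\|_p=(\mathbb E|X|^p)^{1/p}$, and $\|X\|_{\psi_k}=\inf\{C>0:\mathbb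 E[e^{(|X|/C)^k}-1]\le1\}$. Let $(M_\star,\Theta_\star)$ have the shared factor form and let $\pi_{\star,ij}=\operatorname{expit}(\theta_{\star,ij})$. The indicators $w_{ij}$ are Bernoulli$(\pi_{\star,ij})$, the data $x_{ij}$ have law $\mathcal P(m_{\star,ij})$, and all the $w_{ij}$ and $x_{ij}$ are mutually independent. With a pseudo-log-likelihood $l(x,m)$ (the family $\mathcal P$ and the function $l$ may depend on the entry $(i,j)$, as for data of mixed type) and a weight $0<\eta<\infty$, let $l_{ij}=l(x_{ij},m_{ij})$, $\pi_{ij}=\operatorname{expit}(\theta_{ij})$ and $$\mathcal L(M,\Theta)=-\sum_{i,j}\Bigl\{w_{ij}\bigl(\log\pi_{ij}+\eta\, l_{ij}\bigr)+(1-w_{ij})\log(1-\pi_{ij})\Bigr\}.$$ Assume $\|M_\star\|_\infty\le\alpha_m$, $\|\Theta_\star\|_\infty\le\alpha_\theta$, and that there are constants $\alpha_l>0$, $L_l>0$ such that, for all $i,j$ and all $m,m_1,m_2\in[-\alpha_m,\alpha_m]$: $l(x_{ij},m)$ is integrable and $$\pi_{\star,ij}\{\mathbb E[l(x_{ij},m_{\star,ij})]-\mathbb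 E[l(x_{ij},m)]\}\ge\alpha_l(m-m_{\star,ij})^2;$$ $l$ is differentiable in $m$ at every point of $[-\alpha_m,\alpha_m]$, with derivative $l'=\partial l/\partial m$, and almost surely $|l'(x_{ij},m_1)-l'(x_{ij},m_2)|\le L_l|m_1-m_2|$. Put $$\alpha_h=\min\Bigl\{\tfrac{\exp(\alpha_\theta)}{2(1+\exp(\alpha_\theta))^2},\ \eta\alpha_l\Bigr\}.$$ Let $\hat H_o=(\hat M_o^\top,\hat\Theta_o^\top)^\top$ be a random matrix (a function of the outcome), and let $\mathcal E$ be the event that $(\hat M_o,\hat\Theta_o)$ minimizes $\mathcal L$ over all pairs of the shared factor form with ranks $d_s,d_m,d_\theta$ and satisfies $\|\hat M_o\|_\infty\le\alpha_m$, $\|\hat\Theta_o\|_\infty\le\alpha_\theta$. \textbf{Theorem 1.} There are universal constants $C_1,C_2>0$ (not depending on any of the above objects) such that the following holds. (In particular, if $\mathcal E$ has probability one, $\mathcal E$ can be dropped.) A quotient with denominator $0$, which occurs only if $d=0$ or $\alpha_m+\alpha_\theta=0$, is read as $0$. (1) Sub-Gaussian case. If $\max_{ij}\|l'(x_{ij},m_{\star,ij})\|_{\psi_2}\le\alpha_{\psi_2}$,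 then for all $t\ge0$ $$\mathbb P\bigl(\mathcal E,\ \|\hat H_o-H_\star\|_F\ge t\bigr)\le C_1\exp\Bigl(-C_2\frac{\alpha_h^2}{c_{\psi_2}^2d}\,\frac{t^2}{n_1+n_2}\Bigr),\qquad c_{\psi_2}=\max\Bigl\{\tfrac1{\sqrt{\log2}},\ \tfrac{2\eta}{\sqrt{\log2}}L_l\alpha_m+\eta\alpha_{\psi_2}\Bigr\}.$$ (2) Sub-exponential case. If $\max_{ij}\|l'(x_{ij},m_{\star,ij})\|_{\psi_1}\le\alpha_{\psi_1}$, $\max\{L_l\alpha_m,1/\eta\}\le\alpha_{\psi_1}\log(n_1n_2)$, $\frac{2L_l}{n_1^2n_2^2}+\frac{6\alpha_{\psi_1}\sqrt{n_1+n_2}}{(n_1n_2)^{3/2}}\le\frac12\min\{\frac{\exp(\alpha_\theta)}{2\eta(1+\exp(\alpha_\theta))^2},\alpha_l\}$ and $n_1n_2\ge e$, then for all $t\ge\frac{\log(n_1n_2)}{\sqrt{n_1n_2}}$ $$\mathbb P\bigl(\mathcal E,\ \|\hat H_o-H_\star\|_F\ge t\bigr)\le\frac2{n_1n_2}+C_1\exp\Bigl(-C_2\frac{\alpha_h^2}{\eta^2\alpha_{\psi_1}^2d}\,\frac{t^2}{(n_1+n_2)(\log(n_1n_2))^2}\Bigr).$$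 (3) $8+\zeta$ moments. If $\alpha_\zeta,\zeta>0$, $\max_{ij}\|l'(x_{ij},m_{\star,ij})\|_{8+\zeta}\le\alpha_\zeta$, $\alpha_\zeta(n_1+n_2)^{\frac1{4+\zeta/4}}\ge\max\{2L_l\alpha_m,1/\eta\}$ and $\frac{L_l}{(n_1+n_2)^2}+\frac{\max\{\alpha_\zeta,1/\eta\}(8+\zeta)}{7+\zeta}\frac{\sqrt{n_1n_2}}{(n_1+n_2)^{3/2}}\le\frac12\min\{\frac{\exp(\alpha_\theta)}{2\eta(1+\exp(\alpha_\theta))^2},\alpha_l\}$, then for all $t\ge(n_1+n_2)^{-\frac{8+5\zeta}{32+2\zeta}}$ $$\mathbb P\bigl(\mathcal E,\ \|\hat H_o-H_\star\|_F\ge t\bigr)\le\frac{n_1n_2}{(n_1+n_2)^{2+\frac{2\zeta}{16+\zeta}}}+C_1\exp\Bigl(-C_2\frac{\alpha_h^2}{\eta^2\alpha_\zeta^2d}\,\frac{t^2}{(n_1+n_2)^{1+2/(4+\zeta/4)}}\Bigr).$$ (4) $4+\delta$ moments. If $\alpha_\delta,\delta>0$, $\max_{ij}\|l'(x_{ij},m_{\star,ij})\|_{4+\delta}\le\alpha_\delta$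 and $\frac{L_l}{(n_1+n_2)^2}+\frac{\max\{\alpha_\delta,1/\eta\}(4+\delta)}{3+\delta}\frac{\sqrt{n_1n_2}}{(n_1+n_2)^{3/2}}\le\frac12\min\{\frac{\exp(\alpha_\theta)}{2\eta(1+\exp(\alpha_\theta))^2},\alpha_l\}$, then for all $t>(n_1+n_2)^{-\delta/2}$ $$\mathbb P\bigl(\mathcal E,\ \|\hat H_o-H_\star\|_F\ge t\bigr)\le\frac{n_1n_2}{(n_1+n_2)^{2+\delta/2}}+C_1\exp\Bigl(-C_2\frac{\alpha_h}{c_\delta(\alpha_m+\alpha_\theta)d^{3/2}}\,\frac{t^2}{(n_1+n_2)^{3/2}}\Bigr),\qquad c_\delta=\max\{\eta\alpha_\delta+2\eta L_l\alpha_m,\,1\}.$$ \textbf{Orders.} Consequently, along any sequence of such models with $n_1+n_2\to\infty$ in which $d_s,d_m,d_\theta,\eta,\alpha_m,\alpha_\theta,\alpha_l,L_l$ and the constants $\alpha_{\psi_2}$, resp. $\alpha_{\psi_1}$, resp. $(\alpha_\zeta,\zeta)$, resp. $(\alpha_\delta,\delta)$, do not vary, the error $\|\hat H_o-H_\star\|_F$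 on the events $\mathcal E$ is $O_p(\sqrt{n_1+n_2})$ in case (1), $O_p(\log(n_1n_2)\sqrt{n_1+n_2})$ in case (2), $o_p((n_1+n_2)^{3/4})$ in case (3) and $O_p((n_1+n_2)^{3/4})$ in case (4). Here $a=O_p(b)$ on $\mathcal E$ means that for every $\epsilon>0$ there is $C>0$ with $\limsup\mathbb P(\mathcal E,\ a>Cb)\le\epsilon$, and $a=o_p(b)$ on $\mathcal E$ that $\mathbb P(\mathcal E,\ a>Cb)\to0$ for every $C>0$. -/

import Mathlib

open MeasureTheory ProbabilityTheory Filter Topology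
open scoped ENNReal

universe u

namespace SharedFactor

noncomputable section

/-! ### Norms -/

section Frobenius
open scoped Matrix.Norms.Frobenius

/-- The Frobenius norm of a real matrix. -/
def frobNorm {m n : Type*} [Fintype m] [Fintype n] (A : Matrix m n ℝ) : ℝ := ‖A‖

end Frobenius

section Spectral
open scoped Matrix.Norms.L2Operator

/-- The spectral norm of a real matrix. -/
def specNorm {m n : ℕ} (A : Matrix (Fin m) (Fin n) ℝ) : ℝ := ‖A‖

end Spectral

/-- The entrywise maximum norm of `A` is at most `α`. -/
def MaxNormLE {m n : ℕ} (A : Matrix (Fin m) (Fin n) ℝ) (α : ℝ) : Prop :=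
  ∀ i j, |A i j| ≤ α

/-- The total parameter matrix `H = (Mᵀ, Θᵀ)ᵀ`, i.e. `M` stacked on top of `Θ`. -/
def total {n₁ n₂ : ℕ} (M Θ : Matrix (Fin n₁) (Fin n₂) ℝ) :
    Matrix (Fin n₁ ⊕ Fin n₁) (Fin n₂) ℝ :=
  Matrix.fromRows M Θ

/-- `ψ_k(x) = exp(x ^ k) - 1`. -/
def psi (k : ℕ) (x : ℝ) : ℝ := Real.exp (x ^ k) - 1

/-- The Orlicz norm `‖X‖_ψ = inf {C > 0 : 𝔼 ψ(|X| / C) ≤ 1}`; it is `∞` if there is no such `C`. -/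
def orliczNorm {Ω : Type*} [MeasurableSpace Ω] (ψ : ℝ → ℝ) (X : Ω → ℝ) (μ : Measure Ω) : ℝ≥0∞ :=
  ⨅ (C : ℝ) (_ : 0 < C) (_ : ∫⁻ ω, ENNReal.ofReal (ψ (|X ω| / C)) ∂μ ≤ 1), ENNReal.ofReal C

/-! ### The shared factor model and the known-rank estimator -/

/-- `M = Λ_{m1} F_sᵀ + Λ_{m2} F_mᵀ` and `Θ = Λ_{θ1} F_sᵀ + Λ_{θ2} F_θᵀ`, where the factors and the
loadings satisfy the identification constraints. -/
def IsSharedFactor (ds dm dθ : ℕ) {n₁ n₂ : ℕ} (M Θ : Matrix (Fin n₁) (Fin n₂) ℝ) : Prop :=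
  ∃ (Λm1 Λθ1 : Matrix (Fin n₁) (Fin ds) ℝ) (Λm2 : Matrix (Fin n₁) (Fin dm) ℝ)
    (Λθ2 : Matrix (Fin n₁) (Fin dθ) ℝ) (Fs : Matrix (Fin n₂) (Fin ds) ℝ)
    (Fm : Matrix (Fin n₂) (Fin dm) ℝ) (Fθ : Matrix (Fin n₂) (Fin dθ) ℝ),
    M = Λm1 * Fs.transpose + Λm2 * Fm.transpose ∧
    Θ = Λθ1 * Fs.transpose + Λθ2 * Fθ.transpose ∧
    (Λm1.transpose * Λm1 + Λθ1.transpose * Λθ1).IsDiag ∧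
    (Λm2.transpose * Λm2).IsDiag ∧
    (Λθ2.transpose * Λθ2).IsDiag ∧
    (1 / (n₂ : ℝ)) • (Fs.transpose * Fs) = 1 ∧
    (1 / (n₂ : ℝ)) • (Fm.transpose * Fm) = 1 ∧
    (1 / (n₂ : ℝ)) • (Fθ.transpose * Fθ) = 1 ∧
    Fs.transpose * Fm = 0 ∧
    Fs.transpose * Fθ = 0 ∧
    specNorm ((1 / (n₂ : ℝ)) • (Fm.transpose * Fθ)) < 1

/-- The negative pseudo-log-likelihood
`- ∑_{ij} { w_ij (log π_ij + η l_ij(x_ij, m_ij)) + (1 - w_ij) log (1 - π_ij) }`,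
with `π_ij = expit θ_ij`. -/
def negPseudoLogLik {n₁ n₂ : ℕ} (l : Fin n₁ → Fin n₂ → ℝ → ℝ → ℝ) (η : ℝ)
    (w x : Matrix (Fin n₁) (Fin n₂) ℝ) (M Θ : Matrix (Fin n₁) (Fin n₂) ℝ) : ℝ :=
  -∑ i, ∑ j,
    (w i j * (Real.log (Real.sigmoid (Θ i j)) + η * l i j (x i j) (M i j)) +
      (1 - w i j) * Real.log (1 - Real.sigmoid (Θ i j)))

/-- `(M, Θ)` is a minimizer of the negative pseudo-log-likelihood over all pairs of the shared factor
form with the given ranks. -/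
def IsKnownRankEstimate (ds dm dθ : ℕ) {n₁ n₂ : ℕ} (l : Fin n₁ → Fin n₂ → ℝ → ℝ → ℝ) (η : ℝ)
    (w x : Matrix (Fin n₁) (Fin n₂) ℝ) (M Θ : Matrix (Fin n₁) (Fin n₂) ℝ) : Prop :=
  IsSharedFactor ds dm dθ M Θ ∧
  ∀ M' Θ' : Matrix (Fin n₁) (Fin n₂) ℝ, IsSharedFactor ds dm dθ M' Θ' →
    negPseudoLogLik l η w x M Θ ≤ negPseudoLogLik l η w x M' Θ'

/-! ### The statistical experiment and its assumptions -/

/-- The ranks and the constants of the model. -/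
structure Params where
  /-- the rank of the shared part -/
  ds : ℕ
  /-- the rank of the part specific to `M` -/
  dm : ℕ
  /-- the rank of the part specific to `Θ` -/
  dθ : ℕ
  /-- the weight of the `x`-part of the pseudo-log-likelihood -/
  η : ℝ
  /-- the entrywise bound of `M` -/
  αm : ℝ
  /-- the entrywise bound of `Θ` -/
  αθ : ℝ
  /-- the curvature constant of the expected pseudo-log-likelihood -/
  αl : ℝ
  /-- the Lipschitz constant of the score -/
  Ll : ℝ

namespace Params

/-- `d = d_s + d_m + d_θ`. -/
def d (p : Params) : ℕ := p.ds + p.dm + p.dθ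

/-- `exp(α_θ) / (2 (1 + exp(α_θ))²)`. -/
def κ (p : Params) : ℝ := Real.exp p.αθ / (2 * (1 + Real.exp p.αθ) ^ 2)

/-- `α_h = min {exp(α_θ) / (2 (1 + exp(α_θ))²), η α_l}`. -/
def αh (p : Params) : ℝ := min p.κ (p.η * p.αl)

/-- `c_{ψ₂} = max {1 / √(log 2), (2 η / √(log 2)) L_l α_m + η α_{ψ₂}}`. -/
def cPsi2 (p : Params) (α : ℝ) : ℝ :=
  max (1 / √(Real.log 2)) (2 * p.η / √(Real.log 2) * p.Ll * p.αm + p.η * α)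

/-- `c_δ = max {η α_δ + 2 η L_l α_m, 1}`. -/
def cDelta (p : Params) (α : ℝ) : ℝ := max (p.η * α + 2 * p.η * p.Ll * p.αm) 1

end Params

/-- A partially observed random `n₁ × n₂` data matrix, with the families of distributions and the
pseudo-log-likelihoods of its entries and the true parameter matrices. The assumptions are stated
separately below. -/
structure Experiment (n₁ n₂ : ℕ) where
  /-- the sample space -/
  Ω : Type u
  /-- its σ-algebra -/
  mΩ : MeasurableSpace Ω
  /-- the probability measure -/
  P : Measure Ω
  /-- `P` has total mass one -/
  isProb : IsProbabilityMeasure P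
  /-- the one-parameter family of distributions of the `(i, j)` entry -/
  law : Fin n₁ → Fin n₂ → ℝ → ProbabilityMeasure ℝ
  /-- the pseudo-log-likelihood `l(x, m)` of the `(i, j)` entry -/
  l : Fin n₁ → Fin n₂ → ℝ → ℝ → ℝ
  /-- the true matrix `M⋆` -/
  M : Matrix (Fin n₁) (Fin n₂) ℝ
  /-- the true matrix `Θ⋆` -/
  Θ : Matrix (Fin n₁) (Fin n₂) ℝ
  /-- the missing indicators -/
  w : Ω → Matrix (Fin n₁) (Fin n₂) ℝ
  /-- the data -/
  x : Ω → Matrix (Fin n₁) (Fin n₂) ℝ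

attribute [instance] Experiment.mΩ Experiment.isProb

namespace Experiment

variable {n₁ n₂ : ℕ}

/-- The score `l'(x_ij, m) = ∂l(x_ij, m)/∂m`, as a random variable. -/
def score (E : Experiment.{u} n₁ n₂) (i : Fin n₁) (j : Fin n₂) (m : ℝ) (ω : E.Ω) : ℝ :=
  deriv (fun m' => E.l i j (E.x ω i j) m') m

/-- Model and sampling: the truth has the shared factor form, `w_ij` is Bernoulli with parameter
`expit θ⋆_ij`, `x_ij` has the distribution with parameter `m⋆_ij`, and all these variables are
mutually independent. -/
structure AssumptionA (E : Experiment.{u} n₁ n₂) (p : Params) : Prop where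
  truth : IsSharedFactor p.ds p.dm p.dθ E.M E.Θ
  law_w : ∀ i j, HasLaw (fun ω => E.w ω i j)
    (bernoulliMeasure (1 : ℝ) 0 (unitInterval.sigmoid (E.Θ i j))) E.P
  law_x : ∀ i j, HasLaw (fun ω => E.x ω i j) (E.law i j (E.M i j) : Measure ℝ) E.P
  indep_w : iIndepFun (fun (e : Fin n₁ × Fin n₂) ω => E.w ω e.1 e.2) E.P
  indep_x : iIndepFun (fun (e : Fin n₁ × Fin n₂) ω => E.x ω e.1 e.2) E.P
  indep_wx : IndepFun (fun ω (e : Fin n₁ × Fin n₂) => E.w ω e.1 e.2)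
    (fun ω (e : Fin n₁ × Fin n₂) => E.x ω e.1 e.2) E.P

/-- Boundedness of the true matrices and positivity of the weight. -/
structure AssumptionB (E : Experiment.{u} n₁ n₂) (p : Params) : Prop where
  bound_M : MaxNormLE E.M p.αm
  bound_Θ : MaxNormLE E.Θ p.αθ
  eta_pos : 0 < p.η

/-- Quadratic growth of the expected pseudo-log-likelihood at the truth, differentiability in `m`,
and the Lipschitz bound for the score. -/
structure AssumptionC (E : Experiment.{u} n₁ n₂) (p : Params) : Prop where
  αl_pos : 0 < p.αl
  Ll_pos : 0 < p.Ll
  measurable_l : ∀ i j m, Measurable (fun x => E.l i j x m)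
  integrable_l : ∀ i j, ∀ m ∈ Set.Icc (-p.αm) p.αm,
    Integrable (fun ω => E.l i j (E.x ω i j) m) E.P
  growth : ∀ i j, ∀ m ∈ Set.Icc (-p.αm) p.αm,
    p.αl * (m - E.M i j) ^ 2 ≤ Real.sigmoid (E.Θ i j) *
      (∫ ω, E.l i j (E.x ω i j) (E.M i j) ∂E.P - ∫ ω, E.l i j (E.x ω i j) m ∂E.P)
  differentiable_l : ∀ i j x, ∀ m ∈ Set.Icc (-p.αm) p.αm, DifferentiableAt ℝ (E.l i j x) m
  lipschitz_score : ∀ᵐ ω ∂E.P, ∀ i j, ∀ m₁ ∈ Set.Icc (-p.αm) p.αm, ∀ m₂ ∈ Set.Icc (-p.αm) p.αm,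
    |E.score i j m₁ ω - E.score i j m₂ ω| ≤ p.Ll * |m₁ - m₂|

/-- The sub-Gaussian case. -/
structure SubGaussianScore (E : Experiment.{u} n₁ n₂) (α : ℝ) : Prop where
  nonneg : 0 ≤ α
  tail : ∀ i j, orliczNorm (psi 2) (E.score i j (E.M i j)) E.P ≤ ENNReal.ofReal α

/-- The sub-exponential case, with its conditions on the constants. -/
structure SubExponentialScore (E : Experiment.{u} n₁ n₂) (p : Params) (α : ℝ) : Prop where
  nonneg : 0 ≤ α
  tail : ∀ i j, orliczNorm (psi 1) (E.score i j (E.M i j)) E.P ≤ ENNReal.ofReal α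
  const₁ : max (p.Ll * p.αm) (1 / p.η) ≤ α * Real.log ((n₁ : ℝ) * n₂)
  const₂ : 2 * p.Ll / ((n₁ : ℝ) ^ 2 * (n₂ : ℝ) ^ 2) +
      6 * α * √((n₁ : ℝ) + n₂) / ((n₁ : ℝ) * n₂) ^ (3 / 2 : ℝ) ≤
    1 / 2 * min (p.κ / p.η) p.αl
  const₃ : Real.exp 1 ≤ (n₁ : ℝ) * n₂

/-- The case of `8 + ζ` moments, with its conditions on the constants. -/
structure EightMomentScore (E : Experiment.{u} n₁ n₂) (p : Params) (α ζ : ℝ) : Prop where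
  α_pos : 0 < α
  ζ_pos : 0 < ζ
  tail : ∀ i j, eLpNorm (E.score i j (E.M i j)) (ENNReal.ofReal (8 + ζ)) E.P ≤ ENNReal.ofReal α
  const₁ : max (2 * p.Ll * p.αm) (1 / p.η) ≤ α * ((n₁ : ℝ) + n₂) ^ (1 / (4 + ζ / 4))
  const₂ : p.Ll / ((n₁ : ℝ) + n₂) ^ 2 +
      max α (1 / p.η) * (8 + ζ) / (7 + ζ) *
        (√((n₁ : ℝ) * n₂) / ((n₁ : ℝ) + n₂) ^ (3 / 2 : ℝ)) ≤
    1 / 2 * min (p.κ / p.η) p.αl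

/-- The case of `4 + δ` moments, with its condition on the constants. -/
structure FourMomentScore (E : Experiment.{u} n₁ n₂) (p : Params) (α δ : ℝ) : Prop where
  α_pos : 0 < α
  δ_pos : 0 < δ
  tail : ∀ i j, eLpNorm (E.score i j (E.M i j)) (ENNReal.ofReal (4 + δ)) E.P ≤ ENNReal.ofReal α
  const : p.Ll / ((n₁ : ℝ) + n₂) ^ 2 +
      max α (1 / p.η) * (4 + δ) / (3 + δ) *
        (√((n₁ : ℝ) * n₂) / ((n₁ : ℝ) + n₂) ^ (3 / 2 : ℝ)) ≤
    1 / 2 * min (p.κ / p.η) p.αl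

/-- A pair of matrices as a function of the outcome: a candidate for the estimator `(M̂, Θ̂)`. -/
abbrev Estimator (E : Experiment.{u} n₁ n₂) : Type u :=
  E.Ω → Matrix (Fin n₁) (Fin n₂) ℝ × Matrix (Fin n₁) (Fin n₂) ℝ

/-- The event that `(M̂, Θ̂)` solves the known-rank problem and obeys the entrywise bounds. -/
def goodEvent (E : Experiment.{u} n₁ n₂) (p : Params) (est : E.Estimator) : Set E.Ω :=
  {ω | IsKnownRankEstimate p.ds p.dm p.dθ E.l p.η (E.w ω) (E.x ω) (est ω).1 (est ω).2 ∧
    MaxNormLE (est ω).1 p.αm ∧ MaxNormLE (est ω).2 p.αθ}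

/-- The estimation error `‖Ĥ - H⋆‖_F`. -/
def error (E : Experiment.{u} n₁ n₂) (est : E.Estimator) (ω : E.Ω) : ℝ :=
  frobNorm (total (est ω).1 (est ω).2 - total E.M E.Θ)

end Experiment

/-! ### Stochastic orders along a sequence of experiments -/

/-- `a_k = O_p(b_k)` on the events `A_k`: for every `ε > 0` there is `C > 0` with
`limsup P(A_k ∩ {a_k > C b_k}) ≤ ε`. With `A_k` of probability one this is the usual `O_p`. -/
def IsBigOInProbOn {Ω : ℕ → Type u} [∀ k, MeasurableSpace (Ω k)] (P : ∀ k, Measure (Ω k))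
    (A : ∀ k, Set (Ω k)) (a : ∀ k, Ω k → ℝ) (b : ℕ → ℝ) : Prop :=
  ∀ ε : ℝ≥0∞, 0 < ε → ∃ C : ℝ, 0 < C ∧
    limsup (fun k => P k (A k ∩ {ω | C * b k < a k ω})) atTop ≤ ε

/-- `a_k = o_p(b_k)` on the events `A_k`: `P(A_k ∩ {a_k > C b_k}) → 0` for every `C > 0`. -/
def IsLittleOInProbOn {Ω : ℕ → Type u} [∀ k, MeasurableSpace (Ω k)] (P : ∀ k, Measure (Ω k))
    (A : ∀ k, Set (Ω k)) (a : ∀ k, Ω k → ℝ) (b : ℕ → ℝ) : Prop :=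
  ∀ C : ℝ, 0 < C → Tendsto (fun k => P k (A k ∩ {ω | C * b k < a k ω})) atTop (𝓝 0)

end

end SharedFactor

/-!
Write `H = (M, Θ)` and `H⋆` for the truth. In `Θ` the negative log-likelihood is
`softplus θ - w θ` with `softplus θ = log (1 + exp θ)`, hence strongly convex in expectation on
the range allowed for `Θ` (`Params.softplus_growth`); in `M` the expected loss grows quadratically
by assumption. So the expected loss at `H` exceeds that at `H⋆` by `α_h ‖H - H⋆‖²`, and at a
minimizer the centred likelihood ratio, called `noise` below, has to make up for this
(`dist_sq_sub_bias_le_noise`). The theorem follows once the noise is shown to be small, uniformly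
over all pairs of the shared factor form that obey the entrywise bounds. Only the bounds for the
ranks are used of that form.

**Uniform bounds.** The increments of the noise have Gaussian or Bernstein exponential moments in a
distance of the matrices (`lintegral_exp_noise_sub_le`, `lintegral_exp_noise_sub_le_of_bounded`),
and they are chained over a ball in a space of dimension at most `4 d (n₁ + n₂)` that parametrizes
the low-rank pairs (`chaining`). Since the tail bound is trivial unless its level `D` is at least of
order `d (n₁ + n₂)`, one exponential moment of size `exp D` per increment suffices, and no entropy
integral is needed. Two parametrizations occur:

* For the sub-Gaussian bound, `H - H⋆` has rank at most `2 d`, and a matrix of rank at most `k` in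
  the Frobenius ball of radius `r` is `r U V`, with `U` in the operator unit ball and `V` in the
  Frobenius unit ball (`exists_frobParam`). This gives `|noise| ≤ C r √D` on the ball of radius `r`
  around `H⋆`, and peeling over the radii `2 ^ k t` gives the tail bound
  (`measureReal_le_of_subGaussian`).
* For the case of `4 + δ` moments only the second moment of the truncated score is under control,
  and the increments are measured in the maximum norm. A matrix of rank at most `k` with entries
  bounded by `α` is `α U V` with the entries of `U` and `V` bounded by one, by taking columns of
  maximal volume (`exists_supParam`). This gives `|noise| ≤ C √(n₁ + n₂) (α_m + α_θ) D` on the whole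
  box (`measureReal_le_of_bounded`); the Lipschitz constant `2 d` of the product costs a factor
  `2 + log (2 d) ≤ 3 √d`, which is where `d ^ (3 / 2)` comes from.

**Truncation.** In all cases but the sub-Gaussian one, the data points with a score beyond a level
`τ` are discarded. The event that there is such a point gives the first summand of the bounds, and
the change of the expected loss is at most `b |m - m⋆| + q (m - m⋆)²` per entry
(`isTruncationBias_truncSet`). The conditions on the constants and on `t` ensure that this takes
away at most half of the curvature. Where the exponent is not below `-1`, the bounds hold since
`1 ≤ 8 exp (-1)`.

The stochastic orders result from the tail bounds with `t` a multiple of the rate. If `d = 0` or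
`α_m + α_θ = 0`, the error vanishes on the event under consideration.
-/

namespace SharedFactor

noncomputable section

/-! ### Nets and chaining -/

/-- Volume comparison: the balls of radius `δ / 2` around a `δ`-separated family are disjoint. -/
theorem card_le_of_separated_family {V : Type*} [NormedAddCommGroup V] [NormedSpace ℝ V]
    [FiniteDimensional ℝ V] {T : Type*} (τ : T → V) {R δ : ℝ} (hR0 : 0 ≤ R) (hδ : 0 < δ)
    (s : Finset T) (hR : ∀ a ∈ s, ‖τ a‖ ≤ R)
    (hs : ∀ a ∈ s, ∀ b ∈ s, a ≠ b → δ ≤ ‖τ a - τ b‖) :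
    (s.card : ℝ) ≤ (1 + 2 * R / δ) ^ Module.finrank ℝ V := by
  borelize V
  let μ : Measure V := Measure.addHaar
  set ρ : ℝ := R + δ / 2 with hρ
  have ρpos : 0 < ρ := by positivity
  have δpos : 0 < δ / 2 := by positivity
  have hd : (s : Set T).PairwiseDisjoint (fun a => Metric.ball (τ a) (δ / 2)) := by
    intro a ha b hb hab
    apply Metric.ball_disjoint_ball
    rw [dist_eq_norm]
    linarith [hs a ha b hb hab]
  have hsub : (⋃ a ∈ s, Metric.ball (τ a) (δ / 2)) ⊆ Metric.ball (0 : V) ρ := by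
    refine Set.iUnion₂_subset fun a ha => Metric.ball_subset_ball' ?_
    rw [dist_zero_right]
    linarith [hR a ha]
  have I : (s.card : ℝ≥0∞) * ENNReal.ofReal ((δ / 2) ^ Module.finrank ℝ V) *
      μ (Metric.ball 0 1) ≤ ENNReal.ofReal (ρ ^ Module.finrank ℝ V) * μ (Metric.ball 0 1) :=
    calc
      _ = μ (⋃ a ∈ s, Metric.ball (τ a) (δ / 2)) := by
        rw [measure_biUnion_finset hd fun c _ => measurableSet_ball]
        simp only [μ.addHaar_ball_of_pos _ δpos]
        simp only [Finset.sum_const, nsmul_eq_mul, mul_assoc]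
      _ ≤ μ (Metric.ball (0 : V) ρ) := measure_mono hsub
      _ = _ := by simp only [μ.addHaar_ball_of_pos _ ρpos]
  have J := (ENNReal.mul_le_mul_iff_left (Metric.measure_ball_pos _ _ zero_lt_one).ne'
    measure_ball_lt_top.ne).1 I
  have K := ENNReal.toReal_le_of_le_ofReal (pow_nonneg ρpos.le _) J
  rw [ENNReal.toReal_mul, ENNReal.toReal_ofReal (by positivity), ENNReal.toReal_natCast] at K
  have : (1 + 2 * R / δ) = ρ / (δ / 2) := by rw [hρ]; field_simp; ring
  rw [this, div_pow, le_div_iff₀ (by positivity)]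
  exact K

/-- A maximal separated family is a net, and its size is controlled by the volume comparison. -/
theorem exists_net {V : Type*} [NormedAddCommGroup V] [NormedSpace ℝ V]
    [FiniteDimensional ℝ V] {T : Type*} (τ : T → V) {R δ : ℝ} (hR0 : 0 ≤ R) (hδ : 0 < δ)
    (hR : ∀ a, ‖τ a‖ ≤ R) :
    ∃ s : Finset T, (∀ a, ∃ b ∈ s, ‖τ a - τ b‖ ≤ δ) ∧
      (s.card : ℝ) ≤ (1 + 2 * R / δ) ^ Module.finrank ℝ V := by
  classical
  let p : ℕ → Prop := fun n => ∃ s : Finset T, s.card = n ∧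
    ∀ a ∈ s, ∀ b ∈ s, a ≠ b → δ ≤ ‖τ a - τ b‖
  set b := ⌊(1 + 2 * R / δ) ^ Module.finrank ℝ V⌋₊
  have hb : ∀ n, p n → n ≤ b := by
    rintro n ⟨s, rfl, hs⟩
    exact Nat.le_floor (card_le_of_separated_family τ hR0 hδ s (fun a _ => hR a) hs)
  have h0 : p 0 := ⟨∅, rfl, by simp⟩
  obtain ⟨s, hcard, hs⟩ : p (Nat.findGreatest p b) := Nat.findGreatest_spec (Nat.zero_le _) h0
  refine ⟨s, fun a => ?_, card_le_of_separated_family τ hR0 hδ s (fun a _ => hR a) hs⟩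
  by_contra! hcon
  have ha : a ∉ s := fun ha => by
    have := hcon a ha
    simp only [sub_self, norm_zero] at this
    linarith
  have : p (s.card + 1) := by
    refine ⟨insert a s, Finset.card_insert_of_notMem ha, ?_⟩
    intro x hx y hy hxy
    rcases Finset.mem_insert.1 hx with rfl | hx'
    · rcases Finset.mem_insert.1 hy with rfl | hy'
      · exact (hxy rfl).elim
      · exact (hcon y hy').le
    · rcases Finset.mem_insert.1 hy with rfl | hy'
      · rw [norm_sub_rev]; exact (hcon x hx').le
      · exact hs x hx' y hy' hxy
  have h1 := Nat.le_findGreatest (hb _ this) this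
  omega

theorem measure_abs_ge_le_of_lintegral_exp {Ω : Type*} [MeasurableSpace Ω] {P : Measure Ω}
    {f : Ω → ℝ} (hf : AEMeasurable f P) {s D u : ℝ} (hs : 0 < s)
    (h : ∫⁻ ω, ENNReal.ofReal (Real.exp (|f ω| / s)) ∂P ≤ ENNReal.ofReal (2 * Real.exp D)) :
    P {ω | u ≤ |f ω|} ≤ ENNReal.ofReal (2 * Real.exp (D - u / s)) := by
  have hm : AEMeasurable (fun ω => ENNReal.ofReal (Real.exp (|f ω| / s))) P := by
    have : Measurable fun x : ℝ => ENNReal.ofReal (Real.exp (|x| / s)) := by fun_prop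
    exact this.comp_aemeasurable hf
  have h1 := (mul_meas_ge_le_lintegral₀ hm (ENNReal.ofReal (Real.exp (u / s)))).trans h
  have h2 : {ω | u ≤ |f ω|} ⊆
      {ω | ENNReal.ofReal (Real.exp (u / s)) ≤ ENNReal.ofReal (Real.exp (|f ω| / s))} := by
    intro ω (hω : u ≤ |f ω|)
    simp only [Set.mem_ofPred_eq]
    gcongr
  have h3 : P {ω | u ≤ |f ω|} * ENNReal.ofReal (Real.exp (u / s)) ≤
      ENNReal.ofReal (2 * Real.exp D) :=
    (by rw [mul_comm]; gcongr : _ ≤ _).trans h1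
  have hpos : ENNReal.ofReal (Real.exp (u / s)) ≠ 0 := by simp [Real.exp_pos]
  rw [← ENNReal.le_div_iff_mul_le (Or.inl hpos) (Or.inl ENNReal.ofReal_ne_top)] at h3
  refine h3.trans (le_of_eq ?_)
  rw [← ENNReal.ofReal_div_of_pos (Real.exp_pos _), Real.exp_sub]
  ring_nf

theorem net_card_le_exp {R D : ℝ} (hR : 1 ≤ R) {m : ℕ} (hm : m * (2 + Real.log R) ≤ D) (k : ℕ) :
    (1 + 2 * R / (1 / 2) ^ k) ^ m ≤ Real.exp (D * (k + 1)) := by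
  have h2k : (1 : ℝ) ≤ 2 ^ k := one_le_pow₀ (by norm_num)
  have hlogR := Real.log_nonneg hR
  have h1 : 1 + 2 * R / (1 / 2) ^ k ≤ Real.exp ((2 + Real.log R) * (k + 1)) := by
    have e3 : (3 : ℝ) ≤ Real.exp 2 := by
      have := Real.add_one_le_exp (2 : ℝ); linarith
    have e2 : (2 : ℝ) ^ k ≤ Real.exp 2 ^ k := by gcongr; linarith
    calc 1 + 2 * R / (1 / 2) ^ k = 1 + 2 * (R * 2 ^ k) := by
          rw [one_div, inv_pow, div_inv_eq_mul]; ring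
      _ ≤ 3 * (R * 2 ^ k) := by nlinarith
      _ ≤ Real.exp 2 * (R * Real.exp 2 ^ k) := by gcongr
      _ = Real.exp (2 + Real.log R + k * 2) := by
          rw [Real.exp_add, Real.exp_add, Real.exp_log (by linarith), Real.exp_nat_mul]; ring
      _ ≤ _ := by
          gcongr
          have : 0 ≤ Real.log R * k := by positivity
          linarith
  calc (1 + 2 * R / (1 / 2) ^ k) ^ m ≤ Real.exp ((2 + Real.log R) * (k + 1)) ^ m := by
        gcongr
    _ = Real.exp ((m * (2 + Real.log R)) * (k + 1)) := by
        rw [← Real.exp_nat_mul]; ring_nf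
    _ ≤ _ := by gcongr

theorem sum_chain_weights_le (n : ℕ) :
    ∑ j ∈ Finset.range n, (3 * (1 / 2 : ℝ) ^ (j + 1) * (4 * (j + 2))) ≤ 36 := by
  have : ∀ n : ℕ, ∑ j ∈ Finset.range n, (3 * (1 / 2 : ℝ) ^ (j + 1) * (4 * (j + 2))) =
      36 - 12 * (n + 3) * (1 / 2) ^ n := by
    intro n
    induction n with
    | zero => norm_num
    | succ k ih => rw [Finset.sum_range_succ, ih]; push_cast; ring
  rw [this]
  have : (0 : ℝ) ≤ 12 * (n + 3) * (1 / 2) ^ n := by positivity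
  linarith

/-- Chaining with a single exponential moment per increment: if the process is indexed by a subset
of the ball of radius `R` in a normed space of dimension `m`, and
`𝔼 exp (|X_a - X_b| / (K ρ)) ≤ 2 e ^ D` with `ρ` the distance of `a` and `b` (and with `ρ = 1`
for all `a` and `b`), then outside an event of probability `4 e ^ (-D)` no increment exceeds a
multiple of `K D`, as soon as `D ≥ m (2 + log R)`. -/
theorem chaining {V : Type*} [NormedAddCommGroup V] [NormedSpace ℝ V]
    [FiniteDimensional ℝ V] {T : Type*} (τ : T → V) {R D K : ℝ} (hR1 : 1 ≤ R)
    (hR : ∀ a, ‖τ a‖ ≤ R) (hD1 : 1 ≤ D) (hK : 0 < K)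
    (hm : Module.finrank ℝ V * (2 + Real.log R) ≤ D)
    {Ω : Type*} [MeasurableSpace Ω] {P : Measure Ω} (X : T → Ω → ℝ)
    (hX : ∀ a, AEMeasurable (X a) P)
    (hglob : ∀ a b, ∫⁻ ω, ENNReal.ofReal (Real.exp (|X a ω - X b ω| / K)) ∂P ≤
      ENNReal.ofReal (2 * Real.exp D))
    (hinc : ∀ a b, ∀ δ : ℝ, 0 < δ → ‖τ a - τ b‖ ≤ δ →
      ∫⁻ ω, ENNReal.ofReal (Real.exp (|X a ω - X b ω| / (K * δ))) ∂P ≤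
      ENNReal.ofReal (2 * Real.exp D))
    (hlip : ∀ᵐ ω ∂P, ∃ G : ℝ, ∀ a b, |X a ω - X b ω| ≤ G * ‖τ a - τ b‖) (a₀ : T) :
    ∃ B : Set Ω, P B ≤ ENNReal.ofReal (4 * Real.exp (-D)) ∧
      ∀ ω ∉ B, ∀ a, |X a ω - X a₀ ω| ≤ 40 * K * D := by
  classical
  have hnet : ∀ k : ℕ, ∃ s : Finset T, (∀ a, ∃ b ∈ s, ‖τ a - τ b‖ ≤ (1 / 2) ^ k) ∧
      (s.card : ℝ) ≤ Real.exp (D * (k + 1)) := by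
    intro k
    obtain ⟨s, hs, hc⟩ := exists_net τ (δ := (1 / 2) ^ k) (zero_le_one.trans hR1) (by positivity) hR
    exact ⟨s, hs, hc.trans (net_card_le_exp hR1 hm k)⟩
  choose S hS hcard using hnet
  set B₀ : Set Ω := ⋃ b ∈ S 0, {ω | 4 * K * D ≤ |X b ω - X a₀ ω|} with hB₀
  let Pr : ℕ → Finset (T × T) := fun j =>
    (S (j + 1) ×ˢ S j).filter fun bc => ‖τ bc.1 - τ bc.2‖ ≤ 3 * (1 / 2) ^ (j + 1)
  set B : ℕ → Set Ω := fun j => ⋃ bc ∈ Pr j,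
    {ω | K * (3 * (1 / 2) ^ (j + 1)) * (4 * (j + 2) * D) ≤ |X bc.1 ω - X bc.2 ω|} with hB
  set N : Set Ω := {ω | ¬ ∃ G : ℝ, ∀ a b, |X a ω - X b ω| ≤ G * ‖τ a - τ b‖} with hN
  have hN0 : P N = 0 := hlip
  have hPB₀ : P B₀ ≤ ENNReal.ofReal (2 * Real.exp (-D)) := by
    calc P B₀ ≤ ∑ b ∈ S 0, P {ω | 4 * K * D ≤ |X b ω - X a₀ ω|} :=
          measure_biUnion_finset_le _ _
      _ ≤ ∑ b ∈ S 0, ENNReal.ofReal (2 * Real.exp (D - 4 * K * D / K)) :=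
          Finset.sum_le_sum fun b _ => measure_abs_ge_le_of_lintegral_exp
            ((hX b).sub (hX a₀)) hK (hglob b a₀)
      _ = ENNReal.ofReal ((S 0).card * (2 * Real.exp (D - 4 * K * D / K))) := by
          rw [Finset.sum_const, nsmul_eq_mul, ENNReal.ofReal_mul (Nat.cast_nonneg _),
            ENNReal.ofReal_natCast]
      _ ≤ ENNReal.ofReal (Real.exp D * (2 * Real.exp (D - 4 * K * D / K))) := by
          gcongr
          have := hcard 0
          simpa using this
      _ ≤ _ := by
          apply ENNReal.ofReal_le_ofReal
          rw [show 4 * K * D / K = 4 * D by field_simp, mul_left_comm, ← Real.exp_add]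
          gcongr
          linarith
  have hPB : ∀ j, P (B j) ≤ ENNReal.ofReal (2 * Real.exp (-D)) * (1 / 2) ^ (j + 1) := by
    intro j
    have hj0 : (0 : ℝ) ≤ j := Nat.cast_nonneg j
    have hs : (0 : ℝ) < K * (3 * (1 / 2) ^ (j + 1)) := by positivity
    calc P (B j) ≤ ∑ bc ∈ Pr j, P {ω | K * (3 * (1 / 2) ^ (j + 1)) * (4 * (j + 2) * D) ≤
            |X bc.1 ω - X bc.2 ω|} := measure_biUnion_finset_le _ _
      _ ≤ ∑ bc ∈ Pr j, ENNReal.ofReal (2 * Real.exp (D - 4 * (j + 2) * D)) := by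
          refine Finset.sum_le_sum fun bc hbc => ?_
          have := measure_abs_ge_le_of_lintegral_exp (u := K * (3 * (1 / 2) ^ (j + 1)) *
            (4 * (j + 2) * D)) ((hX bc.1).sub (hX bc.2)) hs
            (hinc bc.1 bc.2 _ (by positivity) (Finset.mem_filter.1 hbc).2)
          rwa [mul_div_cancel_left₀ _ hs.ne'] at this
      _ = ENNReal.ofReal ((Pr j).card * (2 * Real.exp (D - 4 * (j + 2) * D))) := by
          rw [Finset.sum_const, nsmul_eq_mul, ENNReal.ofReal_mul (Nat.cast_nonneg _),
            ENNReal.ofReal_natCast]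
      _ ≤ ENNReal.ofReal ((2 * Real.exp (-D)) * (1 / 2) ^ (j + 1)) := by
          apply ENNReal.ofReal_le_ofReal
          have h1 : ((Pr j).card : ℝ) ≤ Real.exp (D * (j + 2)) * Real.exp (D * (j + 1)) := by
            calc ((Pr j).card : ℝ) ≤ ((S (j + 1) ×ˢ S j).card : ℝ) := by
                  exact_mod_cast Finset.card_filter_le _ _
              _ = (S (j + 1)).card * (S j).card := by rw [Finset.card_product]; push_cast; rfl
              _ ≤ _ := by
                  gcongr
                  · have := hcard (j + 1)
                    push_cast at this
                    rw [show D * (j + 2) = D * (j + 1 + 1 : ℝ) by ring]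
                    exact this
                  · exact hcard j
          have h2 : Real.exp (-(j + 1 : ℝ)) ≤ (1 / 2) ^ (j + 1) := by
            rw [show (-(j + 1 : ℝ)) = ((j + 1 : ℕ) : ℝ) * (-1) by push_cast; ring,
              Real.exp_nat_mul]
            gcongr
            rw [Real.exp_neg, one_div]
            gcongr
            have := Real.add_one_le_exp (1 : ℝ); linarith
          calc _ ≤ Real.exp (D * (j + 2)) * Real.exp (D * (j + 1)) *
                (2 * Real.exp (D - 4 * (j + 2) * D)) := by gcongr
            _ = 2 * Real.exp (D * (j + 2) + D * (j + 1) + (D - 4 * (j + 2) * D)) := by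
                rw [Real.exp_add, Real.exp_add]; ring
            _ ≤ 2 * Real.exp (-D + -(j + 1 : ℝ)) := by
                refine mul_le_mul_of_nonneg_left (Real.exp_le_exp.2 ?_) (by norm_num)
                nlinarith
            _ = 2 * Real.exp (-D) * Real.exp (-(j + 1 : ℝ)) := by rw [Real.exp_add]; ring
            _ ≤ _ := by gcongr
      _ = _ := by
          rw [ENNReal.ofReal_mul (by positivity), ENNReal.ofReal_pow (by norm_num)]
          congr 2
          rw [ENNReal.ofReal_div_of_pos (by norm_num)]; simp
  refine ⟨B₀ ∪ (⋃ j, B j) ∪ N, ?_, ?_⟩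
  · calc P (B₀ ∪ (⋃ j, B j) ∪ N) ≤ P B₀ + P (⋃ j, B j) + P N :=
          (measure_union_le _ _).trans (by gcongr; exact measure_union_le _ _)
      _ ≤ ENNReal.ofReal (2 * Real.exp (-D)) +
            ∑' j : ℕ, ENNReal.ofReal (2 * Real.exp (-D)) * (1 / 2) ^ (j + 1) + 0 := by
          rw [hN0]
          gcongr
          exact (measure_iUnion_le _).trans (ENNReal.tsum_le_tsum hPB)
      _ = ENNReal.ofReal (4 * Real.exp (-D)) := by
          rw [ENNReal.tsum_mul_left]
          have : ∑' j : ℕ, (1 / 2 : ℝ≥0∞) ^ (j + 1) = 1 := by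
            rw [ENNReal.tsum_geometric_add_one, one_div, ENNReal.one_sub_inv_two, inv_inv,
              ENNReal.inv_mul_cancel (by norm_num) (by norm_num)]
          rw [this, mul_one, add_zero, ← ENNReal.ofReal_add (by positivity) (by positivity)]
          ring_nf
  · intro ω hω a
    simp only [Set.mem_union, not_or] at hω
    obtain ⟨⟨hω₀, hωB⟩, hωN⟩ := hω
    obtain ⟨G, hG⟩ : ∃ G : ℝ, ∀ a b, |X a ω - X b ω| ≤ G * ‖τ a - τ b‖ := by
      simpa [hN] using hωN
    choose π hπS hπ using fun k => hS k a
    have h0 : |X (π 0) ω - X a₀ ω| ≤ 4 * K * D := by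
      by_contra! hcon
      exact hω₀ (Set.mem_iUnion₂.2 ⟨π 0, hπS 0, hcon.le⟩)
    have hstep : ∀ j, |X (π (j + 1)) ω - X (π j) ω| ≤
        3 * (1 / 2) ^ (j + 1) * (4 * (j + 2)) * (K * D) := by
      intro j
      by_contra! hcon
      refine hωB (Set.mem_iUnion.2 ⟨j, Set.mem_iUnion₂.2 ⟨(π (j + 1), π j), ?_, ?_⟩⟩)
      · refine Finset.mem_filter.2 ⟨Finset.mk_mem_product (hπS _) (hπS _), ?_⟩
        calc ‖τ (π (j + 1)) - τ (π j)‖ = ‖(τ a - τ (π j)) - (τ a - τ (π (j + 1)))‖ := by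
              congr 1; abel
          _ ≤ (1 / 2) ^ j + (1 / 2) ^ (j + 1) :=
              (norm_sub_le _ _).trans (add_le_add (hπ j) (hπ (j + 1)))
          _ = _ := by ring
      · simp only [Set.mem_ofPred_eq]
        refine le_trans (le_of_eq ?_) hcon.le
        ring
    have hsum : ∀ n, |X (π n) ω - X a₀ ω| ≤ 40 * K * D := by
      intro n
      have htel : X (π n) ω - X a₀ ω = ∑ j ∈ Finset.range n, (X (π (j + 1)) ω - X (π j) ω) +
          (X (π 0) ω - X a₀ ω) := by
        rw [Finset.sum_range_sub (fun j => X (π j) ω)]; ring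
      rw [htel]
      calc _ ≤ ∑ j ∈ Finset.range n, |X (π (j + 1)) ω - X (π j) ω| +
            |X (π 0) ω - X a₀ ω| :=
            (abs_add_le _ _).trans (by gcongr; exact Finset.abs_sum_le_sum_abs _ _)
        _ ≤ ∑ j ∈ Finset.range n, (3 * (1 / 2) ^ (j + 1) * (4 * (j + 2))) * (K * D) +
            4 * K * D := by
            gcongr with j _
            exact hstep j
        _ ≤ 36 * (K * D) + 4 * K * D := by
            rw [← Finset.sum_mul]
            have := sum_chain_weights_le n
            gcongr
        _ = _ := by ring
    have hlim : Tendsto (fun n => |X (π n) ω - X a₀ ω|) atTop (𝓝 |X a ω - X a₀ ω|) := by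
      have h1 : Tendsto (fun n => X (π n) ω) atTop (𝓝 (X a ω)) := by
        rw [tendsto_iff_dist_tendsto_zero]
        have h2 : Tendsto (fun n : ℕ => |G| * (1 / 2 : ℝ) ^ n) atTop (𝓝 0) := by
          simpa using (tendsto_pow_atTop_nhds_zero_of_lt_one (r := (1 / 2 : ℝ)) (by norm_num)
            (by norm_num)).const_mul |G|
        refine squeeze_zero (fun _ => dist_nonneg) (fun n => ?_) h2
        rw [dist_comm, Real.dist_eq]
        calc _ ≤ G * ‖τ a - τ (π n)‖ := hG _ _
          _ ≤ |G| * (1 / 2) ^ n := by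
            gcongr
            · exact le_abs_self G
            · exact hπ n
      exact (h1.sub_const _).abs
    exact le_of_tendsto' hlim hsum

/-! ### Exponential moments of centred sums -/

theorem exp_le_add_exp_sq (x : ℝ) : Real.exp x ≤ x + Real.exp (x ^ 2) := by
  have h1 := Real.add_one_le_exp (x ^ 2)
  rcases le_or_gt |x| 1 with h | h
  · have := (abs_le.1 (Real.abs_exp_sub_one_sub_id_le h)).2
    linarith
  · rcases lt_abs.1 h with h | h
    · have : Real.exp x ≤ Real.exp (x ^ 2) := Real.exp_le_exp.2 (by nlinarith)
      linarith
    · have : Real.exp x ≤ 1 := Real.exp_le_one_iff.2 (by linarith)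
      nlinarith

theorem exp_mul_le_one_add {s u : ℝ} (hs0 : 0 ≤ s) (hs1 : s ≤ 1) :
    Real.exp (s * u) ≤ 1 + s * (Real.exp u - 1) := by
  have := convexOn_exp.2 (Set.mem_univ u) (Set.mem_univ 0) hs0 (sub_nonneg.2 hs1) (by ring)
  simp only [smul_eq_mul, mul_zero, add_zero, Real.exp_zero, mul_one] at this
  linarith

section Moments

variable {Ω : Type*} [MeasurableSpace Ω] {P : Measure Ω}

theorem integrable_affine [IsProbabilityMeasure P] {u : Ω → ℝ} (hu : Integrable u P) (b : ℝ) :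
    Integrable (fun ω => 1 + b * u ω) P ∧ ∫ ω, (1 + b * u ω) ∂P = 1 + b * ∫ ω, u ω ∂P := by
  refine ⟨(integrable_const _).add (hu.const_mul b), ?_⟩
  rw [integral_add (integrable_const _) (hu.const_mul b), integral_const_mul]
  simp

theorem integral_sub_one [IsProbabilityMeasure P] {u : Ω → ℝ} (hu : Integrable u P) :
    Integrable (fun ω => u ω - 1) P ∧ ∫ ω, (u ω - 1) ∂P = ∫ ω, u ω ∂P - 1 := by
  refine ⟨hu.sub (integrable_const _), ?_⟩
  rw [integral_sub hu (integrable_const _)]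
  simp

theorem lintegral_exp_sub_le_of_le {f h : Ω → ℝ} (hh : Integrable h P)
    (hle : ∀ᵐ ω ∂P, Real.exp (f ω) ≤ h ω) (c : ℝ) :
    ∫⁻ ω, ENNReal.ofReal (Real.exp (f ω - c)) ∂P ≤
      ENNReal.ofReal (Real.exp (-c) * ∫ ω, h ω ∂P) := by
  calc ∫⁻ ω, ENNReal.ofReal (Real.exp (f ω - c)) ∂P
      ≤ ∫⁻ ω, ENNReal.ofReal (Real.exp (-c) * h ω) ∂P := by
        refine lintegral_mono_ae ?_
        filter_upwards [hle] with ω hω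
        rw [sub_eq_neg_add, Real.exp_add]
        gcongr
    _ = ENNReal.ofReal (∫ ω, Real.exp (-c) * h ω ∂P) := by
        rw [ofReal_integral_eq_lintegral_ofReal (hh.const_mul _)]
        filter_upwards [hle] with ω hω
        have := (Real.exp_pos (f ω)).le.trans hω
        simp only [Pi.zero_apply]
        positivity
    _ = _ := by rw [integral_const_mul]

theorem integrable_exp_sq_of_lintegral_le {G : Ω → ℝ} (hG : AEMeasurable G P)
    (hG2 : ∫⁻ ω, ENNReal.ofReal (Real.exp (G ω ^ 2)) ∂P ≤ 2) :
    Integrable (fun ω => Real.exp (G ω ^ 2)) P ∧ ∫ ω, Real.exp (G ω ^ 2) ∂P ≤ 2 := by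
  have hm : AEStronglyMeasurable (fun ω => Real.exp (G ω ^ 2)) P :=
    (Real.measurable_exp.comp_aemeasurable (hG.pow_const 2)).aestronglyMeasurable
  have hnn : 0 ≤ᵐ[P] fun ω => Real.exp (G ω ^ 2) := ae_of_all _ fun ω => (Real.exp_pos _).le
  refine ⟨(lintegral_ofReal_ne_top_iff_integrable hm hnn).1
    (ne_top_of_le_ne_top (by norm_num) hG2), ?_⟩
  rw [integral_eq_lintegral_of_nonneg_ae hnn hm]
  exact ENNReal.toReal_le_of_le_ofReal (by norm_num) (by simpa using hG2)

/-- The exponential moments of a centred variable dominated by `β G`, with `𝔼 exp (G ^ 2) ≤ 2`,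
are those of a Gaussian of variance `4 β ^ 2`. -/
theorem lintegral_exp_centered_le [IsProbabilityMeasure P] {ξ G : Ω → ℝ} {β : ℝ} (hβ : 0 ≤ β)
    (hξ : AEMeasurable ξ P) (hG : AEMeasurable G P)
    (hG2 : ∫⁻ ω, ENNReal.ofReal (Real.exp (G ω ^ 2)) ∂P ≤ 2)
    (hle : ∀ᵐ ω ∂P, |ξ ω| ≤ β * |G ω|) (lam : ℝ) :
    ∫⁻ ω, ENNReal.ofReal (Real.exp (lam * (ξ ω - ∫ ω', ξ ω' ∂P))) ∂P ≤
      ENNReal.ofReal (Real.exp (2 * lam ^ 2 * β ^ 2)) := by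
  obtain ⟨hGi, hG2'⟩ := integrable_exp_sq_of_lintegral_le hG hG2
  have hξ1 : ∀ᵐ ω ∂P, ‖ξ ω‖ ≤ β / 2 * Real.exp (G ω ^ 2) := by
    filter_upwards [hle] with ω hω
    have h1 := Real.add_one_le_exp (G ω ^ 2)
    have h2 : 2 * |G ω| ≤ G ω ^ 2 + 1 := by
      have := sq_nonneg (|G ω| - 1)
      rw [sub_sq, sq_abs] at this; linarith
    rw [Real.norm_eq_abs]
    nlinarith
  have hξi : Integrable ξ P := (hGi.const_mul (β / 2)).mono' hξ.aestronglyMeasurable hξ1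
  have hEξ : |∫ ω, ξ ω ∂P| ≤ β := by
    calc |∫ ω, ξ ω ∂P| ≤ ∫ ω, β / 2 * Real.exp (G ω ^ 2) ∂P :=
          norm_integral_le_of_norm_le (hGi.const_mul _) hξ1
      _ ≤ β / 2 * 2 := by rw [integral_const_mul]; gcongr
      _ = β := by ring
  simp only [mul_sub]
  rcases le_or_gt (|lam| * β) 1 with h | h
  · have hs1 : lam ^ 2 * β ^ 2 ≤ 1 := by
      rw [← sq_abs, ← mul_pow]; exact pow_le_one₀ (by positivity) h
    have hhi : Integrable (fun ω => lam * ξ ω + (1 + lam ^ 2 * β ^ 2 *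
        (Real.exp (G ω ^ 2) - 1))) P := by
      exact (hξi.const_mul lam).add ((integrable_const _).add
        ((hGi.sub (integrable_const _)).const_mul _))
    refine (lintegral_exp_sub_le_of_le (f := fun ω => lam * ξ ω) hhi ?_ _).trans ?_
    · filter_upwards [hle] with ω hω
      have h1 := exp_le_add_exp_sq (lam * ξ ω)
      have h2 : Real.exp ((lam * ξ ω) ^ 2) ≤ Real.exp (lam ^ 2 * β ^ 2 * G ω ^ 2) := by
        apply Real.exp_le_exp.2
        have : ξ ω ^ 2 ≤ β ^ 2 * G ω ^ 2 := by
          rw [← sq_abs (ξ ω), ← sq_abs (G ω), ← mul_pow]; gcongr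
        rw [mul_pow, mul_assoc]; gcongr
      have h3 := exp_mul_le_one_add (u := G ω ^ 2) (by positivity : 0 ≤ lam ^ 2 * β ^ 2) hs1
      linarith
    · apply ENNReal.ofReal_le_ofReal
      rw [integral_add (hξi.const_mul lam) (integrable_affine (integral_sub_one hGi).1 _).1,
        (integrable_affine (integral_sub_one hGi).1 _).2, integral_const_mul,
        (integral_sub_one hGi).2]
      set e := ∫ ω, ξ ω ∂P
      set v := lam ^ 2 * β ^ 2 with hv
      have hv0 : 0 ≤ v := by positivity
      calc Real.exp (-(lam * e)) * (lam * e + (1 + v * (∫ ω, Real.exp (G ω ^ 2) ∂P - 1)))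
          ≤ Real.exp (-(lam * e)) * Real.exp (lam * e + v) := by
            gcongr
            have := Real.add_one_le_exp (lam * e + v)
            nlinarith
        _ = Real.exp v := by rw [← Real.exp_add]; ring_nf
        _ ≤ _ := by gcongr; nlinarith
  · have hβ0 : 0 < β := by
      rcases hβ.eq_or_lt with h0 | h0
      · rw [← h0] at h; norm_num at h
      · exact h0
    set y := |lam| * β with hy
    have hy2 : y ^ 2 = lam ^ 2 * β ^ 2 := by rw [hy, mul_pow, sq_abs]
    have hhi : Integrable (fun ω => Real.exp (y ^ 2 / 2) *
        (1 + 1 / 2 * (Real.exp (G ω ^ 2) - 1))) P :=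
      ((integrable_const _).add ((hGi.sub (integrable_const _)).const_mul _)).const_mul _
    refine (lintegral_exp_sub_le_of_le (f := fun ω => lam * ξ ω) hhi ?_ _).trans ?_
    · filter_upwards [hle] with ω hω
      have h3 := exp_mul_le_one_add (u := G ω ^ 2) (by norm_num : (0 : ℝ) ≤ 1 / 2) (by norm_num)
      calc Real.exp (lam * ξ ω) ≤ Real.exp (y ^ 2 / 2 + 1 / 2 * G ω ^ 2) := by
            apply Real.exp_le_exp.2
            have h4 : lam * ξ ω ≤ y * |G ω| := by
              calc lam * ξ ω ≤ |lam| * |ξ ω| := by rw [← abs_mul]; exact le_abs_self _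
                _ ≤ |lam| * (β * |G ω|) := by gcongr
                _ = _ := by rw [hy]; ring
            have h5 := sq_nonneg (y - |G ω|)
            rw [sub_sq, sq_abs] at h5
            linarith
        _ ≤ _ := by rw [Real.exp_add]; gcongr
    · apply ENNReal.ofReal_le_ofReal
      rw [integral_const_mul, (integrable_affine (integral_sub_one hGi).1 _).2,
        (integral_sub_one hGi).2]
      set e := ∫ ω, ξ ω ∂P
      have h1 : -(lam * e) ≤ y := by
        calc -(lam * e) ≤ |lam| * |e| := by rw [← abs_mul]; exact neg_le_abs _
          _ ≤ _ := by rw [hy]; gcongr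
      have h32 : (1 : ℝ) + 1 / 2 * (∫ ω, Real.exp (G ω ^ 2) ∂P - 1) ≤ Real.exp (1 / 2) := by
        have := Real.add_one_le_exp (1 / 2 : ℝ)
        linarith
      have h0 : 0 ≤ ∫ ω, Real.exp (G ω ^ 2) ∂P := integral_nonneg fun ω => (Real.exp_pos _).le
      calc _ ≤ Real.exp y * (Real.exp (y ^ 2 / 2) * Real.exp (1 / 2)) :=
            mul_le_mul (Real.exp_le_exp.2 h1)
              (mul_le_mul_of_nonneg_left h32 (Real.exp_pos _).le)
              (mul_nonneg (Real.exp_pos _).le (by linarith)) (Real.exp_pos _).le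
        _ = Real.exp (y + (y ^ 2 / 2 + 1 / 2)) := by rw [← Real.exp_add, ← Real.exp_add]
        _ ≤ _ := by
          apply Real.exp_le_exp.2
          rw [mul_assoc, ← hy2]
          nlinarith

/-- Bernstein's bound: as long as `|λ ξ| ≤ 1`, only the second moment enters. -/
theorem lintegral_exp_centered_le_of_bounded [IsProbabilityMeasure P] {ξ : Ω → ℝ} {v lam : ℝ}
    (hξ : AEMeasurable ξ P) (hsq : Integrable (fun ω => ξ ω ^ 2) P)
    (hv : ∫ ω, ξ ω ^ 2 ∂P ≤ v) (hle : ∀ᵐ ω ∂P, |lam * ξ ω| ≤ 1) :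
    ∫⁻ ω, ENNReal.ofReal (Real.exp (lam * (ξ ω - ∫ ω', ξ ω' ∂P))) ∂P ≤
      ENNReal.ofReal (Real.exp (lam ^ 2 * v)) := by
  have hξi : Integrable ξ P := by
    refine (hsq.add (integrable_const (1 : ℝ))).mono' hξ.aestronglyMeasurable
      (ae_of_all _ fun ω => ?_)
    have := sq_nonneg (|ξ ω| - 1 / 2)
    rw [sub_sq, sq_abs] at this
    simp only [Pi.add_apply, Real.norm_eq_abs]
    linarith
  simp only [mul_sub]
  have hhi : Integrable (fun ω => lam * ξ ω + (1 + lam ^ 2 * ξ ω ^ 2)) P :=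
    (hξi.const_mul lam).add ((integrable_const _).add (hsq.const_mul _))
  refine (lintegral_exp_sub_le_of_le (f := fun ω => lam * ξ ω) hhi ?_ _).trans ?_
  · filter_upwards [hle] with ω hω
    have := (abs_le.1 (Real.abs_exp_sub_one_sub_id_le hω)).2
    rw [mul_pow] at this
    linarith
  · apply ENNReal.ofReal_le_ofReal
    rw [integral_add (hξi.const_mul lam) (integrable_affine hsq _).1,
      (integrable_affine hsq _).2, integral_const_mul]
    set e := ∫ ω, ξ ω ∂P
    calc Real.exp (-(lam * e)) * (lam * e + (1 + lam ^ 2 * ∫ ω, ξ ω ^ 2 ∂P))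
        ≤ Real.exp (-(lam * e)) * Real.exp (lam * e + lam ^ 2 * v) := by
          gcongr
          have := Real.add_one_le_exp (lam * e + lam ^ 2 * v)
          have : lam ^ 2 * ∫ ω, ξ ω ^ 2 ∂P ≤ lam ^ 2 * v := by gcongr
          linarith
      _ = _ := by rw [← Real.exp_add]; ring_nf

theorem lintegral_prod_eq_prod_lintegral_of_aemeasurable {ι : Type*} [Fintype ι]
    (f : ι → Ω → ℝ≥0∞) (hind : iIndepFun f P) (hf : ∀ e, AEMeasurable (f e) P) :
    ∫⁻ ω, ∏ e, f e ω ∂P = ∏ e, ∫⁻ ω, f e ω ∂P := by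
  have h1 : iIndepFun (fun e => (hf e).mk) P := hind.congr fun e => (hf e).ae_eq_mk
  have h2 := lintegral_prod_eq_prod_lintegral_of_indepFun Finset.univ _ h1
    fun e => (hf e).measurable_mk
  have h3 : ∀ᵐ ω ∂P, ∀ e, f e ω = (hf e).mk (f e) ω := ae_all_iff.2 fun e => (hf e).ae_eq_mk
  calc _ = ∫⁻ ω, ∏ e, (hf e).mk (f e) ω ∂P := by
        refine lintegral_congr_ae ?_
        filter_upwards [h3] with ω hω
        exact Finset.prod_congr rfl fun e _ => hω e
    _ = _ := h2
    _ = _ := Finset.prod_congr rfl fun e _ => lintegral_congr_ae (hf e).ae_eq_mk.symm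

theorem lintegral_exp_abs_sum_le {ι : Type*} [Fintype ι] {ξ : ι → Ω → ℝ}
    (hind : iIndepFun ξ P) (hξ : ∀ e, AEMeasurable (ξ e) P) {s D : ℝ} (hs : 0 < s) (v : ι → ℝ)
    (hv : ∑ e, v e ≤ D)
    (h : ∀ e, ∀ lam : ℝ, |lam| = 1 / s →
      ∫⁻ ω, ENNReal.ofReal (Real.exp (lam * (ξ e ω - ∫ ω', ξ e ω' ∂P))) ∂P ≤
        ENNReal.ofReal (Real.exp (v e))) :
    ∫⁻ ω, ENNReal.ofReal (Real.exp (|∑ e, (ξ e ω - ∫ ω', ξ e ω' ∂P)| / s)) ∂P ≤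
      ENNReal.ofReal (2 * Real.exp D) := by
  have hmeas : ∀ (e : ι) (lam : ℝ), Measurable fun x : ℝ =>
      ENNReal.ofReal (Real.exp (lam * (x - ∫ ω', ξ e ω' ∂P))) := fun e lam => by fun_prop
  have key : ∀ lam : ℝ, |lam| = 1 / s →
      ∫⁻ ω, ENNReal.ofReal (Real.exp (lam * ∑ e, (ξ e ω - ∫ ω', ξ e ω' ∂P))) ∂P ≤
        ENNReal.ofReal (Real.exp D) := by
    intro lam hlam
    calc _ = ∫⁻ ω, ∏ e, ENNReal.ofReal (Real.exp (lam * (ξ e ω - ∫ ω', ξ e ω' ∂P))) ∂P := by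
          refine lintegral_congr fun ω => ?_
          rw [Finset.mul_sum, Real.exp_sum, ENNReal.ofReal_prod_of_nonneg]
          exact fun e _ => (Real.exp_pos _).le
      _ = ∏ e, ∫⁻ ω, ENNReal.ofReal (Real.exp (lam * (ξ e ω - ∫ ω', ξ e ω' ∂P))) ∂P :=
          lintegral_prod_eq_prod_lintegral_of_aemeasurable _
            (hind.comp _ fun e => hmeas e lam) fun e => (hmeas e lam).comp_aemeasurable (hξ e)
      _ ≤ ∏ e, ENNReal.ofReal (Real.exp (v e)) := Finset.prod_le_prod' fun e _ => h e lam hlam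
      _ = ENNReal.ofReal (Real.exp (∑ e, v e)) := by
          rw [Real.exp_sum, ENNReal.ofReal_prod_of_nonneg]
          exact fun e _ => (Real.exp_pos _).le
      _ ≤ _ := by gcongr
  have hm : AEMeasurable (fun ω => ENNReal.ofReal (Real.exp (1 / s *
      ∑ e, (ξ e ω - ∫ ω', ξ e ω' ∂P)))) P := by
    have h1 : AEMeasurable (fun ω => ∑ e, (ξ e ω - ∫ ω', ξ e ω' ∂P)) P :=
      Finset.aemeasurable_fun_sum _ fun e _ => (hξ e).sub_const _
    exact (by fun_prop : Measurable fun x : ℝ =>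
      ENNReal.ofReal (Real.exp (1 / s * x))).comp_aemeasurable h1
  calc _ ≤ ∫⁻ ω, (ENNReal.ofReal (Real.exp (1 / s * ∑ e, (ξ e ω - ∫ ω', ξ e ω' ∂P))) +
        ENNReal.ofReal (Real.exp (-(1 / s) * ∑ e, (ξ e ω - ∫ ω', ξ e ω' ∂P)))) ∂P := by
        refine lintegral_mono fun ω => ?_
        rcases abs_cases (∑ e, (ξ e ω - ∫ ω', ξ e ω' ∂P)) with ⟨h, _⟩ | ⟨h, _⟩
        · rw [h]
          refine le_add_right (le_of_eq ?_)
          ring_nf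
        · rw [h]
          refine le_add_left (le_of_eq ?_)
          ring_nf
    _ ≤ ENNReal.ofReal (Real.exp D) + ENNReal.ofReal (Real.exp D) := by
        rw [lintegral_add_left' hm]
        gcongr
        · exact key _ (abs_of_pos (by positivity))
        · exact key _ (by rw [abs_neg]; exact abs_of_pos (by positivity))
    _ = _ := by rw [← ENNReal.ofReal_add (by positivity) (by positivity), two_mul]

/-! ### Tails of a single variable -/

variable {X : Ω → ℝ}

/-- The infimum in the Orlicz norm need not be known to be attained: any larger constant will do. -/
theorem lintegral_psi_le_of_orliczNorm_le {k : ℕ} {α β : ℝ} (hα : 0 ≤ α) (hαβ : α < β)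
    (h : orliczNorm (psi k) X P ≤ ENNReal.ofReal α) :
    ∫⁻ ω, ENNReal.ofReal (psi k (|X ω| / β)) ∂P ≤ 1 := by
  have h1 := h.trans_lt ((ENNReal.ofReal_lt_ofReal_iff (hα.trans_lt hαβ)).2 hαβ)
  simp only [orliczNorm, iInf_lt_iff] at h1
  obtain ⟨C, hC, hC1, hC2⟩ := h1
  have hCβ := (ENNReal.ofReal_lt_ofReal_iff (hα.trans_lt hαβ)).1 hC2
  refine (lintegral_mono fun ω => ENNReal.ofReal_le_ofReal ?_).trans hC1
  have : 0 ≤ |X ω| / β := div_nonneg (abs_nonneg _) (hα.trans hαβ.le)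
  simp only [psi]
  gcongr

theorem exp_quarter_le : Real.exp (1 / 4) ≤ 8 / 5 := by
  have h1 : Real.exp (1 / 4) ^ 4 = Real.exp 1 := by
    rw [← Real.exp_nat_mul]; norm_num
  have h2 := Real.exp_one_lt_d9
  refine le_of_pow_le_pow_left₀ (n := 4) (by norm_num) (by norm_num) ?_
  rw [h1]
  norm_num
  linarith

theorem lintegral_exp_sq_sqrt_le [IsProbabilityMeasure P] {β : ℝ}
    (h : ∫⁻ ω, ENNReal.ofReal (psi 2 (|X ω| / β)) ∂P ≤ 1) :
    ∫⁻ ω, ENNReal.ofReal (Real.exp (√((1 + (X ω / β) ^ 2) / 4) ^ 2)) ∂P ≤ 2 := by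
  have h1 : ∀ ω, ENNReal.ofReal (Real.exp (√((1 + (X ω / β) ^ 2) / 4) ^ 2)) ≤
      ENNReal.ofReal (8 / 5) + ENNReal.ofReal (2 / 5) *
        ENNReal.ofReal (psi 2 (|X ω| / β)) := by
    intro ω
    have hpsi : psi 2 (|X ω| / β) = Real.exp ((X ω / β) ^ 2) - 1 := by
      rw [psi, div_pow, sq_abs, div_pow]
    have h0 : 0 ≤ psi 2 (|X ω| / β) := by
      rw [hpsi]
      have := Real.add_one_le_exp ((X ω / β) ^ 2)
      have := sq_nonneg (X ω / β)
      linarith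
    rw [← ENNReal.ofReal_mul (by norm_num), ← ENNReal.ofReal_add (by norm_num) (by positivity)]
    apply ENNReal.ofReal_le_ofReal
    rw [Real.sq_sqrt (by positivity), hpsi,
      show (1 + (X ω / β) ^ 2) / 4 = 1 / 4 + 1 / 4 * (X ω / β) ^ 2 by ring, Real.exp_add]
    have h2 := exp_mul_le_one_add (u := (X ω / β) ^ 2) (by norm_num : (0 : ℝ) ≤ 1 / 4)
      (by norm_num)
    calc _ ≤ 8 / 5 * (1 + 1 / 4 * (Real.exp ((X ω / β) ^ 2) - 1)) := by
          gcongr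
          exact exp_quarter_le
      _ = _ := by ring
  refine (lintegral_mono h1).trans ?_
  rw [lintegral_add_left (by fun_prop), lintegral_const, measure_univ, mul_one,
    lintegral_const_mul' _ _ ENNReal.ofReal_ne_top]
  calc _ ≤ ENNReal.ofReal (8 / 5) + ENNReal.ofReal (2 / 5) * 1 := by gcongr
    _ = 2 := by
      rw [mul_one, ← ENNReal.ofReal_add (by norm_num) (by norm_num)]
      norm_num

theorem integral_indicator_one_of_nullMeasurableSet {s : Set Ω} (hs : NullMeasurableSet s P) :
    ∫ ω, s.indicator (1 : Ω → ℝ) ω ∂P = P.real s := by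
  rw [integral_indicator₀ hs]
  simp

/-- Markov's inequality for the excess over a level. -/
theorem tail_le_of_le [IsProbabilityMeasure P] (hX : AEMeasurable X P) {f : ℝ → ℝ} {τ v b A B : ℝ}
    (hfi : Integrable (fun ω => f (X ω)) P) (hA : 0 ≤ A) (hB : 0 ≤ B) (hf0 : ∀ x, 0 ≤ f x)
    (h1 : ∀ x, τ < |x| → 1 ≤ A * f x) (h2 : ∀ x, τ < |x| → |x| ≤ B * f x)
    (hv : A * ∫ ω, f (X ω) ∂P ≤ v) (hb : B * ∫ ω, f (X ω) ∂P ≤ b) :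
    Integrable X P ∧ P.real {ω | τ < |X ω|} ≤ v ∧
      ∫ ω, (Set.Ioi τ).indicator id |X ω| ∂P ≤ b := by
  have hXi : Integrable X P := by
    refine ((integrable_const |τ|).add (hfi.const_mul B)).mono' hX.aestronglyMeasurable
      (ae_of_all _ fun ω => ?_)
    rw [Real.norm_eq_abs]
    simp only [Pi.add_apply]
    rcases lt_or_ge τ |X ω| with h | h
    · linarith [h2 _ h, abs_nonneg τ]
    · have := mul_nonneg hB (hf0 (X ω))
      linarith [le_abs_self τ]
  have hms : NullMeasurableSet {ω | τ < |X ω|} P :=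
    nullMeasurableSet_lt aemeasurable_const (by fun_prop)
  refine ⟨hXi, ?_, ?_⟩
  · rw [← integral_indicator_one_of_nullMeasurableSet hms]
    refine le_trans ?_ hv
    rw [← integral_const_mul]
    refine integral_mono_of_nonneg (ae_of_all _ fun ω => Set.indicator_nonneg (by simp) _)
      (hfi.const_mul A) (ae_of_all _ fun ω => ?_)
    by_cases h : τ < |X ω|
    · simp only [Set.indicator_of_mem (show ω ∈ {ω | τ < |X ω|} from h), Pi.one_apply]
      exact h1 _ h
    · simp only [Set.indicator_of_notMem (show ω ∉ {ω | τ < |X ω|} from h)]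
      exact mul_nonneg hA (hf0 _)
  · refine le_trans ?_ hb
    rw [← integral_const_mul]
    refine integral_mono_of_nonneg (ae_of_all _ fun ω => ?_)
      (hfi.const_mul B) (ae_of_all _ fun ω => ?_)
    · by_cases h : |X ω| ∈ Set.Ioi τ
      · simp only [Set.indicator_of_mem h, Pi.zero_apply, id]; exact abs_nonneg _
      · simp only [Set.indicator_of_notMem h, Pi.zero_apply, le_refl]
    · by_cases h : |X ω| ∈ Set.Ioi τ
      · simp only [Set.indicator_of_mem h, id]; exact h2 _ h
      · simp only [Set.indicator_of_notMem h]; exact mul_nonneg hB (hf0 _)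

/-- The constant `3 / 2 * α` in place of `α` makes room for an Orlicz norm that is an infimum. -/
theorem tail_le_of_orliczNorm_one [IsProbabilityMeasure P] (hX : AEMeasurable X P) {α U : ℝ}
    (hα : 0 < α) (hU : 1 ≤ U) (h : orliczNorm (psi 1) X P ≤ ENNReal.ofReal α) :
    Integrable X P ∧ P.real {ω | 3 / 2 * α * U < |X ω|} ≤ 2 * Real.exp (-U) ∧
      ∫ ω, (Set.Ioi (3 / 2 * α * U)).indicator id |X ω| ∂P ≤ 3 * α * U * Real.exp (-U) := by
  set β := 3 / 2 * α with hβ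
  have hβ0 : 0 < β := by positivity
  have h1 := lintegral_psi_le_of_orliczNorm_le (β := β) hα.le (by linarith) h
  simp only [psi, pow_one] at h1
  have hm : AEMeasurable (fun ω => Real.exp (|X ω| / β) - 1) P := by fun_prop
  have hpos : ∀ ω, 0 ≤ Real.exp (|X ω| / β) - 1 := fun ω => by
    have := Real.add_one_le_exp (|X ω| / β)
    have : 0 ≤ |X ω| / β := by positivity
    linarith
  have hi1 : Integrable (fun ω => Real.exp (|X ω| / β) - 1) P := by
    refine ⟨hm.aestronglyMeasurable, ?_⟩
    rw [hasFiniteIntegral_iff_ofReal (ae_of_all _ hpos)]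
    exact h1.trans_lt ENNReal.one_lt_top
  have hi : Integrable (fun ω => Real.exp (|X ω| / β)) P := by
    refine (hi1.add (integrable_const 1)).congr (ae_of_all _ fun ω => ?_)
    simp
  have hE : ∫ ω, Real.exp (|X ω| / β) ∂P ≤ 2 := by
    have h2 : ∫ ω, (Real.exp (|X ω| / β) - 1) ∂P ≤ 1 := by
      rw [integral_eq_lintegral_of_nonneg_ae (ae_of_all _ hpos) hm.aestronglyMeasurable]
      exact ENNReal.toReal_le_of_le_ofReal zero_le_one (by simpa using h1)
    rw [integral_sub hi (integrable_const 1)] at h2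
    simp at h2
    linarith
  have hexp : ∀ x : ℝ, Real.exp (-U) * Real.exp (|x| / β) = Real.exp (|x| / β - U) := fun x => by
    rw [← Real.exp_add]; congr 1; ring
  refine tail_le_of_le hX (f := fun x => Real.exp (|x| / β)) (A := Real.exp (-U))
    (B := β * U * Real.exp (-U)) hi (Real.exp_pos _).le (by positivity)
    (fun x => (Real.exp_pos _).le) (fun x hx => ?_) (fun x hx => ?_) ?_ ?_
  · rw [hexp]
    apply Real.one_le_exp
    have : U < |x| / β := by rw [lt_div_iff₀ hβ0]; linarith
    linarith
  · rw [mul_assoc, hexp]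
    have h3 : U < |x| / β := by rw [lt_div_iff₀ hβ0]; linarith
    have h4 := Real.add_one_le_exp (|x| / β - U)
    have h5 : |x| / β ≤ U * Real.exp (|x| / β - U) := by
      calc |x| / β = U + (|x| / β - U) := by ring
        _ ≤ U + U * (|x| / β - U) := by
          have : 0 ≤ (U - 1) * (|x| / β - U) := mul_nonneg (by linarith) (by linarith)
          linarith
        _ = U * (|x| / β - U + 1) := by ring
        _ ≤ _ := by gcongr
    calc |x| = β * (|x| / β) := by field_simp
      _ ≤ β * (U * Real.exp (|x| / β - U)) := by gcongr
      _ = _ := by ring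
  · rw [mul_comm]; gcongr
  · calc _ ≤ β * U * Real.exp (-U) * 2 := by gcongr
      _ = _ := by rw [hβ]; ring

theorem integrable_rpow_of_eLpNorm_le (hX : AEMeasurable X P) {r α : ℝ}
    (hr : 0 < r) (hα : 0 ≤ α) (h : eLpNorm X (ENNReal.ofReal r) P ≤ ENNReal.ofReal α) :
    Integrable (fun ω => |X ω| ^ r) P ∧ ∫ ω, |X ω| ^ r ∂P ≤ α ^ r := by
  have hr0 : ENNReal.ofReal r ≠ 0 := by simpa using hr
  have hL : MemLp X (ENNReal.ofReal r) P :=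
    ⟨hX.aestronglyMeasurable, h.trans_lt ENNReal.ofReal_lt_top⟩
  have hi := hL.integrable_norm_rpow hr0 ENNReal.ofReal_ne_top
  rw [hL.eLpNorm_eq_integral_rpow_norm hr0 ENNReal.ofReal_ne_top] at h
  rw [ENNReal.toReal_ofReal hr.le] at hi h
  refine ⟨hi, ?_⟩
  have h1 := (ENNReal.ofReal_le_ofReal_iff hα).1 h
  have h0 : 0 ≤ ∫ ω, ‖X ω‖ ^ r ∂P := integral_nonneg fun ω => by positivity
  have h2 := Real.rpow_le_rpow (by positivity) h1 hr.le
  rwa [← Real.rpow_mul h0, inv_mul_cancel₀ hr.ne', Real.rpow_one] at h2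

theorem tail_le_of_eLpNorm [IsProbabilityMeasure P] (hX : AEMeasurable X P) {r α K : ℝ}
    (hr : 1 ≤ r) (hα : 0 < α) (hK : 0 < K)
    (h : eLpNorm X (ENNReal.ofReal r) P ≤ ENNReal.ofReal α) :
    Integrable X P ∧ P.real {ω | α * K < |X ω|} ≤ K ^ (-r) ∧
      ∫ ω, (Set.Ioi (α * K)).indicator id |X ω| ∂P ≤ α * K ^ (-(r - 1)) := by
  obtain ⟨hi, hE⟩ := integrable_rpow_of_eLpNorm_le hX (by linarith) hα.le h
  have hαK : 0 < α * K := by positivity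
  have hα1 : α ^ (-r) * α ^ r = 1 := by rw [← Real.rpow_add hα]; simp
  refine tail_le_of_le hX (f := fun x => |x| ^ r) (A := (α * K) ^ (-r))
    (B := (α * K) ^ (-(r - 1))) hi (by positivity) (by positivity) (fun x => by positivity)
    (fun x hx => ?_) (fun x hx => ?_) ?_ ?_
  · rw [Real.rpow_neg hαK.le, ← div_eq_inv_mul, one_le_div (by positivity)]
    gcongr
  · have hx0 : 0 < |x| := hαK.trans hx
    rw [Real.rpow_neg hαK.le, ← div_eq_inv_mul, le_div_iff₀ (by positivity)]
    calc |x| * (α * K) ^ (r - 1) ≤ |x| * |x| ^ (r - 1) := by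
          gcongr
      _ = |x| ^ r := by
          rw [Real.rpow_sub_one hx0.ne']; field_simp
  · rw [Real.mul_rpow hα.le hK.le]
    calc _ ≤ α ^ (-r) * K ^ (-r) * α ^ r := by gcongr
      _ = K ^ (-r) * (α ^ (-r) * α ^ r) := by ring
      _ = _ := by rw [hα1, mul_one]
  · rw [Real.mul_rpow hα.le hK.le]
    calc _ ≤ α ^ (-(r - 1)) * K ^ (-(r - 1)) * α ^ r := by gcongr
      _ = (α ^ (-(r - 1)) * α ^ r) * K ^ (-(r - 1)) := by ring
      _ = _ := by rw [← Real.rpow_add hα]; norm_num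

end Moments

/-! ### Parametrizations of low-rank matrices -/

/-- The pairs `(U, V)`, `U` with the operator norm and `V` (a family of `n₂` columns) with the
Frobenius norm, which parametrize the `n₁ × n₂` matrices `U V` of rank at most `k`. -/
abbrev FrobParam (k n₁ n₂ : ℕ) : Type :=
  (EuclideanSpace ℝ (Fin k) →L[ℝ] EuclideanSpace ℝ (Fin n₁)) ×
    PiLp 2 (fun _ : Fin n₂ => EuclideanSpace ℝ (Fin k))

/-- The pairs `(U, V)` of factors, with the entrywise maximum norm. -/
abbrev SupParam (k n₁ n₂ : ℕ) : Type :=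
  (Fin n₁ → Fin k → ℝ) × (Fin n₂ → Fin k → ℝ)

theorem finrank_frobParam (k n₁ n₂ : ℕ) :
    Module.finrank ℝ (FrobParam k n₁ n₂) = k * (n₁ + n₂) := by
  have h : Module.finrank ℝ (PiLp 2 (fun _ : Fin n₂ => EuclideanSpace ℝ (Fin k))) = n₂ * k := by
    rw [(WithLp.linearEquiv 2 ℝ _).finrank_eq, Module.finrank_pi_fintype]; simp
  rw [Module.finrank_prod, ← LinearMap.toContinuousLinearMap.finrank_eq,
    Module.finrank_linearMap, h]
  simp
  ring

theorem finrank_supParam (k n₁ n₂ : ℕ) :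
    Module.finrank ℝ (SupParam k n₁ n₂) = k * (n₁ + n₂) := by
  have h : ∀ n : ℕ, Module.finrank ℝ (Fin n → Fin k → ℝ) = n * k := fun n => by
    rw [Module.finrank_pi_fintype]; simp
  rw [Module.finrank_prod, h, h]
  ring

section LowRank

variable {n₁ n₂ k : ℕ}

theorem exists_linearIsometry_of_finrank_le {W : Type*} [NormedAddCommGroup W]
    [InnerProductSpace ℝ W] [FiniteDimensional ℝ W] (h : Module.finrank ℝ W ≤ k) :
    Nonempty (W →ₗᵢ[ℝ] EuclideanSpace ℝ (Fin k)) := by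
  let b := stdOrthonormalBasis ℝ W
  let v : Fin (Module.finrank ℝ W) → EuclideanSpace ℝ (Fin k) :=
    EuclideanSpace.basisFun (Fin k) ℝ ∘ Fin.castLE h
  have hv : Orthonormal ℝ v :=
    (EuclideanSpace.basisFun (Fin k) ℝ).orthonormal.comp _ (Fin.castLE_injective h)
  refine ⟨(b.toBasis.constr ℝ v).isometryOfOrthonormal (v := b.toBasis) ?_ ?_⟩
  · rw [b.coe_toBasis]; exact b.orthonormal
  · convert hv
    ext i
    simp

/-- A matrix of rank at most `k` and Frobenius norm at most `r` is `r U V` with `U` and `V` in the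
unit balls: take for `U` an orthonormal basis of the column space. -/
theorem exists_frobParam {A : Matrix (Fin n₁) (Fin n₂) ℝ} (hA : A.rank ≤ k) {r : ℝ} (hr : 0 < r)
    (hAr : ∑ i, ∑ j, A i j ^ 2 ≤ r ^ 2) :
    ∃ q : FrobParam k n₁ n₂, ‖q‖ ≤ 1 ∧ ∀ i j, A i j = r * (q.1 (q.2 j)) i := by
  let e : (Fin n₁ → ℝ) ≃ₗ[ℝ] EuclideanSpace ℝ (Fin n₁) := (WithLp.linearEquiv 2 ℝ _).symm
  let W := (Submodule.span ℝ (Set.range A.col)).map e.toLinearMap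
  have hW : Module.finrank ℝ W ≤ k := by
    rw [Matrix.rank_eq_finrank_span_cols] at hA
    exact (e.finrank_map_eq _).trans_le hA
  obtain ⟨J⟩ := exists_linearIsometry_of_finrank_le hW
  let c : Fin n₂ → W := fun j => ⟨e (A.col j),
    Submodule.mem_map_of_mem (Submodule.subset_span ⟨j, rfl⟩)⟩
  let U : EuclideanSpace ℝ (Fin k) →L[ℝ] EuclideanSpace ℝ (Fin n₁) :=
    W.subtypeL ∘L ContinuousLinearMap.adjoint J.toContinuousLinearMap
  let V : PiLp 2 (fun _ : Fin n₂ => EuclideanSpace ℝ (Fin k)) :=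
    WithLp.toLp 2 fun j => r⁻¹ • J (c j)
  have hJ : ‖J.toContinuousLinearMap‖ ≤ 1 := J.norm_toContinuousLinearMap_le
  refine ⟨(U, V), ?_, ?_⟩
  · refine max_le ?_ ?_
    · calc ‖U‖ ≤ ‖W.subtypeL‖ * ‖ContinuousLinearMap.adjoint J.toContinuousLinearMap‖ :=
            ContinuousLinearMap.opNorm_comp_le _ _
        _ ≤ 1 * 1 := by
            gcongr
            · exact W.norm_subtypeL_le
            · rwa [LinearIsometryEquiv.norm_map]
        _ = 1 := one_mul 1
    · have h1 : ‖V‖ ^ 2 ≤ 1 := by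
        rw [PiLp.norm_sq_eq_of_L2]
        calc ∑ j, ‖r⁻¹ • J (c j)‖ ^ 2 = ∑ j, (r⁻¹) ^ 2 * ∑ i, A i j ^ 2 := by
              refine Finset.sum_congr rfl fun j _ => ?_
              rw [norm_smul, mul_pow, J.norm_map, Real.norm_eq_abs, sq_abs]
              congr 1
              change ‖e (A.col j)‖ ^ 2 = _
              rw [EuclideanSpace.norm_sq_eq]
              refine Finset.sum_congr rfl fun i _ => ?_
              rw [Real.norm_eq_abs, sq_abs]
              rfl
          _ = (r⁻¹) ^ 2 * ∑ i, ∑ j, A i j ^ 2 := by rw [← Finset.mul_sum, Finset.sum_comm]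
          _ ≤ (r⁻¹) ^ 2 * r ^ 2 := by gcongr
          _ = 1 := by field_simp
      exact (sq_le_one_iff₀ (norm_nonneg _)).1 h1
  · intro i j
    have h1 : U (V j) = r⁻¹ • e (A.col j) := by
      change ((ContinuousLinearMap.adjoint J.toContinuousLinearMap) (r⁻¹ • J (c j)) :
        EuclideanSpace ℝ (Fin n₁)) = _
      rw [map_smul]
      have h2 : (ContinuousLinearMap.adjoint J.toContinuousLinearMap) (J (c j)) = c j :=
        DFunLike.congr_fun J.adjoint_comp_self (c j)
      rw [h2]
      rfl
    change A i j = r * (U (V j)) i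
    rw [h1]
    change A i j = r * (r⁻¹ * A i j)
    field_simp

theorem sum_sq_frobParam_sub_le {q q' : FrobParam k n₁ n₂} (hq : ‖q‖ ≤ 1) (hq' : ‖q'‖ ≤ 1) {r : ℝ}
    {δ : ℝ} (hδ : ‖q - q'‖ ≤ δ) :
    ∑ i, ∑ j, (r * (q.1 (q.2 j)) i - r * (q'.1 (q'.2 j)) i) ^ 2 ≤ 4 * r ^ 2 * δ ^ 2 := by
  have hδ0 : 0 ≤ δ := (norm_nonneg _).trans hδ
  have h1 : ‖q.1 - q'.1‖ ≤ δ := (norm_fst_le (q - q')).trans hδ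
  have h2 : ‖q.2 - q'.2‖ ≤ δ := (norm_snd_le (q - q')).trans hδ
  have h3 : ‖q'.1‖ ≤ 1 := (norm_fst_le q').trans hq'
  have h4 : ‖q.2‖ ≤ 1 := (norm_snd_le q).trans hq
  have hcol : ∀ j, ∑ i, (r * (q.1 (q.2 j)) i - r * (q'.1 (q'.2 j)) i) ^ 2 ≤
      r ^ 2 * (2 * (δ ^ 2 * ‖q.2 j‖ ^ 2 + ‖(q.2 - q'.2) j‖ ^ 2)) := by
    intro j
    have e1 : ∑ i, (r * (q.1 (q.2 j)) i - r * (q'.1 (q'.2 j)) i) ^ 2 =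
        r ^ 2 * ‖q.1 (q.2 j) - q'.1 (q'.2 j)‖ ^ 2 := by
      rw [EuclideanSpace.norm_sq_eq, Finset.mul_sum]
      refine Finset.sum_congr rfl fun i _ => ?_
      rw [Real.norm_eq_abs, sq_abs, ← mul_sub, mul_pow]
      rfl
    have e2 : q.1 (q.2 j) - q'.1 (q'.2 j) = (q.1 - q'.1) (q.2 j) + q'.1 ((q.2 - q'.2) j) := by
      simp
    have e3 : ‖q.1 (q.2 j) - q'.1 (q'.2 j)‖ ≤ δ * ‖q.2 j‖ + ‖(q.2 - q'.2) j‖ := by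
      rw [e2]
      refine (norm_add_le _ _).trans (add_le_add ?_ ?_)
      · exact ((q.1 - q'.1).le_opNorm _).trans (by gcongr)
      · exact ((q'.1).le_opNorm _).trans (mul_le_of_le_one_left (norm_nonneg _) h3)
    rw [e1]
    gcongr
    calc _ ≤ (δ * ‖q.2 j‖ + ‖(q.2 - q'.2) j‖) ^ 2 := by gcongr
      _ ≤ _ := by nlinarith [sq_nonneg (δ * ‖q.2 j‖ - ‖(q.2 - q'.2) j‖)]
  rw [Finset.sum_comm]
  calc _ ≤ ∑ j, r ^ 2 * (2 * (δ ^ 2 * ‖q.2 j‖ ^ 2 + ‖(q.2 - q'.2) j‖ ^ 2)) :=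
        Finset.sum_le_sum fun j _ => hcol j
    _ = r ^ 2 * (2 * (δ ^ 2 * ‖q.2‖ ^ 2 + ‖q.2 - q'.2‖ ^ 2)) := by
        rw [PiLp.norm_sq_eq_of_L2, PiLp.norm_sq_eq_of_L2, ← Finset.mul_sum, ← Finset.mul_sum,
          Finset.sum_add_distrib, ← Finset.mul_sum]
    _ ≤ r ^ 2 * (2 * (δ ^ 2 * 1 ^ 2 + δ ^ 2)) := by gcongr
    _ = _ := by ring

/-- The columns of a matrix are combinations, with coefficients in `[-1, 1]`, of some `rank A` of
them: by Cramer's rule, this holds for a choice of columns of maximal volume. -/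
theorem exists_cols_bounded_coords (A : Matrix (Fin n₁) (Fin n₂) ℝ) :
    ∃ (J : Fin A.rank → Fin n₂) (x : Fin n₂ → Fin A.rank → ℝ),
      (∀ j a, |x j a| ≤ 1) ∧ ∀ i j, A i j = ∑ a, A i (J a) * x j a := by
  set W := Submodule.span ℝ (Set.range A.col) with hWdef
  have hWr : A.rank = Module.finrank ℝ W := Matrix.rank_eq_finrank_span_cols A
  rw [hWr]
  let g : Fin n₂ → W := fun j => ⟨A.col j, Submodule.subset_span ⟨j, rfl⟩⟩
  let b : Module.Basis (Fin (Module.finrank ℝ W)) ℝ W := Module.finBasis ℝ W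
  obtain ⟨f, hfmem, -, hfli⟩ := Submodule.exists_fun_fin_finrank_span_eq ℝ (Set.range A.col)
  choose J₀ hJ₀ using hfmem
  have hli₀ : LinearIndependent ℝ (g ∘ J₀) := by
    refine LinearIndependent.of_comp W.subtype ?_
    have h : W.subtype ∘ (g ∘ J₀) = f := funext hJ₀
    rw [h]
    exact hfli
  have hdet₀ : b.det (g ∘ J₀) ≠ 0 :=
    (b.is_basis_iff_det.1 ⟨hli₀, hli₀.span_eq_top_of_card_eq_finrank' (Fintype.card_fin _)⟩).ne_zero
  have : Nonempty (Fin (Module.finrank ℝ W) → Fin n₂) := ⟨J₀⟩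
  obtain ⟨J, hJ⟩ := Finite.exists_max fun J : Fin (Module.finrank ℝ W) → Fin n₂ =>
    |b.det (g ∘ J)|
  have hpos : 0 < |b.det (g ∘ J)| := (abs_pos.2 hdet₀).trans_le (hJ J₀)
  obtain ⟨hli, hsp⟩ := b.is_basis_iff_det.2 (isUnit_iff_ne_zero.2 (abs_pos.1 hpos))
  let B := Module.Basis.mk hli hsp.ge
  refine ⟨J, fun j a => B.coord a (g j), fun j a => ?_, fun i j => ?_⟩
  · have h1 := DFunLike.congr_fun (b.det_smul_mk_coord_eq_det_update hli hsp.ge a) (g j)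
    have h2 : b.det (g ∘ J) * B.coord a (g j) = b.det (g ∘ Function.update J a j) := by
      rw [Function.comp_update]
      exact h1
    have h3 := hJ (Function.update J a j)
    simp only [← h2, abs_mul] at h3
    exact le_of_mul_le_mul_left (by simpa using h3) hpos
  · have h1 := B.sum_repr (g j)
    have h2 := congrArg (fun w : W => (w : Fin n₁ → ℝ) i) h1
    simp only [Submodule.coe_sum, Finset.sum_apply, Submodule.coe_smul, Pi.smul_apply,
      smul_eq_mul] at h2
    change ∑ a, _ = A i j at h2
    rw [← h2]
    refine Finset.sum_congr rfl fun a _ => ?_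
    rw [mul_comm, Module.Basis.mk_apply]
    rfl

/-- A matrix of rank at most `k` with entries bounded by `α` is `α U V` with factors whose entries
are bounded by one. -/
theorem exists_supParam {A : Matrix (Fin n₁) (Fin n₂) ℝ} (hA : A.rank ≤ k) {α : ℝ} (hα : 0 ≤ α)
    (hAα : MaxNormLE A α) :
    ∃ q : SupParam k n₁ n₂, ‖q‖ ≤ 1 ∧ ∀ i j, A i j = α * ∑ a, q.1 i a * q.2 j a := by
  obtain ⟨J, x, hx, hAx⟩ := exists_cols_bounded_coords A
  have hinj := Fin.castLE_injective hA
  refine ⟨(fun i => Function.extend (Fin.castLE hA) (fun a => A i (J a) / α) 0,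
    fun j => Function.extend (Fin.castLE hA) (x j) 0), ?_, fun i j => ?_⟩
  · have key : ∀ (y : Fin A.rank → ℝ), (∀ a, |y a| ≤ 1) → ∀ a,
        |Function.extend (Fin.castLE hA) y 0 a| ≤ 1 := by
      intro y hy a
      by_cases ha : ∃ b, Fin.castLE hA b = a
      · obtain ⟨b, rfl⟩ := ha
        rw [hinj.extend_apply]; exact hy b
      · rw [Function.extend_apply' _ _ _ ha]; simp
    refine max_le ?_ ?_
    · refine (pi_norm_le_iff_of_nonneg zero_le_one).2 fun i =>
        (pi_norm_le_iff_of_nonneg zero_le_one).2 fun a =>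
          key (fun a => A i (J a) / α) (fun a => ?_) a
      rw [abs_div, abs_of_nonneg hα]
      exact div_le_one_of_le₀ (hAα _ _) hα
    · exact (pi_norm_le_iff_of_nonneg zero_le_one).2 fun j =>
        (pi_norm_le_iff_of_nonneg zero_le_one).2 fun a => key _ (hx j) a
  · have hsum := Fintype.sum_of_injective (Fin.castLE hA) hinj (fun a => A i (J a) / α * x j a)
      (fun a => Function.extend (Fin.castLE hA) (fun a => A i (J a) / α) 0 a *
        Function.extend (Fin.castLE hA) (x j) 0 a)
      (fun a ha => by rw [Function.extend_apply' _ _ _ ha]; simp)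
      (fun a => by rw [hinj.extend_apply, hinj.extend_apply])
    change A i j = α * ∑ a, Function.extend (Fin.castLE hA) (fun a => A i (J a) / α) 0 a *
        Function.extend (Fin.castLE hA) (x j) 0 a
    rw [← hsum, Finset.mul_sum]
    rcases hα.eq_or_lt with h0 | h0
    · have : A i j = 0 := abs_nonpos_iff.1 ((hAα i j).trans h0.ge)
      simp [this, ← h0]
    · rw [hAx i j]
      refine Finset.sum_congr rfl fun a _ => ?_
      field_simp

theorem abs_supParam_sub_le {q q' : SupParam k n₁ n₂} (hq : ‖q‖ ≤ 1) (hq' : ‖q'‖ ≤ 1) {α : ℝ}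
    (hα : 0 ≤ α) {δ : ℝ} (hδ : ‖q - q'‖ ≤ δ) (i : Fin n₁) (j : Fin n₂) :
    |α * ∑ a, q.1 i a * q.2 j a - α * ∑ a, q'.1 i a * q'.2 j a| ≤ α * (2 * k * δ) := by
  have hδ0 : 0 ≤ δ := (norm_nonneg _).trans hδ
  have h1 : ∀ a, |q.1 i a - q'.1 i a| ≤ δ := fun a =>
    ((norm_le_pi_norm ((q.1 - q'.1) i) a).trans (norm_le_pi_norm (q.1 - q'.1) i)).trans
      ((norm_fst_le (q - q')).trans hδ)
  have h2 : ∀ a, |q.2 j a - q'.2 j a| ≤ δ := fun a =>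
    ((norm_le_pi_norm ((q.2 - q'.2) j) a).trans (norm_le_pi_norm (q.2 - q'.2) j)).trans
      ((norm_snd_le (q - q')).trans hδ)
  have h3 : ∀ a, |q'.1 i a| ≤ 1 := fun a =>
    ((norm_le_pi_norm (q'.1 i) a).trans (norm_le_pi_norm q'.1 i)).trans
      ((norm_fst_le q').trans hq')
  have h4 : ∀ a, |q.2 j a| ≤ 1 := fun a =>
    ((norm_le_pi_norm (q.2 j) a).trans (norm_le_pi_norm q.2 j)).trans
      ((norm_snd_le q).trans hq)
  rw [← mul_sub, abs_mul, abs_of_nonneg hα, ← Finset.sum_sub_distrib]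
  gcongr
  calc _ ≤ ∑ a, |q.1 i a * q.2 j a - q'.1 i a * q'.2 j a| := Finset.abs_sum_le_sum_abs _ _
    _ ≤ ∑ _a : Fin k, 2 * δ := by
        refine Finset.sum_le_sum fun a _ => ?_
        calc |q.1 i a * q.2 j a - q'.1 i a * q'.2 j a|
            = |(q.1 i a - q'.1 i a) * q.2 j a + q'.1 i a * (q.2 j a - q'.2 j a)| := by ring_nf
          _ ≤ |q.1 i a - q'.1 i a| * |q.2 j a| + |q'.1 i a| * |q.2 j a - q'.2 j a| := by
              rw [← abs_mul, ← abs_mul]; exact abs_add_le _ _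
          _ ≤ δ * 1 + 1 * δ := by
              gcongr
              · exact h1 a
              · exact h4 a
              · exact h3 a
              · exact h2 a
          _ = 2 * δ := by ring
    _ = 2 * k * δ := by simp; ring

/-! ### Ranks of shared factor pairs -/

theorem IsSharedFactor.rank_sub_le {ds dm dθ : ℕ} {M Θ M' Θ' : Matrix (Fin n₁) (Fin n₂) ℝ}
    (h : IsSharedFactor ds dm dθ M Θ) (h' : IsSharedFactor ds dm dθ M' Θ') :
    (M - M').rank ≤ 2 * (ds + dm + dθ) ∧ (Θ - Θ').rank ≤ 2 * (ds + dm + dθ) := by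
  obtain ⟨L1, L2, L3, L4, F1, F2, F3, rfl, rfl, -⟩ := h
  obtain ⟨L1', L2', L3', L4', F1', F2', F3', rfl, rfl, -⟩ := h'
  have key : ∀ {p q : ℕ} (A A' : Matrix (Fin n₁) (Fin p) ℝ) (B B' : Matrix (Fin n₁) (Fin q) ℝ)
      (C C' : Matrix (Fin p) (Fin n₂) ℝ) (D D' : Matrix (Fin q) (Fin n₂) ℝ),
      (A * C + B * D - (A' * C' + B' * D')).rank ≤ (p + q) + (p + q) := by
    intro p q A A' B B' C C' D D'
    have : A * C + B * D - (A' * C' + B' * D') =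
        Matrix.fromCols (Matrix.fromCols A B) (Matrix.fromCols (-A') (-B')) *
          Matrix.fromRows (Matrix.fromRows C D) (Matrix.fromRows C' D') := by
      rw [Matrix.fromCols_mul_fromRows, Matrix.fromCols_mul_fromRows,
        Matrix.fromCols_mul_fromRows, Matrix.neg_mul, Matrix.neg_mul]
      abel
    rw [this]
    refine (Matrix.rank_mul_le_left _ _).trans ((Matrix.rank_le_card_width _).trans ?_)
    simp
  exact ⟨(key _ _ _ _ _ _ _ _).trans (by omega), (key _ _ _ _ _ _ _ _).trans (by omega)⟩

theorem IsSharedFactor.rank_le {ds dm dθ : ℕ} {M Θ : Matrix (Fin n₁) (Fin n₂) ℝ}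
    (h : IsSharedFactor ds dm dθ M Θ) :
    M.rank ≤ ds + dm + dθ ∧ Θ.rank ≤ ds + dm + dθ := by
  obtain ⟨L1, L2, L3, L4, F1, F2, F3, rfl, rfl, -⟩ := h
  have key : ∀ {p q : ℕ} (A : Matrix (Fin n₁) (Fin p) ℝ) (B : Matrix (Fin n₁) (Fin q) ℝ)
      (C : Matrix (Fin p) (Fin n₂) ℝ) (D : Matrix (Fin q) (Fin n₂) ℝ),
      (A * C + B * D).rank ≤ p + q := by
    intro p q A B C D
    rw [← Matrix.fromCols_mul_fromRows]
    refine (Matrix.rank_mul_le_left _ _).trans ((Matrix.rank_le_card_width _).trans ?_)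
    simp
  exact ⟨(key _ _ _ _).trans (by omega), (key _ _ _ _).trans (by omega)⟩

theorem frobNorm_total_sub_sq (M Θ M' Θ' : Matrix (Fin n₁) (Fin n₂) ℝ) :
    frobNorm (total M Θ - total M' Θ') ^ 2 =
      ∑ i, ∑ j, ((M i j - M' i j) ^ 2 + (Θ i j - Θ' i j) ^ 2) := by
  rw [frobNorm, Matrix.frobenius_norm_def, ← Real.sqrt_eq_rpow, Real.sq_sqrt (by positivity)]
  simp [total, Fintype.sum_sum_type, Finset.sum_add_distrib]

theorem frobNorm_nonneg {m n : Type*} [Fintype m] [Fintype n] (A : Matrix m n ℝ) :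
    0 ≤ frobNorm A := by
  rw [frobNorm, Matrix.frobenius_norm_def]; positivity

end LowRank

/-! ### The Bernoulli log-likelihood -/

/-- `log (1 + exp θ)`, written through the logistic function. -/
def softplus (θ : ℝ) : ℝ := -Real.log (1 - Real.sigmoid θ)

theorem one_sub_sigmoid_pos (θ : ℝ) : 0 < 1 - Real.sigmoid θ := by
  linarith [Real.sigmoid_lt_one θ]

theorem log_sigmoid (θ : ℝ) : Real.log (Real.sigmoid θ) = θ - softplus θ := by
  have h := Real.sigmoid_mul_rexp_neg θ
  rw [Real.sigmoid_neg] at h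
  rw [softplus, ← h, Real.log_mul (Real.sigmoid_pos θ).ne' (Real.exp_pos _).ne', Real.log_exp]
  ring

theorem hasDerivAt_softplus (θ : ℝ) : HasDerivAt softplus (Real.sigmoid θ) θ := by
  have h := (((Real.hasDerivAt_sigmoid θ).const_sub 1).log (one_sub_sigmoid_pos θ).ne').neg
  have h2 : Real.sigmoid θ =
      -(-(Real.sigmoid θ * (1 - Real.sigmoid θ)) / (1 - Real.sigmoid θ)) := by
    have := (one_sub_sigmoid_pos θ).ne'
    field_simp
  rw [h2]
  exact h

theorem Params.two_mul_κ_le (p : Params) {θ : ℝ} (hθ : |θ| ≤ p.αθ) :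
    2 * p.κ ≤ Real.sigmoid θ * (1 - Real.sigmoid θ) := by
  have e1 : 2 * p.κ = (2 + 2 * Real.cosh p.αθ)⁻¹ := by
    rw [Params.κ, Real.cosh_eq, Real.exp_neg]
    have := Real.exp_pos p.αθ
    field_simp
    ring
  have e2 : Real.sigmoid θ * (1 - Real.sigmoid θ) = (2 + 2 * Real.cosh θ)⁻¹ := by
    rw [Real.sigmoid_def, Real.cosh_eq, Real.exp_neg]
    have := Real.exp_pos θ
    field_simp
    ring
  rw [e1, e2]
  have h1 : Real.cosh θ ≤ Real.cosh p.αθ := Real.cosh_le_cosh.2 (hθ.trans (le_abs_self _))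
  have h2 := Real.cosh_pos θ
  gcongr

theorem Params.κ_pos (p : Params) : 0 < p.κ := by
  have := Real.exp_pos p.αθ
  rw [Params.κ]; positivity

theorem Params.κ_le (p : Params) : p.κ ≤ 1 / 8 := by
  have := Real.exp_pos p.αθ
  rw [Params.κ, div_le_div_iff₀ (by positivity) (by norm_num)]
  nlinarith [sq_nonneg (Real.exp p.αθ - 1)]

/-- Strong convexity of the Bernoulli log-likelihood on the range allowed for `Θ`. -/
theorem Params.softplus_growth (p : Params) {θ θ₀ : ℝ} (hθ : |θ| ≤ p.αθ) (hθ₀ : |θ₀| ≤ p.αθ) :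
    p.κ * (θ - θ₀) ^ 2 ≤ softplus θ - softplus θ₀ - Real.sigmoid θ₀ * (θ - θ₀) := by
  let S := Set.Icc (-p.αθ) p.αθ
  let f : ℝ → ℝ := fun u => softplus u - p.κ * u ^ 2
  have hf : ∀ u, HasDerivAt f (Real.sigmoid u - p.κ * (2 * u)) u := fun u => by
    have h : HasDerivAt f (Real.sigmoid u - p.κ * ((2 : ℕ) * u ^ (2 - 1))) u :=
      (hasDerivAt_softplus u).sub ((hasDerivAt_pow 2 u).const_mul p.κ)
    simpa using h
  have hf' : deriv f = fun u => Real.sigmoid u - p.κ * (2 * u) := funext fun u => (hf u).deriv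
  have hf2 : ∀ u, HasDerivAt (deriv f)
      (Real.sigmoid u * (1 - Real.sigmoid u) - p.κ * (2 * 1)) u := by
    intro u
    rw [hf']
    exact (Real.hasDerivAt_sigmoid u).sub (((hasDerivAt_id u).const_mul 2).const_mul p.κ)
  have hconv : ConvexOn ℝ S f := by
    refine convexOn_of_deriv2_nonneg' (convex_Icc _ _)
      (fun u _ => (hf u).differentiableAt.differentiableWithinAt)
      (fun u _ => (hf2 u).differentiableAt.differentiableWithinAt) fun u hu => ?_
    change 0 ≤ deriv (deriv f) u
    rw [(hf2 u).deriv]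
    have := p.two_mul_κ_le (abs_le.2 hu)
    linarith
  have hS : θ ∈ S := abs_le.1 hθ
  have hS₀ : θ₀ ∈ S := abs_le.1 hθ₀
  rcases lt_trichotomy θ θ₀ with h | h | h
  · have h1 := hconv.slope_le_of_hasDerivAt hS hS₀ h (hf θ₀)
    rw [slope_def_field, div_le_iff₀ (by linarith)] at h1
    simp only [f] at h1
    nlinarith
  · subst h; simp
  · have h1 := hconv.le_slope_of_hasDerivAt hS₀ hS h (hf θ₀)
    rw [slope_def_field, le_div_iff₀ (by linarith)] at h1
    simp only [f] at h1
    nlinarith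

/-! ### Independence of the entries -/

/-- If the families `W` and `X` are independent of each other and each consists of independent
variables, then the pairs are independent. -/
theorem iIndepFun_prodMk_of_indepFun {Ω ι α β : Type*} [MeasurableSpace Ω] [Fintype ι]
    [MeasurableSpace α] [MeasurableSpace β] {P : Measure Ω} [IsProbabilityMeasure P]
    {W : ι → Ω → α} {X : ι → Ω → β} (hW : ∀ e, AEMeasurable (W e) P)
    (hX : ∀ e, AEMeasurable (X e) P) (iW : iIndepFun W P) (iX : iIndepFun X P)
    (h : IndepFun (fun ω e => W e ω) (fun ω e => X e ω) P) :
    iIndepFun (fun e ω => (W e ω, X e ω)) P := by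
  have hWX : ∀ e, AEMeasurable (fun ω => (W e ω, X e ω)) P := fun e => (hW e).prodMk (hX e)
  have hWa : AEMeasurable (fun ω e => W e ω) P := aemeasurable_pi_lambda _ hW
  have hXa : AEMeasurable (fun ω e => X e ω) P := aemeasurable_pi_lambda _ hX
  have := fun e => Measure.isProbabilityMeasure_map (hW e)
  have := fun e => Measure.isProbabilityMeasure_map (hX e)
  rw [iIndepFun_iff_map_fun_eq_pi_map hWX]
  have h1 := (indepFun_iff_map_prod_eq_prod_map_map hWa hXa).1 h
  rw [(iIndepFun_iff_map_fun_eq_pi_map hW).1 iW, (iIndepFun_iff_map_fun_eq_pi_map hX).1 iX] at h1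
  have h2 : ∀ e, P.map (fun ω => (W e ω, X e ω)) = (P.map (W e)).prod (P.map (X e)) := fun e =>
    (indepFun_iff_map_prod_eq_prod_map_map (hW e) (hX e)).1
      (h.comp (measurable_pi_apply e) (measurable_pi_apply e))
  simp only [h2]
  have h3 := (measurePreserving_arrowProdEquivProdArrow α β ι (fun e => P.map (W e))
    (fun e => P.map (X e))).symm
  rw [← h3.map_eq, ← h1, AEMeasurable.map_map_of_aemeasurable
    (MeasurableEquiv.measurable _).aemeasurable (hWa.prodMk hXa)]
  rfl

namespace Experiment

variable {n₁ n₂ : ℕ} {E : Experiment.{u} n₁ n₂} {p : Params} {A : Fin n₁ → Fin n₂ → Set ℝ}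
  {a b : Matrix (Fin n₁) (Fin n₂) ℝ × Matrix (Fin n₁) (Fin n₂) ℝ}

theorem AssumptionA.aemeasurable_w (hA : E.AssumptionA p) (i : Fin n₁) (j : Fin n₂) :
    AEMeasurable (fun ω => E.w ω i j) E.P := (hA.law_w i j).aemeasurable

theorem AssumptionA.aemeasurable_x (hA : E.AssumptionA p) (i : Fin n₁) (j : Fin n₂) :
    AEMeasurable (fun ω => E.x ω i j) E.P := (hA.law_x i j).aemeasurable

theorem AssumptionA.w_mem_Icc (hA : E.AssumptionA p) :
    ∀ᵐ ω ∂E.P, ∀ i j, 0 ≤ E.w ω i j ∧ E.w ω i j ≤ 1 := by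
  refine ae_all_iff.2 fun i => ae_all_iff.2 fun j => ?_
  have h1 : MeasurableSet (Set.Icc (0 : ℝ) 1)ᶜ := measurableSet_Icc.compl
  have h2 := (hA.law_w i j).measure_eq h1
  have h3 : bernoulliMeasure (1 : ℝ) 0 (unitInterval.sigmoid (E.Θ i j))
      (Set.Icc (0 : ℝ) 1)ᶜ = 0 := by
    classical
    rw [bernoulliMeasure_apply _ h1]
    simp
  exact h2.trans h3

theorem AssumptionA.integral_w (hA : E.AssumptionA p) (i : Fin n₁) (j : Fin n₂) :
    ∫ ω, E.w ω i j ∂E.P = Real.sigmoid (E.Θ i j) := by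
  rw [(hA.law_w i j).integral_eq, integral_bernoulliMeasure]
  simp
  rfl

theorem AssumptionA.iIndepFun_pair (hA : E.AssumptionA p) :
    iIndepFun (fun (e : Fin n₁ × Fin n₂) ω => (E.w ω e.1 e.2, E.x ω e.1 e.2)) E.P :=
  iIndepFun_prodMk_of_indepFun (fun e => hA.aemeasurable_w e.1 e.2)
    (fun e => hA.aemeasurable_x e.1 e.2) hA.indep_w hA.indep_x hA.indep_wx

theorem AssumptionA.indepFun_w_x (hA : E.AssumptionA p) (i : Fin n₁) (j : Fin n₂) :
    IndepFun (fun ω => E.w ω i j) (fun ω => E.x ω i j) E.P :=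
  hA.indep_wx.comp (measurable_pi_apply (i, j)) (measurable_pi_apply (i, j))

/-! ### Size of the loss increments -/

theorem AssumptionB.mem_Icc_M (hB : E.AssumptionB p) (i : Fin n₁) (j : Fin n₂) :
    E.M i j ∈ Set.Icc (-p.αm) p.αm := abs_le.1 (hB.bound_M i j)

/-- The score at the truth, as a function of the data point. -/
def scoreFun (E : Experiment.{u} n₁ n₂) (i : Fin n₁) (j : Fin n₂) (x : ℝ) : ℝ :=
  deriv (E.l i j x) (E.M i j)

/-- The score is a limit of difference quotients; those at `M i j + 1 / (n + 1)` may leave the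
interval on which `l` is differentiable, but `l` is measurable in `x` at every `m`. -/
theorem measurable_scoreFun (hB : E.AssumptionB p) (hC : E.AssumptionC p) (i : Fin n₁)
    (j : Fin n₂) : Measurable (E.scoreFun i j) := by
  have h1 : ∀ x, HasDerivAt (E.l i j x) (E.scoreFun i j x) (E.M i j) := fun x =>
    (hC.differentiable_l i j x _ (hB.mem_Icc_M i j)).hasDerivAt
  refine measurable_of_tendsto_metrizable (f := fun (n : ℕ) x =>
    ((n : ℝ) + 1) * (E.l i j x (E.M i j + 1 / ((n : ℝ) + 1)) - E.l i j x (E.M i j))) ?_ ?_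
  · intro n
    exact ((hC.measurable_l i j _).sub (hC.measurable_l i j _)).const_mul _
  · refine tendsto_pi_nhds.2 fun x => ?_
    have h2 := (h1 x).tendsto_slope_zero_right
    have h3 : Tendsto (fun n : ℕ => 1 / ((n : ℝ) + 1)) atTop (𝓝[>] 0) := by
      refine tendsto_nhdsWithin_iff.2 ⟨tendsto_one_div_add_atTop_nhds_zero_nat,
        Eventually.of_forall fun n => ?_⟩
      exact Set.mem_Ioi.2 (by positivity)
    refine (h2.comp h3).congr fun n => ?_
    simp

theorem aemeasurable_score (hA : E.AssumptionA p) (hB : E.AssumptionB p) (hC : E.AssumptionC p)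
    (i : Fin n₁) (j : Fin n₂) : AEMeasurable (E.score i j (E.M i j)) E.P :=
  (measurable_scoreFun hB hC i j).comp_aemeasurable (hA.aemeasurable_x i j)

/-- The mean value inequality for the log-likelihood on a neighbourhood of the truth. -/
theorem abs_l_sub_le (hB : E.AssumptionB p) (hC : E.AssumptionC p) :
    ∀ᵐ ω ∂E.P, ∀ i j, ∀ m₁ ∈ Set.Icc (-p.αm) p.αm, ∀ m₂ ∈ Set.Icc (-p.αm) p.αm,
      ∀ ρ, |m₁ - E.M i j| ≤ ρ → |m₂ - E.M i j| ≤ ρ →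
      |E.l i j (E.x ω i j) m₁ - E.l i j (E.x ω i j) m₂| ≤
        (|E.score i j (E.M i j) ω| + p.Ll * ρ) * |m₁ - m₂| := by
  filter_upwards [hC.lipschitz_score] with ω hω i j m₁ hm₁ m₂ hm₂ ρ h₁ h₂
  let S := Set.Icc (-p.αm) p.αm ∩ Metric.closedBall (E.M i j) ρ
  have hS : Convex ℝ S := (convex_Icc _ _).inter (convex_closedBall _ _)
  have h := hS.norm_image_sub_le_of_norm_hasDerivWithin_le (𝕜 := ℝ) (f := E.l i j (E.x ω i j))
    (f' := fun m => E.score i j m ω) (C := |E.score i j (E.M i j) ω| + p.Ll * ρ)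
    (x := m₂) (y := m₁)
    (fun m hm => (hC.differentiable_l i j _ m hm.1).hasDerivAt.hasDerivWithinAt)
    (fun m hm => by
      have h1 := hω i j m hm.1 _ (hB.mem_Icc_M i j)
      have h2 : |m - E.M i j| ≤ ρ := by simpa [Real.dist_eq] using hm.2
      have h3 : p.Ll * |m - E.M i j| ≤ p.Ll * ρ := by
        have := hC.Ll_pos
        gcongr
      rw [Real.norm_eq_abs]
      have h4 := abs_sub_abs_le_abs_sub (E.score i j m ω) (E.score i j (E.M i j) ω)
      linarith)
    ⟨hm₂, by simpa [Real.dist_eq] using h₂⟩ ⟨hm₁, by simpa [Real.dist_eq] using h₁⟩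
  simpa [Real.norm_eq_abs] using h

theorem abs_l_sub_le_of_mem (hB : E.AssumptionB p) (hC : E.AssumptionC p) :
    ∀ᵐ ω ∂E.P, ∀ i j, ∀ m₁ ∈ Set.Icc (-p.αm) p.αm, ∀ m₂ ∈ Set.Icc (-p.αm) p.αm,
      |E.l i j (E.x ω i j) m₁ - E.l i j (E.x ω i j) m₂| ≤
        (|E.score i j (E.M i j) ω| + 2 * p.Ll * p.αm) * |m₁ - m₂| := by
  filter_upwards [abs_l_sub_le hB hC] with ω hω i j m₁ hm₁ m₂ hm₂
  have hM := hB.mem_Icc_M i j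
  have h := hω i j m₁ hm₁ m₂ hm₂ (2 * p.αm)
    (abs_le.2 ⟨by linarith [hm₁.1, hM.2], by linarith [hm₁.2, hM.1]⟩)
    (abs_le.2 ⟨by linarith [hm₂.1, hM.2], by linarith [hm₂.2, hM.1]⟩)
  refine h.trans (le_of_eq ?_)
  ring

/-! ### The noise process -/

/-- The random part of the `e`-th summand of the log-likelihood ratio of `(M, Θ)` against the
truth, with the data outside the truncation set `A` discarded. It is linear in `Θ`, since
`w log π + (1 - w) log (1 - π) = w θ - log (1 + exp θ)`. -/
def noiseTerm (E : Experiment.{u} n₁ n₂) (p : Params) (A : Fin n₁ → Fin n₂ → Set ℝ)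
    (a : Matrix (Fin n₁) (Fin n₂) ℝ × Matrix (Fin n₁) (Fin n₂) ℝ) (e : Fin n₁ × Fin n₂)
    (ω : E.Ω) : ℝ :=
  E.w ω e.1 e.2 * (a.2 e.1 e.2 - E.Θ e.1 e.2) + p.η * (E.w ω e.1 e.2 *
    (A e.1 e.2).indicator (fun x => E.l e.1 e.2 x (a.1 e.1 e.2) - E.l e.1 e.2 x (E.M e.1 e.2))
      (E.x ω e.1 e.2))

/-- The centred (truncated) log-likelihood ratio. -/
def noise (E : Experiment.{u} n₁ n₂) (p : Params) (A : Fin n₁ → Fin n₂ → Set ℝ)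
    (a : Matrix (Fin n₁) (Fin n₂) ℝ × Matrix (Fin n₁) (Fin n₂) ℝ) (ω : E.Ω) : ℝ :=
  ∑ e, (E.noiseTerm p A a e ω - ∫ ω', E.noiseTerm p A a e ω' ∂E.P)

/-- The entrywise bounds on a pair of matrices. -/
def InBox (p : Params) (a : Matrix (Fin n₁) (Fin n₂) ℝ × Matrix (Fin n₁) (Fin n₂) ℝ) : Prop :=
  MaxNormLE a.1 p.αm ∧ MaxNormLE a.2 p.αθ

theorem InBox.mem_Icc (h : InBox p a) (i : Fin n₁) (j : Fin n₂) :
    a.1 i j ∈ Set.Icc (-p.αm) p.αm := abs_le.1 (h.1 i j)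

theorem AssumptionB.inBox (hB : E.AssumptionB p) : InBox p (E.M, E.Θ) := ⟨hB.bound_M, hB.bound_Θ⟩

/-- `g` bounds the Lipschitz constants of the noise terms: of `w θ`, and of `η l(x, m)` on the
truncation set. -/
def IsEnvelope (E : Experiment.{u} n₁ n₂) (p : Params) (A : Fin n₁ → Fin n₂ → Set ℝ)
    (g : Fin n₁ → Fin n₂ → E.Ω → ℝ) : Prop :=
  ∀ᵐ ω ∂E.P, ∀ i j, 1 ≤ g i j ω ∧ (E.x ω i j ∈ A i j →
    p.η * (|E.score i j (E.M i j) ω| + 2 * p.Ll * p.αm) ≤ g i j ω)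

theorem noiseTerm_sub_eq (a b : Matrix (Fin n₁) (Fin n₂) ℝ × Matrix (Fin n₁) (Fin n₂) ℝ)
    (e : Fin n₁ × Fin n₂) (ω : E.Ω) :
    E.noiseTerm p A a e ω - E.noiseTerm p A b e ω =
      E.w ω e.1 e.2 * (a.2 e.1 e.2 - b.2 e.1 e.2) + p.η * (E.w ω e.1 e.2 *
    (A e.1 e.2).indicator (fun x => E.l e.1 e.2 x (a.1 e.1 e.2) - E.l e.1 e.2 x (b.1 e.1 e.2))
      (E.x ω e.1 e.2)) := by
  by_cases h : E.x ω e.1 e.2 ∈ A e.1 e.2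
  · simp only [noiseTerm, Set.indicator_of_mem h]; ring
  · simp only [noiseTerm, Set.indicator_of_notMem h]; ring

theorem noiseTerm_truth (e : Fin n₁ × Fin n₂) (ω : E.Ω) :
    E.noiseTerm p A (E.M, E.Θ) e ω = 0 := by
  simp [noiseTerm]

theorem noise_truth (ω : E.Ω) : E.noise p A (E.M, E.Θ) ω = 0 := by
  simp [noise, noiseTerm_truth]

theorem exists_measurable_noiseTerm (hC : E.AssumptionC p)
    (hAm : ∀ i j, MeasurableSet (A i j))
    (a : Matrix (Fin n₁) (Fin n₂) ℝ × Matrix (Fin n₁) (Fin n₂) ℝ) (e : Fin n₁ × Fin n₂) :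
    ∃ f : ℝ × ℝ → ℝ, Measurable f ∧
      ∀ ω, E.noiseTerm p A a e ω = f (E.w ω e.1 e.2, E.x ω e.1 e.2) := by
  refine ⟨fun z => z.1 * (a.2 e.1 e.2 - E.Θ e.1 e.2) + p.η * (z.1 *
    (A e.1 e.2).indicator (fun x => E.l e.1 e.2 x (a.1 e.1 e.2) - E.l e.1 e.2 x (E.M e.1 e.2))
      z.2), ?_, fun ω => rfl⟩
  have h : Measurable ((A e.1 e.2).indicator
      (fun x => E.l e.1 e.2 x (a.1 e.1 e.2) - E.l e.1 e.2 x (E.M e.1 e.2))) :=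
    ((hC.measurable_l _ _ _).sub (hC.measurable_l _ _ _)).indicator (hAm _ _)
  have h2 : Measurable fun z : ℝ × ℝ => (A e.1 e.2).indicator
      (fun x => E.l e.1 e.2 x (a.1 e.1 e.2) - E.l e.1 e.2 x (E.M e.1 e.2)) z.2 :=
    h.comp measurable_snd
  exact (measurable_fst.mul_const _).add ((measurable_fst.mul h2).const_mul _)

theorem aemeasurable_noiseTerm (hA : E.AssumptionA p) (hC : E.AssumptionC p)
    (hAm : ∀ i j, MeasurableSet (A i j)) (e : Fin n₁ × Fin n₂) :
    AEMeasurable (E.noiseTerm p A a e) E.P := by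
  obtain ⟨f, hf, hfe⟩ := exists_measurable_noiseTerm hC hAm a e
  rw [show E.noiseTerm p A a e = _ from funext hfe]
  exact hf.comp_aemeasurable ((hA.aemeasurable_w e.1 e.2).prodMk (hA.aemeasurable_x e.1 e.2))

theorem iIndepFun_noiseTerm_sub (hA : E.AssumptionA p) (hC : E.AssumptionC p)
    (hAm : ∀ i j, MeasurableSet (A i j)) :
    iIndepFun (fun e ω => E.noiseTerm p A a e ω - E.noiseTerm p A b e ω) E.P := by
  choose f hf hfe using fun e => exists_measurable_noiseTerm (E := E) (p := p) hC hAm a e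
  choose g hg hge using fun e => exists_measurable_noiseTerm (E := E) (p := p) hC hAm b e
  simp only [hfe, hge]
  exact hA.iIndepFun_pair.comp (fun e z => f e z - g e z) fun e => (hf e).sub (hg e)

theorem integrable_l_sub (hC : E.AssumptionC p) (hB : E.AssumptionB p) (hA : E.AssumptionA p)
    (i : Fin n₁) (j : Fin n₂) {S : Set ℝ}
    (hS : MeasurableSet S) {m : ℝ} (hm : m ∈ Set.Icc (-p.αm) p.αm) :
    Integrable (fun ω => S.indicator (fun x => E.l i j x m - E.l i j x (E.M i j)) (E.x ω i j))
      E.P := by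
  have h1 := (hC.integrable_l i j m hm).sub (hC.integrable_l i j _ (hB.mem_Icc_M i j))
  refine h1.norm.mono' ?_ (ae_of_all _ fun ω => ?_)
  · exact ((((hC.measurable_l _ _ _).sub (hC.measurable_l _ _ _)).indicator hS).comp_aemeasurable
      (hA.aemeasurable_x i j)).aestronglyMeasurable
  · by_cases h : E.x ω i j ∈ S
    · simp [Set.indicator_of_mem h]
    · simp [Set.indicator_of_notMem h]

theorem integrable_w (hA : E.AssumptionA p) (i : Fin n₁) (j : Fin n₂) :
    Integrable (fun ω => E.w ω i j) E.P := by
  refine (integrable_const (1 : ℝ)).mono' (hA.aemeasurable_w i j).aestronglyMeasurable ?_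
  filter_upwards [hA.w_mem_Icc] with ω hω
  rw [Real.norm_eq_abs, abs_of_nonneg (hω i j).1]
  exact (hω i j).2

theorem integrable_w_mul (hA : E.AssumptionA p) {i : Fin n₁} {j : Fin n₂} {f : E.Ω → ℝ}
    (hf : Integrable f E.P) : Integrable (fun ω => E.w ω i j * f ω) E.P := by
  refine hf.norm.mono' ((hA.aemeasurable_w i j).aestronglyMeasurable.mul
    hf.aestronglyMeasurable) ?_
  filter_upwards [hA.w_mem_Icc] with ω hω
  rw [norm_mul, Real.norm_eq_abs, abs_of_nonneg (hω i j).1]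
  exact mul_le_of_le_one_left (norm_nonneg _) (hω i j).2

theorem integrable_noiseTerm (hA : E.AssumptionA p) (hB : E.AssumptionB p) (hC : E.AssumptionC p)
    (hAm : ∀ i j, MeasurableSet (A i j)) (ha : InBox p a) (e : Fin n₁ × Fin n₂) :
    Integrable (E.noiseTerm p A a e) E.P :=
  ((integrable_w hA e.1 e.2).mul_const _).add
    ((integrable_w_mul hA (integrable_l_sub hC hB hA _ _ (hAm _ _) (ha.mem_Icc _ _))).const_mul _)

theorem integral_noiseTerm (hA : E.AssumptionA p) (hB : E.AssumptionB p) (hC : E.AssumptionC p)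
    (hAm : ∀ i j, MeasurableSet (A i j)) (ha : InBox p a) (e : Fin n₁ × Fin n₂) :
    ∫ ω, E.noiseTerm p A a e ω ∂E.P =
      Real.sigmoid (E.Θ e.1 e.2) * (a.2 e.1 e.2 - E.Θ e.1 e.2) +
      p.η * (Real.sigmoid (E.Θ e.1 e.2) * ∫ ω, (A e.1 e.2).indicator
        (fun x => E.l e.1 e.2 x (a.1 e.1 e.2) - E.l e.1 e.2 x (E.M e.1 e.2))
        (E.x ω e.1 e.2) ∂E.P) := by
  have hint := integrable_l_sub hC hB hA e.1 e.2 (hAm e.1 e.2) (ha.mem_Icc e.1 e.2)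
  have hmeas : Measurable ((A e.1 e.2).indicator
      (fun x => E.l e.1 e.2 x (a.1 e.1 e.2) - E.l e.1 e.2 x (E.M e.1 e.2))) :=
    ((hC.measurable_l _ _ _).sub (hC.measurable_l _ _ _)).indicator (hAm _ _)
  have hind : IndepFun (fun ω => E.w ω e.1 e.2) (fun ω => (A e.1 e.2).indicator
      (fun x => E.l e.1 e.2 x (a.1 e.1 e.2) - E.l e.1 e.2 x (E.M e.1 e.2)) (E.x ω e.1 e.2)) E.P :=
    (hA.indepFun_w_x e.1 e.2).comp measurable_id hmeas
  simp only [noiseTerm]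
  rw [integral_add ((integrable_w hA e.1 e.2).mul_const _)
    ((integrable_w_mul hA hint).const_mul _), integral_mul_const, integral_const_mul,
    hind.integral_fun_mul_eq_mul_integral (integrable_w hA _ _).aestronglyMeasurable
      hint.aestronglyMeasurable, hA.integral_w]

theorem abs_noiseTerm_sub_le (hA : E.AssumptionA p) (hB : E.AssumptionB p)
    (hC : E.AssumptionC p) {g : Fin n₁ → Fin n₂ → E.Ω → ℝ} (hg : IsEnvelope E p A g) :
    ∀ᵐ ω ∂E.P, ∀ a b, InBox p a → InBox p b → ∀ e,
      |E.noiseTerm p A a e ω - E.noiseTerm p A b e ω| ≤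
        g e.1 e.2 ω * (|a.1 e.1 e.2 - b.1 e.1 e.2| + |a.2 e.1 e.2 - b.2 e.1 e.2|) := by
  filter_upwards [hg, hA.w_mem_Icc, abs_l_sub_le_of_mem hB hC] with ω h1 h2 h3 a b ha hb e
  obtain ⟨hg1, hg2⟩ := h1 e.1 e.2
  obtain ⟨hw0, hw1⟩ := h2 e.1 e.2
  have hη := hB.eta_pos
  rw [noiseTerm_sub_eq]
  have t1 : |E.w ω e.1 e.2 * (a.2 e.1 e.2 - b.2 e.1 e.2)| ≤
      g e.1 e.2 ω * |a.2 e.1 e.2 - b.2 e.1 e.2| := by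
    rw [abs_mul, abs_of_nonneg hw0]
    gcongr
    exact hw1.trans hg1
  have t2 : |p.η * (E.w ω e.1 e.2 * (A e.1 e.2).indicator
      (fun x => E.l e.1 e.2 x (a.1 e.1 e.2) - E.l e.1 e.2 x (b.1 e.1 e.2)) (E.x ω e.1 e.2))| ≤
      g e.1 e.2 ω * |a.1 e.1 e.2 - b.1 e.1 e.2| := by
    by_cases h : E.x ω e.1 e.2 ∈ A e.1 e.2
    · rw [Set.indicator_of_mem h, abs_mul, abs_mul, abs_of_pos hη, abs_of_nonneg hw0]
      have h4 := h3 e.1 e.2 _ (ha.mem_Icc e.1 e.2) _ (hb.mem_Icc e.1 e.2)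
      calc _ ≤ p.η * (1 * ((|E.score e.1 e.2 (E.M e.1 e.2) ω| + 2 * p.Ll * p.αm) *
            |a.1 e.1 e.2 - b.1 e.1 e.2|)) := by gcongr
        _ = p.η * (|E.score e.1 e.2 (E.M e.1 e.2) ω| + 2 * p.Ll * p.αm) *
            |a.1 e.1 e.2 - b.1 e.1 e.2| := by ring
        _ ≤ _ := by
          gcongr
          exact hg2 h
    · rw [Set.indicator_of_notMem h]
      simp only [mul_zero, abs_zero]
      exact mul_nonneg (zero_le_one.trans hg1) (abs_nonneg _)
  calc _ ≤ _ := abs_add_le _ _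
    _ ≤ _ := add_le_add t1 t2
    _ = _ := by ring

theorem noise_sub (hA : E.AssumptionA p) (hB : E.AssumptionB p)
    (hC : E.AssumptionC p) (hAm : ∀ i j, MeasurableSet (A i j)) (ha : InBox p a) (hb : InBox p b)
    (ω : E.Ω) :
    E.noise p A a ω - E.noise p A b ω = ∑ e, (E.noiseTerm p A a e ω - E.noiseTerm p A b e ω -
      ∫ ω', (E.noiseTerm p A a e ω' - E.noiseTerm p A b e ω') ∂E.P) := by
  simp only [noise]
  rw [← Finset.sum_sub_distrib]
  refine Finset.sum_congr rfl fun e _ => ?_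
  rw [integral_sub (integrable_noiseTerm hA hB hC hAm ha e)
    (integrable_noiseTerm hA hB hC hAm hb e)]
  ring

theorem aemeasurable_noise (hA : E.AssumptionA p) (hC : E.AssumptionC p)
    (hAm : ∀ i j, MeasurableSet (A i j)) : AEMeasurable (E.noise p A a) E.P :=
  Finset.aemeasurable_fun_sum _ fun e _ => (aemeasurable_noiseTerm hA hC hAm e).sub_const _

theorem exists_lipschitz_noise (hA : E.AssumptionA p) (hB : E.AssumptionB p)
    (hC : E.AssumptionC p) (hAm : ∀ i j, MeasurableSet (A i j))
    {g : Fin n₁ → Fin n₂ → E.Ω → ℝ} (hg : IsEnvelope E p A g)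
    (hgi : ∀ i j, Integrable (g i j) E.P) :
    ∀ᵐ ω ∂E.P, ∃ C : ℝ, ∀ a b, InBox p a → InBox p b → ∀ ρ : ℝ,
      (∀ i j, |a.1 i j - b.1 i j| ≤ ρ ∧ |a.2 i j - b.2 i j| ≤ ρ) →
      |E.noise p A a ω - E.noise p A b ω| ≤ C * ρ := by
  have hall := abs_noiseTerm_sub_le hA hB hC hg
  filter_upwards [hall, hg] with ω hω hgω
  refine ⟨∑ e : Fin n₁ × Fin n₂, (g e.1 e.2 ω + ∫ ω', g e.1 e.2 ω' ∂E.P) * 2,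
    fun a b ha hb ρ hρ => ?_⟩
  rw [noise_sub hA hB hC hAm ha hb, Finset.sum_mul]
  refine (Finset.abs_sum_le_sum_abs _ _).trans (Finset.sum_le_sum fun e _ => ?_)
  obtain ⟨h1, h2⟩ := hρ e.1 e.2
  have h0 : 0 ≤ ρ := (abs_nonneg _).trans h1
  have b1 : |E.noiseTerm p A a e ω - E.noiseTerm p A b e ω| ≤ g e.1 e.2 ω * (2 * ρ) := by
    refine (hω a b ha hb e).trans ?_
    have := zero_le_one.trans (hgω e.1 e.2).1
    gcongr
    linarith
  have b2 : |∫ ω', (E.noiseTerm p A a e ω' - E.noiseTerm p A b e ω') ∂E.P| ≤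
      (∫ ω', g e.1 e.2 ω' ∂E.P) * (2 * ρ) := by
    rw [← integral_mul_const, ← Real.norm_eq_abs]
    refine norm_integral_le_of_norm_le ((hgi e.1 e.2).mul_const _) ?_
    filter_upwards [hall, hg] with ω' hω' hgω'
    refine (hω' a b ha hb e).trans ?_
    have := zero_le_one.trans (hgω' e.1 e.2).1
    gcongr
    linarith
  calc _ ≤ _ := abs_sub _ _
    _ ≤ _ := add_le_add b1 b2
    _ = _ := by ring

/-- Sub-Gaussian increments of the noise in the Frobenius distance. -/
theorem lintegral_exp_noise_sub_le (hA : E.AssumptionA p) (hB : E.AssumptionB p)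
    (hC : E.AssumptionC p) (hAm : ∀ i j, MeasurableSet (A i j)) {c : ℝ} (hc : 0 < c)
    {G : Fin n₁ → Fin n₂ → E.Ω → ℝ} (hGm : ∀ i j, AEMeasurable (G i j) E.P)
    (hG2 : ∀ i j, ∫⁻ ω, ENNReal.ofReal (Real.exp (G i j ω ^ 2)) ∂E.P ≤ 2)
    (hg : IsEnvelope E p A fun i j ω => c * |G i j ω|)
    (ha : InBox p a) (hb : InBox p b) {s D : ℝ} (hs : 0 < s)
    (hD : 4 * c ^ 2 * (∑ i, ∑ j, ((a.1 i j - b.1 i j) ^ 2 + (a.2 i j - b.2 i j) ^ 2)) ≤ s ^ 2 * D) :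
    ∫⁻ ω, ENNReal.ofReal (Real.exp (|E.noise p A a ω - E.noise p A b ω| / s)) ∂E.P ≤
      ENNReal.ofReal (2 * Real.exp D) := by
  simp only [noise_sub hA hB hC hAm ha hb]
  refine lintegral_exp_abs_sum_le (iIndepFun_noiseTerm_sub hA hC hAm)
    (fun e => (aemeasurable_noiseTerm hA hC hAm e).sub (aemeasurable_noiseTerm hA hC hAm e)) hs
    (fun e => 4 * c ^ 2 / s ^ 2 * ((a.1 e.1 e.2 - b.1 e.1 e.2) ^ 2 +
      (a.2 e.1 e.2 - b.2 e.1 e.2) ^ 2)) ?_ ?_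
  · rw [← Finset.mul_sum, Fintype.sum_prod_type, div_mul_eq_mul_div, div_le_iff₀ (by positivity),
      mul_comm D]
    exact hD
  · intro e lam hlam
    refine (lintegral_exp_centered_le
      (β := c * (|a.1 e.1 e.2 - b.1 e.1 e.2| + |a.2 e.1 e.2 - b.2 e.1 e.2|)) (by positivity)
      ((aemeasurable_noiseTerm hA hC hAm e).sub (aemeasurable_noiseTerm hA hC hAm e))
      (hGm e.1 e.2) (hG2 e.1 e.2) ?_ lam).trans ?_
    · filter_upwards [abs_noiseTerm_sub_le hA hB hC hg] with ω hω
      refine (hω a b ha hb e).trans (le_of_eq ?_)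
      ring
    · apply ENNReal.ofReal_le_ofReal
      apply Real.exp_le_exp.2
      rw [← sq_abs lam, hlam]
      have h : (|a.1 e.1 e.2 - b.1 e.1 e.2| + |a.2 e.1 e.2 - b.2 e.1 e.2|) ^ 2 ≤
          2 * ((a.1 e.1 e.2 - b.1 e.1 e.2) ^ 2 + (a.2 e.1 e.2 - b.2 e.1 e.2) ^ 2) := by
        rw [← sq_abs (a.1 e.1 e.2 - b.1 e.1 e.2), ← sq_abs (a.2 e.1 e.2 - b.2 e.1 e.2)]
        nlinarith [sq_nonneg (|a.1 e.1 e.2 - b.1 e.1 e.2| - |a.2 e.1 e.2 - b.2 e.1 e.2|)]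
      calc _ = 2 * c ^ 2 / s ^ 2 *
            (|a.1 e.1 e.2 - b.1 e.1 e.2| + |a.2 e.1 e.2 - b.2 e.1 e.2|) ^ 2 := by
            field_simp
        _ ≤ 2 * c ^ 2 / s ^ 2 * (2 * ((a.1 e.1 e.2 - b.1 e.1 e.2) ^ 2 +
            (a.2 e.1 e.2 - b.2 e.1 e.2) ^ 2)) := by gcongr
        _ = _ := by ring

/-- Bernstein increments of the noise in the maximum norm, for a score that is bounded on the
truncation set and whose second moment is at most `α ^ 2`. -/
theorem lintegral_exp_noise_sub_le_of_bounded (hA : E.AssumptionA p) (hB : E.AssumptionB p)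
    (hC : E.AssumptionC p) (hAm : ∀ i j, MeasurableSet (A i j)) {c g α : ℝ}
    (hc1 : 1 ≤ c) (hcα : p.η * α + 2 * p.η * p.Ll * p.αm ≤ c) (hα : 0 ≤ α) (hαm : 0 ≤ p.αm)
    (hg : IsEnvelope E p A fun _ _ _ => g)
    (hs2i : ∀ i j, Integrable (fun ω => E.score i j (E.M i j) ω ^ 2) E.P)
    (hs2 : ∀ i j, ∫ ω, E.score i j (E.M i j) ω ^ 2 ∂E.P ≤ α ^ 2)
    (ha : InBox p a) (hb : InBox p b) {s D ρm ρθ : ℝ} (hs : 0 < s)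
    (hρ : ∀ i j, |a.1 i j - b.1 i j| ≤ ρm ∧ |a.2 i j - b.2 i j| ≤ ρθ)
    (hgs : g * (ρm + ρθ) ≤ s) (hD : 4 * c ^ 2 * (ρm + ρθ) ^ 2 * (n₁ * n₂) ≤ s ^ 2 * D) :
    ∫⁻ ω, ENNReal.ofReal (Real.exp (|E.noise p A a ω - E.noise p A b ω| / s)) ∂E.P ≤
      ENNReal.ofReal (2 * Real.exp D) := by
  simp only [noise_sub hA hB hC hAm ha hb]
  have hη := hB.eta_pos
  have hL := hC.Ll_pos
  refine lintegral_exp_abs_sum_le (iIndepFun_noiseTerm_sub hA hC hAm)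
    (fun e => (aemeasurable_noiseTerm hA hC hAm e).sub (aemeasurable_noiseTerm hA hC hAm e)) hs
    (fun e => 4 * c ^ 2 * (ρm + ρθ) ^ 2 / s ^ 2) ?_ ?_
  · simp only [Finset.sum_const, Finset.card_univ, Fintype.card_prod, Fintype.card_fin,
      nsmul_eq_mul]
    rw [← mul_div_assoc, div_le_iff₀ (by positivity)]
    push_cast
    linarith
  · intro e lam hlam
    obtain ⟨h1, h2⟩ := hρ e.1 e.2
    have hρm : 0 ≤ ρm := (abs_nonneg _).trans h1
    have hρθ : 0 ≤ ρθ := (abs_nonneg _).trans h2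
    have hmeas : AEMeasurable (fun ω => E.noiseTerm p A a e ω - E.noiseTerm p A b e ω) E.P :=
      (aemeasurable_noiseTerm hA hC hAm e).sub (aemeasurable_noiseTerm hA hC hAm e)
    -- the weaker envelope `1 + η (|s| + 2 L α_m)` gives the second moment
    set u : ℝ := 2 * p.η * p.Ll * p.αm with hu
    have hu0 : 0 ≤ u := by positivity
    have hsq : ∀ᵐ ω ∂E.P, (E.noiseTerm p A a e ω - E.noiseTerm p A b e ω) ^ 2 ≤
        2 * ρθ ^ 2 + 4 * ρm ^ 2 * u ^ 2 +
          4 * ρm ^ 2 * p.η ^ 2 * E.score e.1 e.2 (E.M e.1 e.2) ω ^ 2 := by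
      filter_upwards [hA.w_mem_Icc, abs_l_sub_le_of_mem hB hC] with ω hw hl
      obtain ⟨hw0, hw1⟩ := hw e.1 e.2
      have hl' := hl e.1 e.2 _ (ha.mem_Icc e.1 e.2) _ (hb.mem_Icc e.1 e.2)
      set σ := |E.score e.1 e.2 (E.M e.1 e.2) ω| with hσ
      have hσ0 : 0 ≤ σ := abs_nonneg _
      have t1 : |E.noiseTerm p A a e ω - E.noiseTerm p A b e ω| ≤
          ρθ + (p.η * σ + u) * ρm := by
        rw [noiseTerm_sub_eq]
        refine (abs_add_le _ _).trans (add_le_add ?_ ?_)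
        · rw [abs_mul, abs_of_nonneg hw0]
          exact (mul_le_of_le_one_left (abs_nonneg _) hw1).trans h2
        · rw [abs_mul, abs_mul, abs_of_pos hη, abs_of_nonneg hw0]
          by_cases h : E.x ω e.1 e.2 ∈ A e.1 e.2
          · rw [Set.indicator_of_mem h]
            calc _ ≤ p.η * (1 * ((σ + 2 * p.Ll * p.αm) * ρm)) := by
                  gcongr
                  exact hl'.trans (by gcongr)
              _ = _ := by rw [hu]; ring
          · rw [Set.indicator_of_notMem h]
            simp only [abs_zero, mul_zero]
            positivity
      calc _ = |E.noiseTerm p A a e ω - E.noiseTerm p A b e ω| ^ 2 := (sq_abs _).symm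
        _ ≤ (ρθ + (p.η * σ + u) * ρm) ^ 2 := by gcongr
        _ ≤ 2 * ρθ ^ 2 + 2 * ((p.η * σ + u) * ρm) ^ 2 := by
            nlinarith [sq_nonneg (ρθ - (p.η * σ + u) * ρm)]
        _ ≤ 2 * ρθ ^ 2 + 2 * ((2 * (p.η * σ) ^ 2 + 2 * u ^ 2) * ρm ^ 2) := by
            rw [mul_pow (p.η * σ + u)]
            gcongr
            nlinarith [sq_nonneg (p.η * σ - u)]
        _ = 2 * ρθ ^ 2 + 4 * ρm ^ 2 * u ^ 2 + 4 * ρm ^ 2 * p.η ^ 2 * σ ^ 2 := by ring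
        _ = _ := by rw [hσ, sq_abs]
    have hdom : Integrable (fun ω => 2 * ρθ ^ 2 + 4 * ρm ^ 2 * u ^ 2 +
        4 * ρm ^ 2 * p.η ^ 2 * E.score e.1 e.2 (E.M e.1 e.2) ω ^ 2) E.P :=
      (integrable_const _).add ((hs2i e.1 e.2).const_mul _)
    have hint : Integrable (fun ω => (E.noiseTerm p A a e ω - E.noiseTerm p A b e ω) ^ 2) E.P := by
      refine hdom.mono' (hmeas.pow_const 2).aestronglyMeasurable ?_
      filter_upwards [hsq] with ω hω
      rwa [Real.norm_eq_abs, abs_of_nonneg (sq_nonneg _)]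
    refine (lintegral_exp_centered_le_of_bounded (v := 4 * c ^ 2 * (ρm + ρθ) ^ 2) hmeas hint
      ?_ ?_).trans ?_
    · refine (integral_mono_ae hint hdom hsq).trans ?_
      rw [integral_add (integrable_const _) ((hs2i e.1 e.2).const_mul _), integral_const_mul]
      simp only [integral_const, probReal_univ, smul_eq_mul, one_mul]
      have k1 : (p.η * α) ^ 2 + u ^ 2 ≤ c ^ 2 := by
        have : 0 ≤ p.η * α := by positivity
        nlinarith
      calc _ ≤ 2 * ρθ ^ 2 + 4 * ρm ^ 2 * u ^ 2 + 4 * ρm ^ 2 * p.η ^ 2 * α ^ 2 := by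
            gcongr
            exact hs2 e.1 e.2
        _ = 2 * ρθ ^ 2 + 4 * ρm ^ 2 * ((p.η * α) ^ 2 + u ^ 2) := by ring
        _ ≤ 4 * ρθ ^ 2 * c ^ 2 + 4 * ρm ^ 2 * c ^ 2 := by
            have : 1 ≤ c ^ 2 := one_le_pow₀ hc1
            have h5 : 0 ≤ ρθ ^ 2 := sq_nonneg _
            have h6 : 4 * ρm ^ 2 * ((p.η * α) ^ 2 + u ^ 2) ≤ 4 * ρm ^ 2 * c ^ 2 := by gcongr
            nlinarith
        _ ≤ _ := by
            have : 0 ≤ ρm * ρθ * c ^ 2 := by positivity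
            nlinarith
    · filter_upwards [abs_noiseTerm_sub_le hA hB hC hg, hg] with ω hω hgω
      have hg0 := zero_le_one.trans (hgω e.1 e.2).1
      rw [abs_mul, hlam, one_div_mul_eq_div, div_le_one hs]
      exact (hω a b ha hb e).trans (le_trans (by gcongr) hgs)
    · rw [← sq_abs lam, hlam]
      apply le_of_eq
      congr 2
      field_simp

/-! ### Curvature against noise -/

/-- The Frobenius distance of a pair of matrices to the truth. -/
def dist (E : Experiment.{u} n₁ n₂)
    (a : Matrix (Fin n₁) (Fin n₂) ℝ × Matrix (Fin n₁) (Fin n₂) ℝ) : ℝ :=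
  frobNorm (total a.1 a.2 - total E.M E.Θ)

theorem dist_nonneg : 0 ≤ E.dist a := frobNorm_nonneg _

theorem dist_sq : E.dist a ^ 2 =
    ∑ i, ∑ j, ((a.1 i j - E.M i j) ^ 2 + (a.2 i j - E.Θ i j) ^ 2) :=
  frobNorm_total_sub_sq _ _ _ _

theorem negPseudoLogLik_eq {l : Fin n₁ → Fin n₂ → ℝ → ℝ → ℝ} {η : ℝ}
    {w x M Θ : Matrix (Fin n₁) (Fin n₂) ℝ} :
    negPseudoLogLik l η w x M Θ =
      ∑ e : Fin n₁ × Fin n₂, (softplus (Θ e.1 e.2) - w e.1 e.2 * Θ e.1 e.2 -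
        η * (w e.1 e.2 * l e.1 e.2 (x e.1 e.2) (M e.1 e.2))) := by
  rw [negPseudoLogLik, Fintype.sum_prod_type, ← Finset.sum_neg_distrib]
  refine Finset.sum_congr rfl fun i _ => ?_
  rw [← Finset.sum_neg_distrib]
  refine Finset.sum_congr rfl fun j _ => ?_
  have h : Real.log (1 - Real.sigmoid (Θ i j)) = -softplus (Θ i j) := by rw [softplus, neg_neg]
  rw [log_sigmoid, h]
  ring

theorem αh_pos (hB : E.AssumptionB p) (hC : E.AssumptionC p) : 0 < p.αh :=
  lt_min p.κ_pos (mul_pos hB.eta_pos hC.αl_pos)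

/-- `b` and `q` bound the effect of the truncation on the expected log-likelihood. -/
def IsTruncationBias (E : Experiment.{u} n₁ n₂) (p : Params) (A : Fin n₁ → Fin n₂ → Set ℝ)
    (b q : ℝ) : Prop :=
  ∀ i j, ∀ m ∈ Set.Icc (-p.αm) p.αm,
    ∫ ω, (A i j)ᶜ.indicator (fun x => |E.l i j x m - E.l i j x (E.M i j)|) (E.x ω i j) ∂E.P ≤
      b * |m - E.M i j| + q * (m - E.M i j) ^ 2

/-- The expected excess loss of one entry is at least `α_h` times the squared error, up to the
truncation bias. -/
theorem curvature_entry_le (hA : E.AssumptionA p) (hB : E.AssumptionB p) (hC : E.AssumptionC p)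
    (hAm : ∀ i j, MeasurableSet (A i j)) {b q : ℝ} (hbq : IsTruncationBias E p A b q)
    (ha : InBox p a) (e : Fin n₁ × Fin n₂) :
    p.αh * ((a.1 e.1 e.2 - E.M e.1 e.2) ^ 2 + (a.2 e.1 e.2 - E.Θ e.1 e.2) ^ 2) -
      p.η * (b * |a.1 e.1 e.2 - E.M e.1 e.2| + q * (a.1 e.1 e.2 - E.M e.1 e.2) ^ 2) ≤
    softplus (a.2 e.1 e.2) - softplus (E.Θ e.1 e.2) - ∫ ω, E.noiseTerm p A a e ω ∂E.P := by
  have hη := hB.eta_pos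
  obtain ⟨i, j⟩ := e
  simp only
  have h1 := p.softplus_growth (ha.2 i j) (hB.bound_Θ i j)
  have h2 := hC.growth i j _ (ha.mem_Icc i j)
  have h3 := hbq i j _ (ha.mem_Icc i j)
  rw [integral_noiseTerm hA hB hC hAm ha]
  simp only
  set f : ℝ → ℝ := fun x => E.l i j x (a.1 i j) - E.l i j x (E.M i j) with hf
  have hi : Integrable (fun ω => (A i j).indicator f (E.x ω i j)) E.P :=
    integrable_l_sub hC hB hA i j (hAm i j) (ha.mem_Icc i j)
  have hic : Integrable (fun ω => (A i j)ᶜ.indicator f (E.x ω i j)) E.P :=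
    integrable_l_sub hC hB hA i j (hAm i j).compl (ha.mem_Icc i j)
  have h4 : ∫ ω, (A i j).indicator f (E.x ω i j) ∂E.P +
      ∫ ω, (A i j)ᶜ.indicator f (E.x ω i j) ∂E.P =
      ∫ ω, E.l i j (E.x ω i j) (a.1 i j) ∂E.P - ∫ ω, E.l i j (E.x ω i j) (E.M i j) ∂E.P := by
    rw [← integral_add hi hic, ← integral_sub (hC.integrable_l i j _ (ha.mem_Icc i j))
      (hC.integrable_l i j _ (hB.mem_Icc_M i j))]
    refine integral_congr_ae (ae_of_all _ fun ω => ?_)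
    simp only
    rw [Set.indicator_self_add_compl_apply]
  have h5 : -∫ ω, (A i j)ᶜ.indicator f (E.x ω i j) ∂E.P ≤
      ∫ ω, (A i j)ᶜ.indicator (fun x => |f x|) (E.x ω i j) ∂E.P := by
    refine (neg_le_abs _).trans ((abs_integral_le_integral_abs).trans (le_of_eq ?_))
    refine integral_congr_ae (ae_of_all _ fun ω => ?_)
    by_cases h : E.x ω i j ∈ (A i j)ᶜ
    · simp only [Set.indicator_of_mem h]
    · simp only [Set.indicator_of_notMem h, abs_zero]
  set σ := Real.sigmoid (E.Θ i j) with hσ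
  have hσ0 : 0 ≤ σ := Real.sigmoid_nonneg _
  have hσ1 : σ ≤ 1 := Real.sigmoid_le_one _
  set I := ∫ ω, (A i j).indicator f (E.x ω i j) ∂E.P
  set J := ∫ ω, (A i j)ᶜ.indicator f (E.x ω i j) ∂E.P
  have hJ0 : 0 ≤ ∫ ω, (A i j)ᶜ.indicator (fun x => |f x|) (E.x ω i j) ∂E.P :=
    integral_nonneg fun ω => Set.indicator_nonneg (fun x _ => abs_nonneg _) _
  set J' := ∫ ω, (A i j)ᶜ.indicator (fun x => |f x|) (E.x ω i j) ∂E.P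
  have h6 : p.αl * (a.1 i j - E.M i j) ^ 2 - J' ≤ -(σ * I) := by
    have e1 : -(σ * I) = σ * (∫ ω, E.l i j (E.x ω i j) (E.M i j) ∂E.P -
        ∫ ω, E.l i j (E.x ω i j) (a.1 i j) ∂E.P) + σ * J := by
      have : I = -(∫ ω, E.l i j (E.x ω i j) (E.M i j) ∂E.P -
        ∫ ω, E.l i j (E.x ω i j) (a.1 i j) ∂E.P) - J := by linarith
      rw [this]; ring
    have e2 : -J' ≤ σ * J := by nlinarith
    rw [e1]
    linarith
  have h7 : p.αh * (a.1 i j - E.M i j) ^ 2 ≤ p.η * p.αl * (a.1 i j - E.M i j) ^ 2 := by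
    gcongr; exact min_le_right _ _
  have h8 : p.αh * (a.2 i j - E.Θ i j) ^ 2 ≤ p.κ * (a.2 i j - E.Θ i j) ^ 2 := by
    gcongr; exact min_le_left _ _
  have h9 := mul_le_mul_of_nonneg_left (h6.trans' (sub_le_sub_left h3 _)) hη.le
  linarith

/-- The basic inequality: at a minimizer, the noise makes up for the expected loss of fit. -/
theorem dist_sq_sub_bias_le_noise (hA : E.AssumptionA p) (hB : E.AssumptionB p)
    (hC : E.AssumptionC p) (hAm : ∀ i j, MeasurableSet (A i j)) {b q : ℝ} (hb : 0 ≤ b)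
    (hq : 0 ≤ q) (hbq : IsTruncationBias E p A b q) (ha : InBox p a) {ω : E.Ω}
    (hopt : IsKnownRankEstimate p.ds p.dm p.dθ E.l p.η (E.w ω) (E.x ω) a.1 a.2)
    (hx : ∀ i j, E.x ω i j ∈ A i j) :
    p.αh * E.dist a ^ 2 - p.η * (b * √((n₁ : ℝ) * n₂) * E.dist a + q * E.dist a ^ 2) ≤
      E.noise p A a ω := by
  have hη := hB.eta_pos
  have h1 := hopt.2 _ _ hA.truth
  rw [negPseudoLogLik_eq, negPseudoLogLik_eq] at h1
  have h2 : ∑ e : Fin n₁ × Fin n₂, (softplus (a.2 e.1 e.2) - softplus (E.Θ e.1 e.2)) ≤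
      ∑ e, E.noiseTerm p A a e ω := by
    have : ∑ e, E.noiseTerm p A a e ω = ∑ e : Fin n₁ × Fin n₂,
        (softplus (a.2 e.1 e.2) - softplus (E.Θ e.1 e.2)) +
        (∑ e : Fin n₁ × Fin n₂, (softplus (E.Θ e.1 e.2) - E.w ω e.1 e.2 * E.Θ e.1 e.2 -
          p.η * (E.w ω e.1 e.2 * E.l e.1 e.2 (E.x ω e.1 e.2) (E.M e.1 e.2))) -
        ∑ e : Fin n₁ × Fin n₂, (softplus (a.2 e.1 e.2) - E.w ω e.1 e.2 * a.2 e.1 e.2 -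
          p.η * (E.w ω e.1 e.2 * E.l e.1 e.2 (E.x ω e.1 e.2) (a.1 e.1 e.2)))) := by
      rw [← Finset.sum_sub_distrib, ← Finset.sum_add_distrib]
      refine Finset.sum_congr rfl fun e _ => ?_
      simp only [noiseTerm, Set.indicator_of_mem (hx e.1 e.2)]
      ring
    linarith
  have h3 : ∑ e : Fin n₁ × Fin n₂, (p.αh * ((a.1 e.1 e.2 - E.M e.1 e.2) ^ 2 +
      (a.2 e.1 e.2 - E.Θ e.1 e.2) ^ 2) -
      p.η * (b * |a.1 e.1 e.2 - E.M e.1 e.2| + q * (a.1 e.1 e.2 - E.M e.1 e.2) ^ 2)) ≤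
      E.noise p A a ω := by
    refine (Finset.sum_le_sum fun e _ => curvature_entry_le hA hB hC hAm hbq ha e).trans ?_
    simp only [noise, Finset.sum_sub_distrib] at h2 ⊢
    linarith
  refine le_trans ?_ h3
  have hd : E.dist a ^ 2 = ∑ e : Fin n₁ × Fin n₂, ((a.1 e.1 e.2 - E.M e.1 e.2) ^ 2 +
      (a.2 e.1 e.2 - E.Θ e.1 e.2) ^ 2) := by
    rw [dist_sq, Fintype.sum_prod_type]
  have hs2 : ∑ e : Fin n₁ × Fin n₂, (a.1 e.1 e.2 - E.M e.1 e.2) ^ 2 ≤ E.dist a ^ 2 := by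
    rw [hd]
    exact Finset.sum_le_sum fun e _ => le_add_of_nonneg_right (sq_nonneg _)
  have hs1 : ∑ e : Fin n₁ × Fin n₂, |a.1 e.1 e.2 - E.M e.1 e.2| ≤
      √((n₁ : ℝ) * n₂) * E.dist a := by
    have h5 := sq_sum_le_card_mul_sum_sq (s := (Finset.univ : Finset (Fin n₁ × Fin n₂)))
      (f := fun e => |a.1 e.1 e.2 - E.M e.1 e.2|)
    simp only [sq_abs, Finset.card_univ, Fintype.card_prod, Fintype.card_fin, Nat.cast_mul] at h5
    refine le_of_sq_le_sq ?_ (mul_nonneg (Real.sqrt_nonneg _) dist_nonneg)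
    rw [mul_pow, Real.sq_sqrt (by positivity)]
    exact h5.trans (by gcongr)
  have hsplit : ∑ e : Fin n₁ × Fin n₂, (p.αh * ((a.1 e.1 e.2 - E.M e.1 e.2) ^ 2 +
      (a.2 e.1 e.2 - E.Θ e.1 e.2) ^ 2) -
      p.η * (b * |a.1 e.1 e.2 - E.M e.1 e.2| + q * (a.1 e.1 e.2 - E.M e.1 e.2) ^ 2)) =
      p.αh * E.dist a ^ 2 - p.η * (b * ∑ e : Fin n₁ × Fin n₂, |a.1 e.1 e.2 - E.M e.1 e.2| +
        q * ∑ e : Fin n₁ × Fin n₂, (a.1 e.1 e.2 - E.M e.1 e.2) ^ 2) := by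
    rw [hd, Finset.mul_sum, Finset.mul_sum, Finset.mul_sum, ← Finset.sum_add_distrib,
      Finset.mul_sum, ← Finset.sum_sub_distrib]
  rw [hsplit]
  have h6 := mul_le_mul_of_nonneg_left hs1 hb
  have h7 := mul_le_mul_of_nonneg_left hs2 hq
  have h8 := mul_le_mul_of_nonneg_left (add_le_add h6 h7) hη.le
  linarith

/-- At distance `t` or more from the truth, the truncation bias takes away at most half of the
curvature. -/
theorem half_dist_sq_le_noise (hA : E.AssumptionA p) (hB : E.AssumptionB p)
    (hC : E.AssumptionC p) (hAm : ∀ i j, MeasurableSet (A i j)) {b q t : ℝ} (hb : 0 ≤ b)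
    (hq : 0 ≤ q) (hbq : IsTruncationBias E p A b q) (hq' : p.η * q ≤ p.αh / 2)
    (hbt : p.η * (b * √((n₁ : ℝ) * n₂)) ≤ (p.αh / 2 - p.η * q) * t) (ha : InBox p a)
    (ht : t ≤ E.dist a) {ω : E.Ω}
    (hopt : IsKnownRankEstimate p.ds p.dm p.dθ E.l p.η (E.w ω) (E.x ω) a.1 a.2)
    (hx : ∀ i j, E.x ω i j ∈ A i j) :
    p.αh / 2 * E.dist a ^ 2 ≤ E.noise p A a ω := by
  refine le_trans ?_ (dist_sq_sub_bias_le_noise hA hB hC hAm hb hq hbq ha hopt hx)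
  have h1 : p.η * (b * √((n₁ : ℝ) * n₂)) ≤ (p.αh / 2 - p.η * q) * E.dist a :=
    hbt.trans (mul_le_mul_of_nonneg_left ht (by linarith))
  have h2 := mul_le_mul_of_nonneg_right h1 (dist_nonneg (E := E) (a := a))
  linarith

/-! ### Uniform bounds for the noise -/

/-- Uniform bound of sub-Gaussian noise over a Frobenius ball. -/
theorem exists_exceptional_of_subGaussian (hA : E.AssumptionA p) (hB : E.AssumptionB p)
    (hC : E.AssumptionC p) (hAm : ∀ i j, MeasurableSet (A i j)) {c : ℝ} (hc : 0 < c)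
    {G : Fin n₁ → Fin n₂ → E.Ω → ℝ} (hGm : ∀ i j, AEMeasurable (G i j) E.P)
    (hG2 : ∀ i j, ∫⁻ ω, ENNReal.ofReal (Real.exp (G i j ω ^ 2)) ∂E.P ≤ 2)
    (hg : IsEnvelope E p A fun i j ω => c * |G i j ω|) {r D : ℝ} (hr : 0 < r) (hD1 : 1 ≤ D)
    (hD : 8 * p.d * ((n₁ : ℝ) + n₂) ≤ D) :
    ∃ B : Set E.Ω, E.P B ≤ ENNReal.ofReal (4 * Real.exp (-D)) ∧ ∀ ω ∉ B, ∀ a,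
      IsSharedFactor p.ds p.dm p.dθ a.1 a.2 → InBox p a → E.dist a ≤ r →
      |E.noise p A a ω| ≤ 240 * c * r * √D := by
  let T := {a : Matrix (Fin n₁) (Fin n₂) ℝ × Matrix (Fin n₁) (Fin n₂) ℝ //
    IsSharedFactor p.ds p.dm p.dθ a.1 a.2 ∧ InBox p a ∧ E.dist a ≤ r}
  have hsum : ∀ a : T, ∑ i, ∑ j, ((a.1.1 - E.M) i j ^ 2 + (a.1.2 - E.Θ) i j ^ 2) ≤ r ^ 2 := by
    intro a
    have := pow_le_pow_left₀ dist_nonneg a.2.2.2 2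
    rw [dist_sq] at this
    exact this
  have hM : ∀ a : T, ∃ q : FrobParam (2 * p.d) n₁ n₂, ‖q‖ ≤ 1 ∧
      ∀ i j, (a.1.1 - E.M) i j = r * (q.1 (q.2 j)) i := fun a =>
    exists_frobParam (IsSharedFactor.rank_sub_le a.2.1 hA.truth).1 hr ((hsum a).trans'
      (Finset.sum_le_sum fun i _ => Finset.sum_le_sum fun j _ =>
        le_add_of_nonneg_right (sq_nonneg _)))
  have hΘ : ∀ a : T, ∃ q : FrobParam (2 * p.d) n₁ n₂, ‖q‖ ≤ 1 ∧
      ∀ i j, (a.1.2 - E.Θ) i j = r * (q.1 (q.2 j)) i := fun a =>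
    exists_frobParam (IsSharedFactor.rank_sub_le a.2.1 hA.truth).2 hr ((hsum a).trans'
      (Finset.sum_le_sum fun i _ => Finset.sum_le_sum fun j _ =>
        le_add_of_nonneg_left (sq_nonneg _)))
  choose qM hqM hqM' using hM
  choose qΘ hqΘ hqΘ' using hΘ
  let τ : T → FrobParam (2 * p.d) n₁ n₂ × FrobParam (2 * p.d) n₁ n₂ := fun a => (qM a, qΘ a)
  have hinc : ∀ a b : T, ∀ δ : ℝ, ‖τ a - τ b‖ ≤ δ →
      ∑ i, ∑ j, ((a.1.1 i j - b.1.1 i j) ^ 2 + (a.1.2 i j - b.1.2 i j) ^ 2) ≤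
        8 * r ^ 2 * δ ^ 2 := by
    intro a b δ hδ
    have h1 := sum_sq_frobParam_sub_le (hqM a) (hqM b) (r := r)
      ((norm_fst_le (τ a - τ b)).trans hδ)
    have h2 := sum_sq_frobParam_sub_le (hqΘ a) (hqΘ b) (r := r)
      ((norm_snd_le (τ a - τ b)).trans hδ)
    simp only [← hqM', ← hqΘ'] at h1 h2
    simp only [Matrix.sub_apply, sub_sub_sub_cancel_right] at h1 h2
    simp only [Finset.sum_add_distrib]
    linarith
  have hD0 : 0 < √D := Real.sqrt_pos.2 (by linarith)
  set K := 6 * c * r / √D with hK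
  have hK0 : 0 < K := by positivity
  have hK2 : K ^ 2 * D = 36 * c ^ 2 * r ^ 2 := by
    rw [hK, div_pow, Real.sq_sqrt (by linarith)]
    have : D ≠ 0 := by linarith
    field_simp
    norm_num
  obtain ⟨gB, hgB1, hgB2⟩ := chaining τ (R := 1) (D := D) (K := K) le_rfl
    (fun a => max_le (hqM a) (hqΘ a)) hD1 hK0 (by
      rw [Module.finrank_prod, finrank_frobParam, Real.log_one]
      push_cast
      linarith)
    (P := E.P) (fun a => E.noise p A a.1) (fun a => aemeasurable_noise hA hC hAm)
    (fun a b => by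
      refine lintegral_exp_noise_sub_le hA hB hC hAm hc hGm hG2 hg a.2.2.1 b.2.2.1 hK0 ?_
      rw [hK2]
      have h1 := hsum a
      have h2 := hsum b
      have h3 : ∑ i, ∑ j, ((a.1.1 i j - b.1.1 i j) ^ 2 + (a.1.2 i j - b.1.2 i j) ^ 2) ≤
          ∑ i, ∑ j, (2 * ((a.1.1 - E.M) i j ^ 2 + (a.1.2 - E.Θ) i j ^ 2) +
            2 * ((b.1.1 - E.M) i j ^ 2 + (b.1.2 - E.Θ) i j ^ 2)) := by
        refine Finset.sum_le_sum fun i _ => Finset.sum_le_sum fun j _ => ?_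
        simp only [Matrix.sub_apply]
        nlinarith [sq_nonneg ((a.1.1 i j - E.M i j) + (b.1.1 i j - E.M i j)),
          sq_nonneg ((a.1.2 i j - E.Θ i j) + (b.1.2 i j - E.Θ i j))]
      have h4 : ∑ i, ∑ j, (2 * ((a.1.1 - E.M) i j ^ 2 + (a.1.2 - E.Θ) i j ^ 2) +
            2 * ((b.1.1 - E.M) i j ^ 2 + (b.1.2 - E.Θ) i j ^ 2)) ≤ 4 * r ^ 2 := by
        simp only [Finset.sum_add_distrib, ← Finset.mul_sum] at h1 h2 ⊢
        linarith
      calc _ ≤ 4 * c ^ 2 * (4 * r ^ 2) := by gcongr; exact h3.trans h4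
        _ ≤ _ := by nlinarith [sq_nonneg (c * r)])
    (fun a b δ hδ hab => by
      refine lintegral_exp_noise_sub_le hA hB hC hAm hc hGm hG2 hg a.2.2.1 b.2.2.1
        (by positivity) ?_
      have h1 := hinc a b δ hab
      calc _ ≤ 4 * c ^ 2 * (8 * r ^ 2 * δ ^ 2) := by gcongr
        _ ≤ 36 * c ^ 2 * r ^ 2 * δ ^ 2 := by nlinarith [sq_nonneg (c * r * δ)]
        _ = _ := by rw [← hK2]; ring)
    (by
      have hgi : ∀ i j, Integrable (fun ω => c * |G i j ω|) E.P := by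
        intro i j
        refine ((integrable_exp_sq_of_lintegral_le (hGm i j) (hG2 i j)).1.mono'
          (hGm i j).norm.aestronglyMeasurable (ae_of_all _ fun ω => ?_)).const_mul c
        have h1 := Real.add_one_le_exp (G i j ω ^ 2)
        have h2 := sq_nonneg (|G i j ω| - 1 / 2)
        rw [sub_sq, sq_abs] at h2
        rw [norm_norm, Real.norm_eq_abs]
        linarith
      filter_upwards [exists_lipschitz_noise hA hB hC hAm hg hgi] with ω ⟨C, hω⟩
      refine ⟨C * (4 * r), fun a b => ?_⟩
      rw [mul_assoc]
      refine hω _ _ a.2.2.1 b.2.2.1 _ fun i j => ?_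
      have h1 := hinc a b _ le_rfl
      have h2 : (a.1.1 i j - b.1.1 i j) ^ 2 + (a.1.2 i j - b.1.2 i j) ^ 2 ≤
          (4 * r * ‖τ a - τ b‖) ^ 2 := by
        calc _ ≤ ∑ j, ((a.1.1 i j - b.1.1 i j) ^ 2 + (a.1.2 i j - b.1.2 i j) ^ 2) :=
              Finset.single_le_sum (f := fun j => (a.1.1 i j - b.1.1 i j) ^ 2 +
                (a.1.2 i j - b.1.2 i j) ^ 2) (fun j _ => by positivity) (Finset.mem_univ j)
          _ ≤ _ := Finset.single_le_sum (f := fun i => ∑ j, ((a.1.1 i j - b.1.1 i j) ^ 2 +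
                (a.1.2 i j - b.1.2 i j) ^ 2)) (fun j _ => by positivity) (Finset.mem_univ i)
          _ ≤ _ := h1
          _ ≤ _ := by nlinarith [sq_nonneg (r * ‖τ a - τ b‖)]
      have h3 : 0 ≤ 4 * r * ‖τ a - τ b‖ := by positivity
      exact ⟨abs_le_of_sq_le_sq (by nlinarith [sq_nonneg (a.1.2 i j - b.1.2 i j)]) h3,
        abs_le_of_sq_le_sq (by nlinarith [sq_nonneg (a.1.1 i j - b.1.1 i j)]) h3⟩)
    ⟨(E.M, E.Θ), hA.truth, hB.inBox, by
      have : E.dist (E.M, E.Θ) ^ 2 = 0 := by rw [dist_sq]; simp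
      rw [pow_eq_zero_iff two_ne_zero] at this
      rw [this]; exact hr.le⟩
  refine ⟨gB, hgB1, fun ω hω a h1 h2 h3 => ?_⟩
  have := hgB2 ω hω ⟨a, h1, h2, h3⟩
  rw [noise_truth, sub_zero] at this
  refine this.trans (le_of_eq ?_)
  rw [hK]
  nth_rewrite 2 [← Real.mul_self_sqrt (by linarith : 0 ≤ D)]
  field_simp
  norm_num

theorem two_add_log_le {d : ℝ} (hd : 1 ≤ d) : 2 + Real.log (2 * d) ≤ 3 * √d := by
  have h0 : 0 < √d := Real.sqrt_pos.2 (by linarith)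
  have h1 : Real.log (2 * d) = Real.log 2 + 2 * Real.log (√d) := by
    rw [Real.log_mul (by norm_num) (by linarith), Real.log_sqrt (by linarith)]; ring
  have h2 := Real.log_le_sub_one_of_pos h0
  have h3 := Real.log_two_lt_d9
  have h4 : 1 ≤ √d := Real.one_le_sqrt.2 hd
  linarith

theorem rpow_three_halves {x : ℝ} (hx : 0 < x) : x ^ (3 / 2 : ℝ) = x * √x := by
  rw [show (3 / 2 : ℝ) = 1 + 1 / 2 by norm_num, Real.rpow_add hx, Real.rpow_one,
    Real.sqrt_eq_rpow]

/-- Uniform bound of bounded noise over all pairs in the box. The factors are rescaled by `2 d`, the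
Lipschitz constant of the product, so that the noise has increments of size one in them. As the
chaining starts at the scale of the box, the rescaling costs only a logarithm of `d`. -/
theorem exists_exceptional_of_bounded (hA : E.AssumptionA p) (hB : E.AssumptionB p)
    (hC : E.AssumptionC p) (hAm : ∀ i j, MeasurableSet (A i j)) {c g α : ℝ}
    (hc1 : 1 ≤ c) (hcα : p.η * α + 2 * p.η * p.Ll * p.αm ≤ c) (hα : 0 ≤ α)
    (hαm : 0 ≤ p.αm) (hαθ : 0 ≤ p.αθ) (hαs : 0 < p.αm + p.αθ) (hd : 1 ≤ p.d)
    (hn₁ : 0 < n₁) (hgc : g ≤ 2 * c * √((n₁ : ℝ) + n₂))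
    (hg : IsEnvelope E p A fun _ _ _ => g)
    (hs2i : ∀ i j, Integrable (fun ω => E.score i j (E.M i j) ω ^ 2) E.P)
    (hs2 : ∀ i j, ∫ ω, E.score i j (E.M i j) ω ^ 2 ∂E.P ≤ α ^ 2) {D : ℝ}
    (hD : 6 * (p.d : ℝ) ^ (3 / 2 : ℝ) * ((n₁ : ℝ) + n₂) ≤ D) :
    ∃ B : Set E.Ω, E.P B ≤ ENNReal.ofReal (4 * Real.exp (-D)) ∧ ∀ ω ∉ B, ∀ a,
      IsSharedFactor p.ds p.dm p.dθ a.1 a.2 → InBox p a →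
      |E.noise p A a ω| ≤ 160 * c * √((n₁ : ℝ) + n₂) * (p.αm + p.αθ) * D := by
  let T := {a : Matrix (Fin n₁) (Fin n₂) ℝ × Matrix (Fin n₁) (Fin n₂) ℝ //
    IsSharedFactor p.ds p.dm p.dθ a.1 a.2 ∧ InBox p a}
  have hM : ∀ a : T, ∃ q : SupParam p.d n₁ n₂, ‖q‖ ≤ 1 ∧
      ∀ i j, a.1.1 i j = p.αm * ∑ k, q.1 i k * q.2 j k := fun a =>
    exists_supParam a.2.1.rank_le.1 hαm a.2.2.1
  have hΘ : ∀ a : T, ∃ q : SupParam p.d n₁ n₂, ‖q‖ ≤ 1 ∧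
      ∀ i j, a.1.2 i j = p.αθ * ∑ k, q.1 i k * q.2 j k := fun a =>
    exists_supParam a.2.1.rank_le.2 hαθ a.2.2.2
  choose qM hqM hqM' using hM
  choose qΘ hqΘ hqΘ' using hΘ
  have hd' : (1 : ℝ) ≤ p.d := by exact_mod_cast hd
  set R : ℝ := 2 * p.d with hR
  have hR0 : 0 < R := by positivity
  let τ : T → SupParam p.d n₁ n₂ × SupParam p.d n₁ n₂ := fun a => (R • qM a, R • qΘ a)
  have hsm : ∀ {q q' : SupParam p.d n₁ n₂} {δ : ℝ}, ‖R • q - R • q'‖ ≤ δ → ‖q - q'‖ ≤ δ / R := by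
    intro q q' δ h
    rw [← smul_sub, norm_smul, Real.norm_eq_abs, abs_of_pos hR0] at h
    rw [le_div_iff₀ hR0, mul_comm]
    exact h
  have hinc : ∀ a b : T, ∀ δ : ℝ, ‖τ a - τ b‖ ≤ δ → ∀ i j,
      |a.1.1 i j - b.1.1 i j| ≤ p.αm * δ ∧ |a.1.2 i j - b.1.2 i j| ≤ p.αθ * δ := by
    intro a b δ hδ i j
    have h1 := abs_supParam_sub_le (hqM a) (hqM b) hαm
      (hsm ((norm_fst_le (τ a - τ b)).trans hδ)) i j
    have h2 := abs_supParam_sub_le (hqΘ a) (hqΘ b) hαθ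
      (hsm ((norm_snd_le (τ a - τ b)).trans hδ)) i j
    simp only [← hqM', ← hqΘ'] at h1 h2
    rw [← hR, mul_div_cancel₀ _ hR0.ne'] at h1 h2
    exact ⟨h1, h2⟩
  set N : ℝ := (n₁ : ℝ) + n₂ with hN
  have hN1 : 1 ≤ N := by
    have : (1 : ℝ) ≤ n₁ := by exact_mod_cast hn₁
    have : (0 : ℝ) ≤ n₂ := Nat.cast_nonneg _
    linarith
  have hNN : (n₁ : ℝ) * n₂ ≤ N ^ 2 := by
    have h1 : (0 : ℝ) ≤ n₁ := Nat.cast_nonneg _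
    have h2 : (0 : ℝ) ≤ n₂ := Nat.cast_nonneg _
    rw [hN]
    nlinarith
  have hd32 : (1 : ℝ) ≤ (p.d : ℝ) ^ (3 / 2 : ℝ) := Real.one_le_rpow hd' (by norm_num)
  have hDN : N ≤ D := by nlinarith
  have hsN : 0 < √N := Real.sqrt_pos.2 (by linarith)
  have hsN2 : √N ^ 2 = N := Real.sq_sqrt (by linarith)
  set K := 4 * c * √N * (p.αm + p.αθ) with hK
  have hK0 : 0 < K := by positivity
  have hK2 : K ^ 2 = 16 * c ^ 2 * N * (p.αm + p.αθ) ^ 2 := by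
    rw [hK, mul_pow, mul_pow, mul_pow, hsN2]; ring
  have hvar : 16 * c ^ 2 * (p.αm + p.αθ) ^ 2 * ((n₁ : ℝ) * n₂) ≤ K ^ 2 * D := by
    rw [hK2]
    calc _ ≤ 16 * c ^ 2 * (p.αm + p.αθ) ^ 2 * (N * D) := by
          have hND : (n₁ : ℝ) * n₂ ≤ N * D := hNN.trans (by rw [sq]; gcongr)
          gcongr
      _ = _ := by ring
  obtain ⟨gB, hgB1, hgB2⟩ := chaining τ (R := R) (D := D) (K := K) (by linarith)
    (fun a => max_le
      (by
        rw [norm_smul, Real.norm_eq_abs, abs_of_pos hR0]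
        exact mul_le_of_le_one_right hR0.le (hqM a))
      (by
        rw [norm_smul, Real.norm_eq_abs, abs_of_pos hR0]
        exact mul_le_of_le_one_right hR0.le (hqΘ a))) (hN1.trans hDN) hK0 (by
      rw [Module.finrank_prod, finrank_supParam]
      push_cast
      have h1 := two_add_log_le hd'
      rw [rpow_three_halves (by linarith)] at hD
      rw [← hR] at h1
      calc (p.d * N + p.d * N) * (2 + Real.log R) ≤ (p.d * N + p.d * N) * (3 * √p.d) := by gcongr
        _ = 6 * (p.d * √p.d) * N := by ring
        _ ≤ D := hD)
    (P := E.P) (fun a => E.noise p A a.1) (fun a => aemeasurable_noise hA hC hAm)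
    (fun a b => by
      refine lintegral_exp_noise_sub_le_of_bounded hA hB hC hAm hc1 hcα hα hαm hg hs2i hs2
        a.2.2 b.2.2 (ρm := 2 * p.αm) (ρθ := 2 * p.αθ) hK0 (fun i j => ?_) ?_ ?_
      · have h1 := abs_le.1 (a.2.2.1 i j)
        have h2 := abs_le.1 (b.2.2.1 i j)
        have h3 := abs_le.1 (a.2.2.2 i j)
        have h4 := abs_le.1 (b.2.2.2 i j)
        exact ⟨abs_le.2 ⟨by linarith, by linarith⟩, abs_le.2 ⟨by linarith, by linarith⟩⟩
      · calc g * (2 * p.αm + 2 * p.αθ) ≤ 2 * c * √N * (2 * p.αm + 2 * p.αθ) := by gcongr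
          _ = K := by rw [hK]; ring
      · refine le_trans (le_of_eq ?_) hvar
        ring)
    (fun a b δ hδ hab => by
      refine lintegral_exp_noise_sub_le_of_bounded hA hB hC hAm hc1 hcα hα hαm hg hs2i hs2
        a.2.2 b.2.2 (ρm := p.αm * δ) (ρθ := p.αθ * δ) (by positivity) (hinc a b δ hab) ?_ ?_
      · calc g * (p.αm * δ + p.αθ * δ) ≤ 2 * c * √N * (p.αm * δ + p.αθ * δ) := by gcongr
          _ ≤ 2 * (2 * c * √N * (p.αm * δ + p.αθ * δ)) := by
            have : 0 ≤ 2 * c * √N * (p.αm * δ + p.αθ * δ) := by positivity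
            linarith
          _ = K * δ := by rw [hK]; ring
      · calc _ = (16 * c ^ 2 * (p.αm + p.αθ) ^ 2 * ((n₁ : ℝ) * n₂)) * δ ^ 2 / 4 := by ring
          _ ≤ K ^ 2 * D * δ ^ 2 := by
            have h1 := mul_le_mul_of_nonneg_right hvar (sq_nonneg δ)
            have h2 : 0 ≤ K ^ 2 * D * δ ^ 2 := by
              have : 0 ≤ D := by linarith
              positivity
            linarith
          _ = _ := by ring)
    (by
      filter_upwards [exists_lipschitz_noise hA hB hC hAm hg fun i j => integrable_const g]
        with ω ⟨C, hω⟩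
      refine ⟨C * (p.αm + p.αθ), fun a b => ?_⟩
      rw [mul_assoc]
      refine hω _ _ a.2.2 b.2.2 _ fun i j => ?_
      obtain ⟨h1, h2⟩ := hinc a b _ le_rfl i j
      have h3 := norm_nonneg (τ a - τ b)
      exact ⟨h1.trans (by nlinarith), h2.trans (by nlinarith)⟩)
    ⟨(E.M, E.Θ), hA.truth, hB.inBox⟩
  refine ⟨gB, hgB1, fun ω hω a h1 h2 => ?_⟩
  have := hgB2 ω hω ⟨a, h1, h2⟩
  rw [noise_truth, sub_zero] at this
  refine this.trans (le_of_eq ?_)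
  rw [hK]
  ring

/-! ### Tail bounds for the estimation error -/

/-- The event that some data point falls into the discarded region. -/
def badEvent (E : Experiment.{u} n₁ n₂) (A : Fin n₁ → Fin n₂ → Set ℝ) : Set E.Ω :=
  {ω | ∃ i j, E.x ω i j ∉ A i j}

theorem tsum_ofReal_exp_le {D : ℝ} (hD : 1 ≤ D) :
    ∑' k : ℕ, ENNReal.ofReal (4 * Real.exp (-(4 ^ k * D))) ≤
      ENNReal.ofReal (8 * Real.exp (-D)) := by
  have h1 : ∀ k : ℕ, ENNReal.ofReal (4 * Real.exp (-(4 ^ k * D))) ≤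
      ENNReal.ofReal (8 * Real.exp (-D)) * (1 / 2) ^ (k + 1) := by
    intro k
    have h2 : Real.exp (-(4 ^ k * D)) ≤ Real.exp (-D) * (1 / 2) ^ k := by
      have h3 : (k : ℝ) + 1 ≤ 4 ^ k := by
        have := one_add_mul_le_pow (by norm_num : (-2 : ℝ) ≤ 3) k
        norm_num at this
        have hk : (0 : ℝ) ≤ k := Nat.cast_nonneg k
        linarith
      have h4 : Real.exp (-(k : ℝ)) ≤ (1 / 2) ^ k := by
        rw [show (-(k : ℝ)) = (k : ℝ) * (-1) by ring, Real.exp_nat_mul]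
        gcongr
        rw [Real.exp_neg, one_div]
        gcongr
        have := Real.add_one_le_exp (1 : ℝ); linarith
      calc Real.exp (-(4 ^ k * D)) ≤ Real.exp (-D + -(k : ℝ)) := by
            apply Real.exp_le_exp.2
            have hk : (0 : ℝ) ≤ k := Nat.cast_nonneg k
            nlinarith
        _ = Real.exp (-D) * Real.exp (-(k : ℝ)) := Real.exp_add _ _
        _ ≤ _ := by gcongr
    calc _ ≤ ENNReal.ofReal ((8 * Real.exp (-D)) * (1 / 2) ^ (k + 1)) := by
          apply ENNReal.ofReal_le_ofReal
          rw [pow_succ]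
          linarith
      _ = _ := by
          rw [ENNReal.ofReal_mul (by positivity), ENNReal.ofReal_pow (by norm_num)]
          congr 2
          rw [ENNReal.ofReal_div_of_pos (by norm_num)]; simp
  refine (ENNReal.tsum_le_tsum h1).trans (le_of_eq ?_)
  rw [ENNReal.tsum_mul_left, ENNReal.tsum_geometric_add_one, one_div, ENNReal.one_sub_inv_two,
    inv_inv, ENNReal.inv_mul_cancel (by norm_num) (by norm_num), mul_one]

theorem measureReal_le_of_subset {Ω : Type*} [MeasurableSpace Ω] {P : Measure Ω}
    [IsProbabilityMeasure P] {S B F : Set Ω} (h : S ⊆ B ∪ F) {x : ℝ} (hx : 0 ≤ x)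
    (hF : P F ≤ ENNReal.ofReal x) : P.real S ≤ P.real B + x := by
  calc P.real S ≤ P.real (B ∪ F) := measureReal_mono h
    _ ≤ P.real B + P.real F := measureReal_union_le _ _
    _ ≤ _ := by
      gcongr
      exact ENNReal.toReal_le_of_le_ofReal hx hF

theorem one_le_eight_mul_exp {x : ℝ} (hx : x ≤ 1) : 1 ≤ 8 * Real.exp (-x) := by
  have h1 : Real.exp (-1) ≤ Real.exp (-x) := Real.exp_le_exp.2 (by linarith)
  have h2 : 1 / 8 ≤ Real.exp (-1) := by
    rw [Real.exp_neg, one_div]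
    gcongr
    have := Real.exp_one_lt_d9
    linarith
  linarith

/-- Tail bound for sub-Gaussian noise, by peeling over Frobenius shells: the deviation of the noise
on the shell of radius `2 ^ k t` is less than the curvature there. The bound is trivial for `d = 0`,
where the exponent is a quotient by zero, and unless `8 d (n₁ + n₂)` is at most the level `D`
of the chaining; hence the restriction in `hbt`. -/
theorem measureReal_le_of_subGaussian (hA : E.AssumptionA p) (hB : E.AssumptionB p)
    (hC : E.AssumptionC p) (hAm : ∀ i j, MeasurableSet (A i j)) {c₀ : ℝ} (hc : 0 < c₀)
    {G : Fin n₁ → Fin n₂ → E.Ω → ℝ} (hGm : ∀ i j, AEMeasurable (G i j) E.P)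
    (hG2 : ∀ i j, ∫⁻ ω, ENNReal.ofReal (Real.exp (G i j ω ^ 2)) ∂E.P ≤ 2)
    (hg : IsEnvelope E p A fun i j ω => 10 * c₀ * |G i j ω|) {b q : ℝ} (hb : 0 ≤ b) (hq : 0 ≤ q)
    (hbq : IsTruncationBias E p A b q) (hq' : p.η * q ≤ p.αh / 2) {t : ℝ} (ht : 0 ≤ t)
    (hbt : 0 < p.d → 8 * p.d * ((n₁ : ℝ) + n₂) ≤ p.αh ^ 2 * t ^ 2 / (10 ^ 8 * c₀ ^ 2) →
      p.η * (b * √((n₁ : ℝ) * n₂)) ≤ (p.αh / 2 - p.η * q) * t)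
    (hn₁ : 0 < n₁) (est : E.Estimator) :
    E.P.real (E.goodEvent p est ∩ {ω | t ≤ E.error est ω}) ≤ E.P.real (E.badEvent A) +
      8 * Real.exp (-(1 / 10 ^ 10 * (p.αh ^ 2 / (c₀ ^ 2 * p.d)) *
        (t ^ 2 / ((n₁ : ℝ) + n₂)))) := by
  have hαh := αh_pos hB hC
  set N : ℝ := (n₁ : ℝ) + n₂ with hN
  have hN1 : 1 ≤ N := by
    have : (1 : ℝ) ≤ n₁ := by exact_mod_cast hn₁
    have : (0 : ℝ) ≤ n₂ := Nat.cast_nonneg _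
    linarith
  -- the level at which the bound `2400 c₀ (2 t) √D` of the noise on the first shell is below
  -- `α_h t ^ 2 / 2`
  set D := p.αh ^ 2 * t ^ 2 / (10 ^ 8 * c₀ ^ 2) with hD
  have hD0 : 0 ≤ D := by positivity
  rcases Nat.eq_zero_or_pos p.d with hd0 | hd0
  · have h1 := measureReal_nonneg (μ := E.P) (s := E.badEvent A)
    have h2 : E.P.real (E.goodEvent p est ∩ {ω | t ≤ E.error est ω}) ≤ 1 := measureReal_le_one
    have h3 := one_le_eight_mul_exp zero_le_one
    rw [hd0]
    simp only [Nat.cast_zero, mul_zero, div_zero, zero_mul]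
    linarith
  have hd : (1 : ℝ) ≤ p.d := by exact_mod_cast hd0
  have hexp : 1 / 10 ^ 10 * (p.αh ^ 2 / (c₀ ^ 2 * p.d)) * (t ^ 2 / N) =
      1 / 100 * (D / (p.d * N)) := by
    rw [hD]; field_simp; ring
  have hdN : 1 ≤ p.d * N := by nlinarith
  rw [hexp]
  rcases lt_or_ge D (8 * p.d * N) with h | h
  · have h1 := measureReal_nonneg (μ := E.P) (s := E.badEvent A)
    have h2 : E.P.real (E.goodEvent p est ∩ {ω | t ≤ E.error est ω}) ≤ 1 := measureReal_le_one
    have h3 : 1 / 100 * (D / (p.d * N)) ≤ 1 := by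
      have : D / (p.d * N) ≤ 8 := by
        rw [div_le_iff₀ (by linarith)]; linarith
      linarith
    have := one_le_eight_mul_exp h3
    linarith
  have hD1 : 1 ≤ D := by nlinarith
  have ht0 : 0 < t := by
    rcases ht.eq_or_lt with h0 | h0
    · rw [hD, ← h0] at hD1; norm_num at hD1
    · exact h0
  have hsqrtD : √D = p.αh * t / (10 ^ 4 * c₀) := by
    rw [hD, show p.αh ^ 2 * t ^ 2 / (10 ^ 8 * c₀ ^ 2) = (p.αh * t / (10 ^ 4 * c₀)) ^ 2 by
      field_simp]
    exact Real.sqrt_sq (by positivity)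
  have hexc := fun k : ℕ => exists_exceptional_of_subGaussian hA hB hC hAm
    (by positivity : 0 < 10 * c₀) hGm hG2 hg (r := 2 ^ (k + 1) * t) (D := 4 ^ k * D)
    (by positivity)
    (hD1.trans (le_mul_of_one_le_left hD0 (one_le_pow₀ (by norm_num))))
    (h.trans (le_mul_of_one_le_left hD0 (one_le_pow₀ (by norm_num))))
  choose B hB1 hB2 using hexc
  refine (measureReal_le_of_subset (B := E.badEvent A) (F := ⋃ k, B k)
    (x := 8 * Real.exp (-D)) ?_ (by positivity)
    ((measure_iUnion_le _).trans ((ENNReal.tsum_le_tsum hB1).trans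
      (tsum_ofReal_exp_le hD1)))).trans ?_
  · rintro ω ⟨⟨hopt, hbox⟩, hω : t ≤ E.dist (est ω)⟩
    by_contra hcon
    simp only [Set.mem_union, not_or, Set.mem_iUnion, not_exists] at hcon
    obtain ⟨hbad, hnB⟩ := hcon
    have hx : ∀ i j, E.x ω i j ∈ A i j := by simpa [badEvent] using hbad
    have h1 := half_dist_sq_le_noise hA hB hC hAm hb hq hbq hq' (hbt hd0 h) hbox hω hopt hx
    obtain ⟨k, hk1, hk2⟩ := exists_nat_pow_near ((one_le_div ht0).2 hω)
      (by norm_num : (1 : ℝ) < 2)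
    rw [le_div_iff₀ ht0] at hk1
    rw [div_lt_iff₀ ht0] at hk2
    have h2 := (le_abs_self _).trans (hB2 k ω (hnB k) (est ω) hopt.1 hbox hk2.le)
    have h3 : √(4 ^ k * D) = 2 ^ k * √D := by
      rw [Real.sqrt_mul (by positivity), show (4 : ℝ) ^ k = (2 ^ k) ^ 2 by
        rw [← pow_mul, mul_comm, pow_mul]; norm_num, Real.sqrt_sq (by positivity)]
    rw [h3, hsqrtD] at h2
    have h4 : 240 * (10 * c₀) * (2 ^ (k + 1) * t) * (2 ^ k * (p.αh * t / (10 ^ 4 * c₀))) =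
        48 / 100 * (p.αh * (2 ^ k * t) ^ 2) := by
      rw [pow_succ]; field_simp; norm_num
    rw [h4] at h2
    have h5 : p.αh / 2 * (2 ^ k * t) ^ 2 ≤ p.αh / 2 * E.dist (est ω) ^ 2 := by gcongr
    have h6 : 0 < p.αh * (2 ^ k * t) ^ 2 := by positivity
    linarith
  · gcongr
    have : D / (p.d * N) ≤ D := div_le_self hD0 hdN
    linarith

/-- Tail bound for bounded noise. A bound over the whole box suffices here: the noise is at most of
order `α_h t ^ 2`, whatever the distance to the truth. -/
theorem measureReal_le_of_bounded (hA : E.AssumptionA p) (hB : E.AssumptionB p)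
    (hC : E.AssumptionC p) (hAm : ∀ i j, MeasurableSet (A i j)) {c g α : ℝ}
    (hc1 : 1 ≤ c) (hcα : p.η * α + 2 * p.η * p.Ll * p.αm ≤ c) (hα : 0 ≤ α)
    (hαm : 0 ≤ p.αm) (hαθ : 0 ≤ p.αθ)
    (hn₁ : 0 < n₁) (hgc : g ≤ 2 * c * √((n₁ : ℝ) + n₂))
    (hg : IsEnvelope E p A fun _ _ _ => g)
    (hs2i : ∀ i j, Integrable (fun ω => E.score i j (E.M i j) ω ^ 2) E.P)
    (hs2 : ∀ i j, ∫ ω, E.score i j (E.M i j) ω ^ 2 ∂E.P ≤ α ^ 2)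
    {b q : ℝ} (hb : 0 ≤ b) (hq : 0 ≤ q)
    (hbq : IsTruncationBias E p A b q) (hq' : p.η * q ≤ p.αh / 2) {t : ℝ} (ht : 0 < t)
    (hbt : p.η * (b * √((n₁ : ℝ) * n₂)) ≤ (p.αh / 2 - p.η * q) * t) (est : E.Estimator) :
    E.P.real (E.goodEvent p est ∩ {ω | t ≤ E.error est ω}) ≤ E.P.real (E.badEvent A) +
      8 * Real.exp (-(1 / 10 ^ 10 * (p.αh / (c * (p.αm + p.αθ) * (p.d : ℝ) ^ (3 / 2 : ℝ))) *
        (t ^ 2 / ((n₁ : ℝ) + n₂) ^ (3 / 2 : ℝ)))) := by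
  have hαh := αh_pos hB hC
  set N : ℝ := (n₁ : ℝ) + n₂ with hN
  have hN1 : 1 ≤ N := by
    have : (1 : ℝ) ≤ n₁ := by exact_mod_cast hn₁
    have : (0 : ℝ) ≤ n₂ := Nat.cast_nonneg _
    linarith
  have hbad := measureReal_nonneg (μ := E.P) (s := E.badEvent A)
  have hone : E.P.real (E.goodEvent p est ∩ {ω | t ≤ E.error est ω}) ≤ 1 := measureReal_le_one
  rcases Nat.eq_zero_or_pos p.d with hd0 | hd0
  · have h3 := one_le_eight_mul_exp zero_le_one
    rw [hd0]
    rw [Nat.cast_zero, Real.zero_rpow (by norm_num)]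
    simp only [mul_zero, div_zero, zero_mul]
    linarith
  rcases (add_nonneg hαm hαθ).eq_or_lt with hα0 | hα0
  · have h3 := one_le_eight_mul_exp zero_le_one
    rw [← hα0]
    simp only [mul_zero, div_zero, zero_mul]
    linarith
  have hd : (1 : ℝ) ≤ p.d := by exact_mod_cast hd0
  have hsN : 0 < √N := Real.sqrt_pos.2 (by linarith)
  rw [rpow_three_halves (by linarith : 0 < N)]
  set d' := (p.d : ℝ) ^ (3 / 2 : ℝ) with hd'
  have hd1 : 1 ≤ d' := Real.one_le_rpow hd (by norm_num)
  -- the level at which the bound of the noise is below `α_h t ^ 2 / 2`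
  set D := p.αh * t ^ 2 / (400 * c * √N * (p.αm + p.αθ)) with hD
  have hD0 : 0 ≤ D := by positivity
  have hexp : 1 / 10 ^ 10 * (p.αh / (c * (p.αm + p.αθ) * d')) * (t ^ 2 / (N * √N)) =
      400 / 10 ^ 10 * (D / (d' * N)) := by
    rw [hD]; field_simp
  rw [hexp]
  have hdN : 1 ≤ d' * N := by nlinarith
  rcases lt_or_ge D (6 * d' * N) with h | h
  · have h3 : 400 / 10 ^ 10 * (D / (d' * N)) ≤ 1 := by
      have : D / (d' * N) ≤ 6 := by
        rw [div_le_iff₀ (by linarith)]; linarith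
      linarith
    have := one_le_eight_mul_exp h3
    linarith
  obtain ⟨B, hB1, hB2⟩ := exists_exceptional_of_bounded hA hB hC hAm hc1 hcα hα hαm hαθ hα0
    hd0 hn₁ hgc hg hs2i hs2 h
  refine (measureReal_le_of_subset (B := E.badEvent A) (F := B)
    (x := 4 * Real.exp (-D)) ?_ (by positivity) hB1).trans ?_
  · rintro ω ⟨⟨hopt, hbox⟩, hω : t ≤ E.dist (est ω)⟩
    by_contra hcon
    simp only [Set.mem_union, not_or] at hcon
    obtain ⟨hbad, hnB⟩ := hcon
    have hx : ∀ i j, E.x ω i j ∈ A i j := by simpa [badEvent] using hbad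
    have h1 := half_dist_sq_le_noise hA hB hC hAm hb hq hbq hq' hbt hbox hω hopt hx
    have h2 := (le_abs_self _).trans (hB2 ω hnB (est ω) hopt.1 hbox)
    have h4 : 160 * c * √N * (p.αm + p.αθ) * D = 40 / 100 * (p.αh * t ^ 2) := by
      rw [hD]; field_simp; norm_num
    rw [h4] at h2
    have h5 : p.αh / 2 * t ^ 2 ≤ p.αh / 2 * E.dist (est ω) ^ 2 := by gcongr
    have h6 : 0 < p.αh * t ^ 2 := by positivity
    linarith
  · have h7 : D / (d' * N) ≤ D := div_le_self hD0 hdN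
    have h8 : Real.exp (-D) ≤ Real.exp (-(400 / 10 ^ 10 * (D / (d' * N)))) :=
      Real.exp_le_exp.2 (by linarith)
    have := Real.exp_pos (-D)
    linarith

/-! ### Truncation of the scores -/

/-- The data values at which the score is at most `τ`. -/
def truncSet (E : Experiment.{u} n₁ n₂) (τ : ℝ) (i : Fin n₁) (j : Fin n₂) : Set ℝ :=
  {x | |E.scoreFun i j x| ≤ τ}

theorem measurableSet_truncSet (hB : E.AssumptionB p) (hC : E.AssumptionC p) (τ : ℝ) (i : Fin n₁)
    (j : Fin n₂) : MeasurableSet (E.truncSet τ i j) :=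
  measurableSet_le (measurable_scoreFun hB hC i j).abs measurable_const

/-- By the mean value inequality, the loss increment of a discarded point is at most
`(|s| + L |m - m⋆|) |m - m⋆|`, with `s` its score at the truth. -/
theorem isTruncationBias_truncSet (hA : E.AssumptionA p) (hB : E.AssumptionB p)
    (hC : E.AssumptionC p) {τ b v : ℝ}
    (hs : ∀ i j, Integrable (E.score i j (E.M i j)) E.P)
    (hv : ∀ i j, E.P.real {ω | τ < |E.score i j (E.M i j) ω|} ≤ v)
    (hb : ∀ i j, ∫ ω, (Set.Ioi τ).indicator id |E.score i j (E.M i j) ω| ∂E.P ≤ b) :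
    IsTruncationBias E p (E.truncSet τ) b (p.Ll * v) := by
  intro i j m hm
  have hL := hC.Ll_pos
  set X := E.score i j (E.M i j) with hX
  have hXm : AEMeasurable X E.P := aemeasurable_score hA hB hC i j
  have hms : NullMeasurableSet {ω | τ < |X ω|} E.P :=
    nullMeasurableSet_lt aemeasurable_const (by fun_prop)
  set δ := m - E.M i j with hδ
  have hi1 : Integrable (fun ω => (Set.Ioi τ).indicator id |X ω|) E.P := by
    refine (hs i j).abs.mono' ?_ (ae_of_all _ fun ω => ?_)
    · exact ((measurable_id.indicator measurableSet_Ioi).comp_aemeasurable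
        hXm.abs).aestronglyMeasurable
    · refine (norm_indicator_le_norm_self _ _).trans (by simp [hX])
  have hi2 : Integrable ({ω | τ < |X ω|}.indicator (1 : E.Ω → ℝ)) E.P :=
    (integrable_const (1 : ℝ)).indicator₀ hms
  calc _ ≤ ∫ ω, (|δ| * (Set.Ioi τ).indicator id |X ω| +
        p.Ll * δ ^ 2 * {ω | τ < |X ω|}.indicator (1 : E.Ω → ℝ) ω) ∂E.P := by
        refine integral_mono_of_nonneg
          (ae_of_all _ fun ω => Set.indicator_nonneg (fun x _ => abs_nonneg _) _)
          ((hi1.const_mul _).add (hi2.const_mul _)) ?_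
        filter_upwards [abs_l_sub_le hB hC] with ω hω
        by_cases h : τ < |X ω|
        · have h1 : E.x ω i j ∈ (E.truncSet τ i j)ᶜ := not_le.2 h
          rw [Set.indicator_of_mem h1, Set.indicator_of_mem (Set.mem_Ioi.2 h),
            Set.indicator_of_mem (show ω ∈ {ω | τ < |X ω|} from h)]
          have h2 := hω i j m hm _ (hB.mem_Icc_M i j) |δ| le_rfl (by simp)
          refine h2.trans (le_of_eq ?_)
          rw [← sq_abs δ]
          simp only [id, Pi.one_apply]
          ring
        · have h1 : E.x ω i j ∉ (E.truncSet τ i j)ᶜ := not_not.2 (not_lt.1 h)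
          rw [Set.indicator_of_notMem h1,
            Set.indicator_of_notMem (show |X ω| ∉ Set.Ioi τ from h),
            Set.indicator_of_notMem (show ω ∉ {ω | τ < |X ω|} from h)]
          simp
    _ = |δ| * ∫ ω, (Set.Ioi τ).indicator id |X ω| ∂E.P +
        p.Ll * δ ^ 2 * E.P.real {ω | τ < |X ω|} := by
        rw [integral_add (hi1.const_mul _) (hi2.const_mul _), integral_const_mul,
          integral_const_mul, integral_indicator_one_of_nullMeasurableSet hms]
    _ ≤ |δ| * b + p.Ll * δ ^ 2 * v := by
        gcongr
        · exact hb i j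
        · exact hv i j
    _ = _ := by ring

theorem measureReal_badEvent_truncSet_le {τ v : ℝ}
    (hv : ∀ i j, E.P.real {ω | τ < |E.score i j (E.M i j) ω|} ≤ v) :
    E.P.real (E.badEvent (E.truncSet τ)) ≤ (n₁ : ℝ) * n₂ * v := by
  have h : E.badEvent (E.truncSet τ) =
      ⋃ e : Fin n₁ × Fin n₂, {ω | τ < |E.score e.1 e.2 (E.M e.1 e.2) ω|} := by
    ext ω
    rw [Set.mem_iUnion, Prod.exists]
    exact exists_congr fun i => exists_congr fun j =>
      not_le (a := |E.score i j (E.M i j) ω|) (b := τ)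
  rw [h]
  refine (measureReal_iUnion_fintype_le _).trans ?_
  refine (Finset.sum_le_sum fun e _ => hv e.1 e.2).trans (le_of_eq ?_)
  simp

theorem AssumptionB.αm_nonneg (hB : E.AssumptionB p) (hn₁ : 0 < n₁) (hn₂ : 0 < n₂) : 0 ≤ p.αm :=
  (abs_nonneg _).trans (hB.bound_M ⟨0, hn₁⟩ ⟨0, hn₂⟩)

theorem AssumptionB.αθ_nonneg (hB : E.AssumptionB p) (hn₁ : 0 < n₁) (hn₂ : 0 < n₂) : 0 ≤ p.αθ :=
  (abs_nonneg _).trans (hB.bound_Θ ⟨0, hn₁⟩ ⟨0, hn₂⟩)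

theorem η_mul_min (hB : E.AssumptionB p) : p.η * min (p.κ / p.η) p.αl = p.αh := by
  rw [mul_min_of_nonneg _ _ hB.eta_pos.le, mul_div_cancel₀ _ hB.eta_pos.ne', Params.αh]

theorem one_le_add_cast (hn₁ : 0 < n₁) : (1 : ℝ) ≤ (n₁ : ℝ) + n₂ := by
  have : (1 : ℝ) ≤ n₁ := by exact_mod_cast hn₁
  have : (0 : ℝ) ≤ n₂ := Nat.cast_nonneg _
  linarith

/-! ### Tail bounds under the conditions on the score -/

theorem tail_of_subGaussianScore (hA : E.AssumptionA p) (hB : E.AssumptionB p)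
    (hC : E.AssumptionC p) (hn₁ : 0 < n₁) (hn₂ : 0 < n₂) (est : E.Estimator) {α : ℝ}
    (hS : E.SubGaussianScore α) {t : ℝ} (ht : 0 ≤ t) :
    E.P.real (E.goodEvent p est ∩ {ω | t ≤ E.error est ω}) ≤
      8 * Real.exp (-(1 / 10 ^ 10 * (p.αh ^ 2 / (p.cPsi2 α ^ 2 * p.d)) *
        (t ^ 2 / ((n₁ : ℝ) + n₂)))) := by
  have hη := hB.eta_pos
  have hαm := hB.αm_nonneg hn₁ hn₂
  have hL := hC.Ll_pos
  have hαh := αh_pos hB hC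
  have hα := hS.nonneg
  set c := p.cPsi2 α with hc
  have hl0 : 0 < √(Real.log 2) := Real.sqrt_pos.2 (Real.log_pos (by norm_num))
  have hl1 : √(Real.log 2) ≤ 1 := Real.sqrt_le_one.2 (by have := Real.log_two_lt_d9; linarith)
  have hc1 : 1 ≤ c := (one_le_one_div hl0 hl1).trans (le_max_left _ _)
  have hc2 : 2 * p.η * p.Ll * p.αm + p.η * α ≤ c := by
    refine le_trans ?_ (le_max_right _ _)
    gcongr
    rw [le_div_iff₀ hl0]
    exact mul_le_of_le_one_right (by positivity) hl1
  have h3 : 0 ≤ 2 * p.η * p.Ll * p.αm := by positivity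
  have h4 : 0 ≤ p.η * α := by positivity
  -- a constant beyond the Orlicz norm, which may be attained only in the limit, and which is
  -- positive for `α = 0` as well
  set β := α + c / p.η with hβ
  have hβ0 : 0 < β := by positivity
  have hβ2 : p.η * β ≤ 2 * c := by
    rw [hβ, mul_add, mul_div_cancel₀ _ hη.ne']; linarith
  have hαβ : α < β := by rw [hβ]; linarith [div_pos (by linarith : 0 < c) hη]
  have hbad : E.P.real (E.badEvent fun _ _ => Set.univ) = 0 := by
    simp [badEvent]
  have h := measureReal_le_of_subGaussian hA hB hC (A := fun _ _ => Set.univ)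
    (fun _ _ => MeasurableSet.univ) (c₀ := c) (by linarith)
    (G := fun i j ω => √((1 + (E.score i j (E.M i j) ω / β) ^ 2) / 4))
    (fun i j => by
      have := aemeasurable_score hA hB hC i j
      fun_prop)
    (fun i j => lintegral_exp_sq_sqrt_le
      (lintegral_psi_le_of_orliczNorm_le hα hαβ (hS.tail i j)))
    (ae_of_all _ fun ω i j => ?_) (b := 0) (q := 0) le_rfl le_rfl (fun i j m _ => by simp)
    (by rw [mul_zero]; positivity) ht (fun _ _ => by simp; positivity) hn₁ est
  · rwa [hbad, zero_add] at h
  · set s := E.score i j (E.M i j) ω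
    set G := √((1 + (s / β) ^ 2) / 4) with hG
    have hG0 : 0 ≤ G := Real.sqrt_nonneg _
    have hG1 : 1 / 2 ≤ G := Real.le_sqrt_of_sq_le (by nlinarith [sq_nonneg (s / β)])
    have hG2 : |s| / β / 2 ≤ G := by
      refine Real.le_sqrt_of_sq_le ?_
      rw [div_pow, div_pow, sq_abs, div_pow]
      linarith
    change 1 ≤ 10 * c * |G| ∧ (_ → p.η * (|s| + _) ≤ 10 * c * |G|)
    rw [abs_of_nonneg hG0]
    refine ⟨by nlinarith, fun _ => ?_⟩
    have h6 : p.η * |s| ≤ 4 * c * G := by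
      calc p.η * |s| = p.η * β * (|s| / β) := by field_simp
        _ ≤ 2 * c * (2 * G) := by gcongr; linarith
        _ = _ := by ring
    nlinarith

/-- A bounded score is dominated by a constant `G = 1 / 2`, for which `exp (G ^ 2) ≤ 2`. -/
theorem isEnvelope_const {τ c : ℝ} (hη : 0 < p.η) (hc : 1 ≤ c)
    (h : p.η * (τ + 2 * p.Ll * p.αm) ≤ 5 * c) :
    IsEnvelope E p (E.truncSet τ) fun _ _ _ => 10 * c * |(1 / 2 : ℝ)| := by
  refine ae_of_all _ fun ω i j => ?_
  have h1 : 10 * c * |(1 / 2 : ℝ)| = 5 * c := by rw [abs_of_pos (by norm_num)]; ring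
  simp only [h1]
  refine ⟨by linarith, fun hx => le_trans ?_ h⟩
  have : |E.score i j (E.M i j) ω| ≤ τ := hx
  gcongr

theorem lintegral_exp_half_sq_le {Ω : Type*} [MeasurableSpace Ω] {P : Measure Ω}
    [IsProbabilityMeasure P] : ∫⁻ _, ENNReal.ofReal (Real.exp ((1 / 2 : ℝ) ^ 2)) ∂P ≤ 2 := by
  rw [lintegral_const, measure_univ, mul_one, show ((1 / 2 : ℝ) ^ 2) = 1 / 4 by norm_num]
  refine (ENNReal.ofReal_le_ofReal (exp_quarter_le.trans (by norm_num : (8 / 5 : ℝ) ≤ 2))).trans ?_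
  simp

set_option maxHeartbeats 800000 in
/-- Truncation at `τ = 3 α log (n₁ n₂)`, which a score exceeds with probability
`2 / (n₁ n₂) ^ 2` at most. -/
theorem tail_of_subExponentialScore (hA : E.AssumptionA p) (hB : E.AssumptionB p)
    (hC : E.AssumptionC p) (hn₁ : 0 < n₁) (hn₂ : 0 < n₂) (est : E.Estimator) {α : ℝ}
    (hS : E.SubExponentialScore p α) {t : ℝ}
    (ht : Real.log ((n₁ : ℝ) * n₂) / √((n₁ : ℝ) * n₂) ≤ t) :
    E.P.real (E.goodEvent p est ∩ {ω | t ≤ E.error est ω}) ≤ 2 / ((n₁ : ℝ) * n₂) +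
      8 * Real.exp (-(1 / 10 ^ 10 * (p.αh ^ 2 / (p.η ^ 2 * α ^ 2 * p.d)) *
        (t ^ 2 / (((n₁ : ℝ) + n₂) * Real.log ((n₁ : ℝ) * n₂) ^ 2)))) := by
  have hη := hB.eta_pos
  have hL := hC.Ll_pos
  have hαh := αh_pos hB hC
  have hn1 : (1 : ℝ) ≤ n₁ := by exact_mod_cast hn₁
  have hn2 : (1 : ℝ) ≤ n₂ := by exact_mod_cast hn₂
  set N : ℝ := (n₁ : ℝ) + n₂ with hN
  set n : ℝ := (n₁ : ℝ) * n₂ with hn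
  have hn0 : 0 < n := by positivity
  have hnN : n ≤ N ^ 2 := by rw [hn, hN]; nlinarith
  have hN1 : 1 ≤ N := one_le_add_cast hn₁
  set ℓ := Real.log n with hℓ
  have hℓ1 : 1 ≤ ℓ := (Real.le_log_iff_exp_le hn0).2 hS.const₃
  have hℓN : ℓ ≤ 2 * N := by
    have h1 : ℓ ≤ Real.log (N ^ 2) := Real.log_le_log hn0 hnN
    rw [Real.log_pow] at h1
    have h2 := Real.log_le_sub_one_of_pos (by linarith : 0 < N)
    push_cast at h1
    linarith
  have ht0 : 0 ≤ t := le_trans (by positivity) ht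
  have hαl1 := (le_max_left _ _).trans hS.const₁
  have hαl2 := (le_max_right _ _).trans hS.const₁
  have hα : 0 < α := by
    have h1 : 0 < α * ℓ := lt_of_lt_of_le (by positivity) hαl2
    exact pos_of_mul_pos_left h1 (by linarith)
  set c := p.η * α * ℓ with hc
  have hc1 : 1 ≤ c := by
    rw [div_le_iff₀ hη] at hαl2
    linarith
  have hexp : Real.exp (-(2 * ℓ)) = 1 / n ^ 2 := by
    rw [Real.exp_neg, show 2 * ℓ = Real.log (n ^ 2) by rw [Real.log_pow]; push_cast; rfl,
      Real.exp_log (by positivity), one_div]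
  have htail := fun i j => tail_le_of_orliczNorm_one (aemeasurable_score hA hB hC i j) hα
    (by linarith : 1 ≤ 2 * ℓ) (hS.tail i j)
  simp only [hexp] at htail
  set τ := 3 / 2 * α * (2 * ℓ) with hτ
  have hbias := isTruncationBias_truncSet hA hB hC (fun i j => (htail i j).1)
    (fun i j => (htail i j).2.1) (fun i j => (htail i j).2.2)
  have hn32 : n ^ (3 / 2 : ℝ) = n * √n := rpow_three_halves hn0
  have hsn : 0 < √n := Real.sqrt_pos.2 hn0
  have hsn2 : √n * √n = n := Real.mul_self_sqrt hn0.le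
  have hsN : 0 < √N := Real.sqrt_pos.2 (by linarith)
  have hsN2 : √N * √N = N := Real.mul_self_sqrt (by linarith)
  have hconst : p.η * (p.Ll * (2 * (1 / n ^ 2))) + p.η * (6 * α * √N / (n * √n)) ≤ p.αh / 2 := by
    have h1 := mul_le_mul_of_nonneg_left hS.const₂ hη.le
    rw [mul_left_comm p.η (1 / 2), η_mul_min hB, hn32] at h1
    rw [show (n₁ : ℝ) ^ 2 * (n₂ : ℝ) ^ 2 = n ^ 2 by rw [hn]; ring] at h1
    rw [mul_add] at h1
    refine le_trans (le_of_eq ?_) (h1.trans (by linarith))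
    ring
  have hpos2 : 0 ≤ p.η * (6 * α * √N / (n * √n)) := by positivity
  have h := measureReal_le_of_subGaussian hA hB hC (measurableSet_truncSet hB hC τ) (c₀ := c)
    (by linarith) (G := fun _ _ _ => 1 / 2) (fun _ _ => aemeasurable_const)
    (fun _ _ => lintegral_exp_half_sq_le)
    (isEnvelope_const hη hc1 (by
      have := mul_le_mul_of_nonneg_left hαl1 hη.le
      rw [hτ, hc]; linarith)) (by positivity) (by positivity) hbias (by linarith) ht0
    (fun hd h8 => by
      have hd1 : (1 : ℝ) ≤ p.d := by exact_mod_cast hd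
      have h9 : 2 * √N ≤ t := by
        rw [le_div_iff₀ (by positivity)] at h8
        have h10 : p.αh ≤ 1 := (min_le_left _ _).trans (p.κ_le.trans (by norm_num))
        have h11 : p.αh ^ 2 * t ^ 2 ≤ 1 * t ^ 2 := by
          gcongr
          exact pow_le_one₀ hαh.le h10
        have h12 : 4 * N ≤ 8 * p.d * N * (10 ^ 8 * c ^ 2) := by
          have h13 : (1 : ℝ) ≤ c ^ 2 := one_le_pow₀ hc1
          calc 4 * N ≤ (8 * 1 * N) * (10 ^ 8 * 1) := by linarith
            _ ≤ _ := by gcongr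
        refine le_of_sq_le_sq ?_ ht0
        nlinarith
      -- `log (n₁ n₂) ≤ √N t`, so the bias is compared with the second condition on the constants
      have h13 : ℓ ≤ √N * t := by nlinarith
      refine le_trans ?_ (mul_le_mul_of_nonneg_right
        (by linarith : p.η * (6 * α * √N / (n * √n)) ≤ _) ht0)
      calc p.η * (3 * α * (2 * ℓ) * (1 / n ^ 2) * √n) = p.η * (6 * α * ℓ / (n * √n)) := by
            have e : 1 / n ^ 2 * √n = 1 / (n * √n) := by
              rw [div_mul_eq_mul_div, one_mul, div_eq_div_iff (by positivity) (by positivity),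
                one_mul, show √n * (n * √n) = n * (√n * √n) by ring, hsn2, sq]
            rw [mul_assoc (3 * α * (2 * ℓ)), e]
            ring
        _ ≤ p.η * (6 * α * (√N * t) / (n * √n)) := by gcongr
        _ = _ := by ring) hn₁ est
  refine h.trans (add_le_add ?_ (le_of_eq ?_))
  · refine (measureReal_badEvent_truncSet_le fun i j => (htail i j).2.1).trans (le_of_eq ?_)
    rw [← hn]
    field_simp
  · rw [hc, ← hN]
    congr 3
    ring_nf

/-- Truncation at `τ = α K`, so that the truncated score is treated as sub-Gaussian with constant
`η α K`. -/
theorem tail_of_eightMomentScore (hA : E.AssumptionA p) (hB : E.AssumptionB p)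
    (hC : E.AssumptionC p) (hn₁ : 0 < n₁) (est : E.Estimator) {α ζ : ℝ}
    (hS : E.EightMomentScore p α ζ) {t : ℝ}
    (ht : ((n₁ : ℝ) + n₂) ^ (-((8 + 5 * ζ) / (32 + 2 * ζ))) ≤ t) :
    E.P.real (E.goodEvent p est ∩ {ω | t ≤ E.error est ω}) ≤
      (n₁ : ℝ) * n₂ / ((n₁ : ℝ) + n₂) ^ (2 + 2 * ζ / (16 + ζ)) +
      8 * Real.exp (-(1 / 10 ^ 10 * (p.αh ^ 2 / (p.η ^ 2 * α ^ 2 * p.d)) *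
        (t ^ 2 / ((n₁ : ℝ) + n₂) ^ (1 + 2 / (4 + ζ / 4))))) := by
  have hη := hB.eta_pos
  have hL := hC.Ll_pos
  have hαh := αh_pos hB hC
  have hα := hS.α_pos
  have hζ := hS.ζ_pos
  set N : ℝ := (n₁ : ℝ) + n₂ with hN
  set n : ℝ := (n₁ : ℝ) * n₂ with hn
  have hn0 : 0 ≤ n := by positivity
  have hN1 : 1 ≤ N := one_le_add_cast hn₁
  have hN0 : 0 < N := by linarith
  have ht0 : 0 < t := lt_of_lt_of_le (by positivity) ht
  set K := N ^ (1 / (4 + ζ / 4)) with hK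
  have hK0 : 0 < K := by positivity
  have hKpow : ∀ s : ℝ, K ^ s = N ^ (1 / (4 + ζ / 4) * s) := fun s => by
    rw [hK, ← Real.rpow_mul hN0.le]
  have hα1 := (le_max_left _ _).trans hS.const₁
  have hα2 := (le_max_right _ _).trans hS.const₁
  rw [← hN, ← hK] at hα1 hα2
  set c := p.η * α * K with hc
  have hc1 : 1 ≤ c := by
    rw [div_le_iff₀ hη] at hα2
    linarith
  have htail := fun i j => tail_le_of_eLpNorm (aemeasurable_score hA hB hC i j)
    (by linarith : 1 ≤ 8 + ζ) hα hK0 (hS.tail i j)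
  have hv : K ^ (-(8 + ζ)) = (N ^ (2 + 2 * ζ / (16 + ζ)))⁻¹ := by
    rw [hKpow, ← Real.rpow_neg hN0.le]
    congr 1
    field_simp
    ring
  have hv2 : K ^ (-(8 + ζ)) ≤ 1 / N ^ 2 := by
    rw [hv, one_div, ← Real.rpow_natCast]
    have : 0 < 2 * ζ / (16 + ζ) := by positivity
    gcongr
    · push_cast; linarith
  -- the exponent in the lower bound on `t` is what the bias leaves over
  have hbK : K ^ (-(8 + ζ - 1)) = N ^ (-(3 / 2) : ℝ) * N ^ (-((8 + 5 * ζ) / (32 + 2 * ζ))) := by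
    rw [hKpow, ← Real.rpow_add hN0]
    congr 1
    field_simp
    ring
  have hbias := isTruncationBias_truncSet hA hB hC (fun i j => (htail i j).1)
    (fun i j => (htail i j).2.1.trans hv2) (fun i j => (htail i j).2.2)
  have hconst := mul_le_mul_of_nonneg_left hS.const₂ hη.le
  rw [mul_left_comm p.η (1 / 2), η_mul_min hB, mul_add, ← hN, ← hn] at hconst
  have h1 : α * (√n * N ^ (-(3 / 2) : ℝ)) ≤
      max α (1 / p.η) * (8 + ζ) / (7 + ζ) * (√n / N ^ (3 / 2 : ℝ)) := by
    rw [Real.rpow_neg hN0.le, ← div_eq_mul_inv]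
    gcongr
    rw [le_div_iff₀ (by positivity)]
    exact mul_le_mul (le_max_left _ _) (by linarith) (by positivity) (by positivity)
  have h2 := mul_le_mul_of_nonneg_left h1 hη.le
  have h2' : 0 ≤ p.η * (α * (√n * N ^ (-(3 / 2) : ℝ))) := by positivity
  have hq : p.η * (p.Ll * (1 / N ^ 2)) = p.η * (p.Ll / N ^ 2) := by ring
  have h := measureReal_le_of_subGaussian hA hB hC (measurableSet_truncSet hB hC (α * K)) (c₀ := c)
    (by linarith) (G := fun _ _ _ => 1 / 2) (fun _ _ => aemeasurable_const)
    (fun _ _ => lintegral_exp_half_sq_le)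
    (isEnvelope_const hη hc1 (by
      have := mul_le_mul_of_nonneg_left hα1 hη.le
      rw [hc] at hc1 ⊢; linarith)) (by positivity) (by positivity) hbias (by linarith) ht0.le
    (fun _ _ => by
      refine le_trans ?_ (mul_le_mul_of_nonneg_right
        (by linarith : p.η * (α * (√n * N ^ (-(3 / 2) : ℝ))) ≤ _) ht0.le)
      rw [hbK]
      calc _ = p.η * (α * (√n * N ^ (-(3 / 2) : ℝ))) * N ^ (-((8 + 5 * ζ) / (32 + 2 * ζ))) := by
            ring
        _ ≤ _ := by gcongr) hn₁ est
  refine h.trans (add_le_add ?_ (le_of_eq ?_))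
  · refine (measureReal_badEvent_truncSet_le fun i j => (htail i j).2.1).trans (le_of_eq ?_)
    rw [← hn, hv]
    exact (div_eq_mul_inv _ _).symm
  · have hN2 : N ^ (1 + 2 / (4 + ζ / 4)) = N * K ^ 2 := by
      rw [Real.rpow_add hN0, Real.rpow_one, ← Real.rpow_natCast K, hKpow]
      congr 2
      push_cast
      ring
    rw [hc, hN2, ← hN]
    congr 3
    ring_nf

/-- Truncation at `τ = α √N`, the largest level for which Bernstein's bound is governed by the
second moment. -/
theorem tail_of_fourMomentScore (hA : E.AssumptionA p) (hB : E.AssumptionB p)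
    (hC : E.AssumptionC p) (hn₁ : 0 < n₁) (hn₂ : 0 < n₂) (est : E.Estimator) {α δ : ℝ}
    (hS : E.FourMomentScore p α δ) {t : ℝ} (ht : ((n₁ : ℝ) + n₂) ^ (-(δ / 2)) < t) :
    E.P.real (E.goodEvent p est ∩ {ω | t ≤ E.error est ω}) ≤
      (n₁ : ℝ) * n₂ / ((n₁ : ℝ) + n₂) ^ (2 + δ / 2) +
      8 * Real.exp (-(1 / 10 ^ 10 *
        (p.αh / (p.cDelta α * (p.αm + p.αθ) * (p.d : ℝ) ^ (3 / 2 : ℝ))) *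
        (t ^ 2 / ((n₁ : ℝ) + n₂) ^ (3 / 2 : ℝ)))) := by
  have hη := hB.eta_pos
  have hL := hC.Ll_pos
  have hαh := αh_pos hB hC
  have hα := hS.α_pos
  have hδ := hS.δ_pos
  have hαm := hB.αm_nonneg hn₁ hn₂
  have hαθ := hB.αθ_nonneg hn₁ hn₂
  set N : ℝ := (n₁ : ℝ) + n₂ with hN
  set n : ℝ := (n₁ : ℝ) * n₂ with hn
  have hn0 : 0 ≤ n := by positivity
  have hN1 : 1 ≤ N := one_le_add_cast hn₁
  have hN0 : 0 < N := by linarith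
  have ht0 : 0 < t := lt_trans (by positivity) ht
  have hsN : 1 ≤ √N := Real.one_le_sqrt.2 hN1
  have hKpow : ∀ s : ℝ, √N ^ s = N ^ (1 / 2 * s) := fun s => by
    rw [Real.sqrt_eq_rpow, ← Real.rpow_mul hN0.le]
  set c := p.cDelta α with hc
  have hc1 : 1 ≤ c := le_max_right _ _
  have hc2 : p.η * α + 2 * p.η * p.Ll * p.αm ≤ c := le_max_left _ _
  have htail := fun i j => tail_le_of_eLpNorm (aemeasurable_score hA hB hC i j)
    (by linarith : 1 ≤ 4 + δ) hα (by linarith : 0 < √N) (hS.tail i j)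
  have hv : √N ^ (-(4 + δ)) = (N ^ (2 + δ / 2))⁻¹ := by
    rw [hKpow, ← Real.rpow_neg hN0.le]
    congr 1
    ring
  have hv2 : √N ^ (-(4 + δ)) ≤ 1 / N ^ 2 := by
    rw [hv, one_div, ← Real.rpow_natCast]
    gcongr
    · push_cast; linarith
  have hbK : √N ^ (-(4 + δ - 1)) = N ^ (-(3 / 2) : ℝ) * N ^ (-(δ / 2)) := by
    rw [hKpow, ← Real.rpow_add hN0]
    congr 1
    ring
  have hbias := isTruncationBias_truncSet hA hB hC (fun i j => (htail i j).1)
    (fun i j => (htail i j).2.1.trans hv2) (fun i j => (htail i j).2.2)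
  have hconst := mul_le_mul_of_nonneg_left hS.const hη.le
  rw [mul_left_comm p.η (1 / 2), η_mul_min hB, mul_add, ← hN, ← hn] at hconst
  have h1 : α * (√n * N ^ (-(3 / 2) : ℝ)) ≤
      max α (1 / p.η) * (4 + δ) / (3 + δ) * (√n / N ^ (3 / 2 : ℝ)) := by
    rw [Real.rpow_neg hN0.le, ← div_eq_mul_inv]
    gcongr
    rw [le_div_iff₀ (by positivity)]
    exact mul_le_mul (le_max_left _ _) (by linarith) (by positivity) (by positivity)
  have h2 := mul_le_mul_of_nonneg_left h1 hη.le
  have h2' : 0 ≤ p.η * (α * (√n * N ^ (-(3 / 2) : ℝ))) := by positivity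
  have hq : p.η * (p.Ll * (1 / N ^ 2)) = p.η * (p.Ll / N ^ 2) := by ring
  have hs2 := fun i j => integrable_rpow_of_eLpNorm_le (aemeasurable_score hA hB hC i j)
    two_pos hα.le ((eLpNorm_le_eLpNorm_of_exponent_le
      (ENNReal.ofReal_le_ofReal (by linarith : (2 : ℝ) ≤ 4 + δ))
      (aemeasurable_score hA hB hC i j).aestronglyMeasurable).trans (hS.tail i j))
  simp only [Real.rpow_two, sq_abs] at hs2
  have h := measureReal_le_of_bounded hA hB hC (measurableSet_truncSet hB hC (α * √N))
    (g := max 1 (p.η * (α * √N + 2 * p.Ll * p.αm))) hc1 hc2 hα.le hαm hαθ hn₁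
    (max_le (by nlinarith) (by
      have h3 : 2 * p.η * p.Ll * p.αm ≤ 2 * p.η * p.Ll * p.αm * √N :=
        le_mul_of_one_le_right (by positivity) hsN
      have h4 := mul_le_mul_of_nonneg_right hc2 (Real.sqrt_nonneg N)
      have h5 : 0 ≤ c * √N := by positivity
      rw [← hN]
      linarith))
    (ae_of_all _ fun ω i j => ⟨le_max_left _ _, fun hx => le_trans (by
      have : |E.score i j (E.M i j) ω| ≤ α * √N := hx
      gcongr) (le_max_right _ _)⟩)
    (fun i j => (hs2 i j).1) (fun i j => (hs2 i j).2) (by positivity) (by positivity) hbias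
    (by linarith) ht0
    (by
      refine le_trans ?_ (mul_le_mul_of_nonneg_right
        (by linarith : p.η * (α * (√n * N ^ (-(3 / 2) : ℝ))) ≤ _) ht0.le)
      rw [hbK]
      calc _ = p.η * (α * (√n * N ^ (-(3 / 2) : ℝ))) * N ^ (-(δ / 2)) := by
            ring
        _ ≤ _ := by gcongr) est
  refine h.trans (add_le_add ?_ le_rfl)
  refine (measureReal_badEvent_truncSet_le fun i j => (htail i j).2.1).trans (le_of_eq ?_)
  rw [← hn, hv]
  exact (div_eq_mul_inv _ _).symm

end Experiment

/-! ### From tail bounds to stochastic orders -/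

theorem inter_eq_empty_of_eq_zero {Ω : Type*} {A : Set Ω} {a : Ω → ℝ} {b : ℝ}
    (h : ∀ ω ∈ A, a ω = 0) (hb : 0 ≤ b) {C : ℝ} (hC : 0 < C) : A ∩ {ω | C * b < a ω} = ∅ := by
  refine Set.eq_empty_of_forall_notMem fun ω hω => ?_
  have h1 : C * b < a ω := hω.2
  rw [h ω hω.1] at h1
  have := mul_nonneg hC.le hb
  linarith

section Orders

variable {Ω : ℕ → Type u} [∀ k, MeasurableSpace (Ω k)] {P : ∀ k, Measure (Ω k)}
  {A : ∀ k, Set (Ω k)} {a : ∀ k, Ω k → ℝ} {b : ℕ → ℝ}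

theorem isBigOInProbOn_of_tail [∀ k, IsProbabilityMeasure (P k)] {r : ℕ → ℝ}
    (hr : Tendsto r atTop (𝓝 0)) {c : ℝ} (hc : 0 < c)
    (h : ∀ C : ℝ, 1 ≤ C → ∀ᶠ k in atTop,
      (P k).real (A k ∩ {ω | C * b k ≤ a k ω}) ≤ r k + 8 * Real.exp (-(c * C ^ 2))) :
    IsBigOInProbOn P A a b := by
  intro ε hε
  obtain ⟨x, hx0, hx⟩ : ∃ x : ℝ, 0 < x ∧ ENNReal.ofReal x ≤ ε := by
    obtain ⟨y, hy0, hy⟩ := ENNReal.lt_iff_exists_nnreal_btwn.1 hε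
    exact ⟨y, by exact_mod_cast hy0, by simpa using hy.le⟩
  have h1 : Tendsto (fun C : ℝ => 8 * Real.exp (-(c * C ^ 2))) atTop (𝓝 0) := by
    have h2 : Tendsto (fun C : ℝ => c * C ^ 2) atTop atTop :=
      (tendsto_pow_atTop two_ne_zero).const_mul_atTop hc
    simpa using (Real.tendsto_exp_neg_atTop_nhds_zero.comp h2).const_mul 8
  obtain ⟨C, hC, hC1⟩ := ((h1.eventually (ge_mem_nhds hx0)).and (eventually_ge_atTop 1)).exists
  refine ⟨C, by linarith, le_trans ?_ hx⟩
  have h3 : Tendsto (fun k => ENNReal.ofReal (r k + x)) atTop (𝓝 (ENNReal.ofReal x)) := by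
    have := hr.add_const x
    rw [zero_add] at this
    exact ENNReal.tendsto_ofReal this
  rw [← h3.limsup_eq]
  refine limsup_le_limsup ?_
  filter_upwards [h C hC1] with k hk
  rw [← ofReal_measureReal]
  refine ENNReal.ofReal_le_ofReal ?_
  refine (measureReal_mono ?_).trans (hk.trans (add_le_add le_rfl hC))
  exact Set.inter_subset_inter_right _ fun ω (hω : C * b k < a k ω) => hω.le

theorem isLittleOInProbOn_of_tail [∀ k, IsProbabilityMeasure (P k)]
    (h : ∀ C : ℝ, 0 < C → ∃ s : ℕ → ℝ, Tendsto s atTop (𝓝 0) ∧ ∀ᶠ k in atTop,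
      (P k).real (A k ∩ {ω | C * b k ≤ a k ω}) ≤ s k) :
    IsLittleOInProbOn P A a b := by
  intro C hC
  obtain ⟨s, hs, hs'⟩ := h C hC
  have h3 : Tendsto (fun k => ENNReal.ofReal (s k)) atTop (𝓝 0) := by
    simpa using ENNReal.tendsto_ofReal hs
  refine tendsto_of_tendsto_of_tendsto_of_le_of_le' tendsto_const_nhds h3
    (Eventually.of_forall fun _ => zero_le) ?_
  filter_upwards [hs'] with k hk
  rw [← ofReal_measureReal]
  refine ENNReal.ofReal_le_ofReal ((measureReal_mono ?_).trans hk)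
  exact Set.inter_subset_inter_right _ fun ω (hω : C * b k < a k ω) => hω.le

theorem isBigOInProbOn_of_eq_zero (h : ∀ k, ∀ ω ∈ A k, a k ω = 0) (hb : ∀ k, 0 ≤ b k) :
    IsBigOInProbOn P A a b := fun ε _ => ⟨1, one_pos, by
  simp only [inter_eq_empty_of_eq_zero (h _) (hb _) one_pos, measure_empty, limsup_const,
    zero_le]⟩

theorem isLittleOInProbOn_of_eq_zero (h : ∀ k, ∀ ω ∈ A k, a k ω = 0) (hb : ∀ k, 0 ≤ b k) :
    IsLittleOInProbOn P A a b := fun C hC => by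
  simp only [inter_eq_empty_of_eq_zero (h _) (hb _) hC, measure_empty]
  exact tendsto_const_nhds

end Orders

namespace Experiment

theorem error_eq_zero_of_entries {n₁ n₂ : ℕ} {E : Experiment.{u} n₁ n₂} {est : E.Estimator}
    {ω : E.Ω} (h1 : (est ω).1 = E.M) (h2 : (est ω).2 = E.Θ) : E.error est ω = 0 := by
  have h : E.dist (est ω) ^ 2 = 0 := by rw [dist_sq, h1, h2]; simp
  exact pow_eq_zero_iff two_ne_zero |>.1 h

theorem error_eq_zero_of_rank {n₁ n₂ : ℕ} {E : Experiment.{u} n₁ n₂} {p : Params}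
    (hA : E.AssumptionA p) (hd : p.d = 0) (est : E.Estimator) {ω : E.Ω}
    (hω : ω ∈ E.goodEvent p est) : E.error est ω = 0 := by
  have hd' : p.ds + p.dm + p.dθ = 0 := hd
  have : IsEmpty (Fin p.ds) := by rw [show p.ds = 0 by omega]; infer_instance
  have : IsEmpty (Fin p.dm) := by rw [show p.dm = 0 by omega]; infer_instance
  have : IsEmpty (Fin p.dθ) := by rw [show p.dθ = 0 by omega]; infer_instance
  have h0 : ∀ M Θ : Matrix (Fin n₁) (Fin n₂) ℝ, IsSharedFactor p.ds p.dm p.dθ M Θ →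
      M = 0 ∧ Θ = 0 := by
    rintro M Θ ⟨Λm1, Λθ1, Λm2, Λθ2, Fs, Fm, Fθ, rfl, rfl, -⟩
    constructor <;> (ext i j; simp [Matrix.mul_apply])
  have h1 := h0 _ _ hω.1.1
  have h2 := h0 _ _ hA.truth
  exact error_eq_zero_of_entries (h1.1.trans h2.1.symm) (h1.2.trans h2.2.symm)

theorem error_eq_zero_of_box {n₁ n₂ : ℕ} {E : Experiment.{u} n₁ n₂} {p : Params}
    (hB : E.AssumptionB p) (hα : p.αm + p.αθ = 0) (hn₁ : 0 < n₁) (hn₂ : 0 < n₂)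
    (est : E.Estimator) {ω : E.Ω} (hω : ω ∈ E.goodEvent p est) : E.error est ω = 0 := by
  have h1 := hB.αm_nonneg hn₁ hn₂
  have h2 := hB.αθ_nonneg hn₁ hn₂
  have h3 : p.αm = 0 := by linarith
  have h4 : p.αθ = 0 := by linarith
  have h0 : ∀ B : Matrix (Fin n₁) (Fin n₂) ℝ, MaxNormLE B 0 → B = 0 := fun B hB => by
    ext i j
    exact abs_nonpos_iff.1 (hB i j)
  have hM := hB.bound_M
  have hΘ := hB.bound_Θ
  obtain ⟨-, h5, h6⟩ := hω
  rw [h3] at hM h5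
  rw [h4] at hΘ h6
  exact error_eq_zero_of_entries ((h0 _ h5).trans (h0 _ hM).symm) ((h0 _ h6).trans (h0 _ hΘ).symm)

theorem cast_mul_div_rpow_le {n₁ n₂ : ℕ} (hn₁ : 0 < n₁) (s : ℝ) :
    (n₁ : ℝ) * n₂ / ((n₁ : ℝ) + n₂) ^ (2 + s) ≤ ((n₁ : ℝ) + n₂) ^ (-s) := by
  have hN : (0 : ℝ) < (n₁ : ℝ) + n₂ := by linarith [one_le_add_cast (n₂ := n₂) hn₁]
  rw [Real.rpow_neg hN.le, Real.rpow_add hN, Real.rpow_two, div_le_iff₀ (by positivity)]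
  have h1 : (0 : ℝ) ≤ n₁ := Nat.cast_nonneg _
  have h2 : (0 : ℝ) ≤ n₂ := Nat.cast_nonneg _
  have h3 : (((n₁ : ℝ) + n₂) ^ s)⁻¹ * (((n₁ : ℝ) + n₂) ^ 2 * ((n₁ : ℝ) + n₂) ^ s) =
      ((n₁ : ℝ) + n₂) ^ 2 := by
    have : ((n₁ : ℝ) + n₂) ^ s ≠ 0 := by positivity
    field_simp
  rw [h3]
  nlinarith

section Sequence

variable {p : Params} {n₁ n₂ : ℕ → ℕ} {E : ∀ k, Experiment.{u} (n₁ k) (n₂ k)}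
  {est : ∀ k, (E k).Estimator}

theorem isBigOInProbOn_of_subGaussianScore (hn₁ : ∀ k, 0 < n₁ k) (hn₂ : ∀ k, 0 < n₂ k)
    (hA : ∀ k, (E k).AssumptionA p) (hB : ∀ k, (E k).AssumptionB p)
    (hC : ∀ k, (E k).AssumptionC p) {α : ℝ} (hS : ∀ k, (E k).SubGaussianScore α) :
    IsBigOInProbOn (fun k => (E k).P) (fun k => (E k).goodEvent p (est k))
      (fun k => (E k).error (est k)) (fun k => √((n₁ k : ℝ) + n₂ k)) := by
  rcases Nat.eq_zero_or_pos p.d with hd | hd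
  · exact isBigOInProbOn_of_eq_zero (fun k ω hω => error_eq_zero_of_rank (hA k) hd (est k) hω)
      fun k => Real.sqrt_nonneg _
  have hαh := αh_pos (hB 0) (hC 0)
  have hc : 0 < p.cPsi2 α := lt_of_lt_of_le (one_div_pos.2
    (Real.sqrt_pos.2 (Real.log_pos (by norm_num)))) (le_max_left _ _)
  have hd' : (0 : ℝ) < p.d := by exact_mod_cast hd
  refine isBigOInProbOn_of_tail (r := fun _ => 0) tendsto_const_nhds
    (c := 1 / 10 ^ 10 * (p.αh ^ 2 / (p.cPsi2 α ^ 2 * p.d))) (by positivity)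
    fun C hC1 => Eventually.of_forall fun k => ?_
  have hN := one_le_add_cast (n₂ := n₂ k) (hn₁ k)
  have h := tail_of_subGaussianScore (hA k) (hB k) (hC k) (hn₁ k) (hn₂ k) (est k) (hS k)
    (t := C * √((n₁ k : ℝ) + n₂ k)) (by positivity)
  rwa [mul_pow, Real.sq_sqrt (by linarith), mul_div_cancel_right₀ _ (by linarith),
    ← zero_add (8 * _)] at h

theorem isBigOInProbOn_of_subExponentialScore (hn₁ : ∀ k, 0 < n₁ k) (hn₂ : ∀ k, 0 < n₂ k)
    (hN : Tendsto (fun k => n₁ k + n₂ k) atTop atTop)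
    (hA : ∀ k, (E k).AssumptionA p) (hB : ∀ k, (E k).AssumptionB p)
    (hC : ∀ k, (E k).AssumptionC p) {α : ℝ} (hS : ∀ k, (E k).SubExponentialScore p α) :
    IsBigOInProbOn (fun k => (E k).P) (fun k => (E k).goodEvent p (est k))
      (fun k => (E k).error (est k))
      (fun k => Real.log ((n₁ k : ℝ) * n₂ k) * √((n₁ k : ℝ) + n₂ k)) := by
  have hlog : ∀ k, 1 ≤ Real.log ((n₁ k : ℝ) * n₂ k) := fun k => by
    have h1 := (hS k).const₃
    exact (Real.le_log_iff_exp_le ((Real.exp_pos 1).trans_le h1)).2 h1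
  rcases Nat.eq_zero_or_pos p.d with hd | hd
  · exact isBigOInProbOn_of_eq_zero (fun k ω hω => error_eq_zero_of_rank (hA k) hd (est k) hω)
      fun k => mul_nonneg (by linarith [hlog k]) (Real.sqrt_nonneg _)
  have hαh := αh_pos (hB 0) (hC 0)
  have hη := (hB 0).eta_pos
  have hα : 0 < α := by
    have h1 : 0 < α * Real.log ((n₁ 0 : ℝ) * n₂ 0) :=
      lt_of_lt_of_le (one_div_pos.2 hη) ((le_max_right _ _).trans (hS 0).const₁)
    exact pos_of_mul_pos_left h1 (by linarith [hlog 0])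
  have hd' : (0 : ℝ) < p.d := by exact_mod_cast hd
  have hcast : Tendsto (fun k => (n₁ k : ℝ) + n₂ k) atTop atTop := by
    have := (tendsto_natCast_atTop_atTop (R := ℝ)).comp hN
    refine this.congr fun k => ?_
    simp
  refine isBigOInProbOn_of_tail (r := fun k => 2 / ((n₁ k : ℝ) * n₂ k)) ?_
    (c := 1 / 10 ^ 10 * (p.αh ^ 2 / (p.η ^ 2 * α ^ 2 * p.d))) (by positivity)
    fun C hC1 => Eventually.of_forall fun k => ?_
  · refine squeeze_zero (fun k => by positivity) (fun k => ?_)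
      (hcast.const_div_atTop 4)
    have h1 : (1 : ℝ) ≤ n₁ k := by exact_mod_cast hn₁ k
    have h2 : (1 : ℝ) ≤ n₂ k := by exact_mod_cast hn₂ k
    rw [div_le_div_iff₀ (by positivity) (by positivity)]
    nlinarith
  have hN1 := one_le_add_cast (n₂ := n₂ k) (hn₁ k)
  have hl := hlog k
  have hn : 1 ≤ √((n₁ k : ℝ) * n₂ k) := by
    have h1 : (1 : ℝ) ≤ n₁ k := by exact_mod_cast hn₁ k
    have h2 : (1 : ℝ) ≤ n₂ k := by exact_mod_cast hn₂ k
    exact Real.one_le_sqrt.2 (one_le_mul_of_one_le_of_one_le h1 h2)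
  have h := tail_of_subExponentialScore (hA k) (hB k) (hC k) (hn₁ k) (hn₂ k) (est k) (hS k)
    (t := C * (Real.log ((n₁ k : ℝ) * n₂ k) * √((n₁ k : ℝ) + n₂ k))) (by
      have h1 : 1 ≤ √((n₁ k : ℝ) + n₂ k) := Real.one_le_sqrt.2 hN1
      calc _ ≤ Real.log ((n₁ k : ℝ) * n₂ k) := div_le_self (by linarith) hn
        _ ≤ Real.log ((n₁ k : ℝ) * n₂ k) * √((n₁ k : ℝ) + n₂ k) :=
          le_mul_of_one_le_right (by linarith) h1
        _ ≤ _ := le_mul_of_one_le_left (by positivity) hC1)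
  have e : (C * (Real.log ((n₁ k : ℝ) * n₂ k) * √((n₁ k : ℝ) + n₂ k))) ^ 2 /
      (((n₁ k : ℝ) + n₂ k) * Real.log ((n₁ k : ℝ) * n₂ k) ^ 2) = C ^ 2 := by
    rw [mul_pow, mul_pow, Real.sq_sqrt (by linarith)]
    have : Real.log ((n₁ k : ℝ) * n₂ k) ≠ 0 := by linarith
    field_simp
  rwa [e] at h

theorem isLittleOInProbOn_of_eightMomentScore (hn₁ : ∀ k, 0 < n₁ k)
    (hN : Tendsto (fun k => n₁ k + n₂ k) atTop atTop)
    (hA : ∀ k, (E k).AssumptionA p) (hB : ∀ k, (E k).AssumptionB p)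
    (hC : ∀ k, (E k).AssumptionC p) {α ζ : ℝ} (hS : ∀ k, (E k).EightMomentScore p α ζ) :
    IsLittleOInProbOn (fun k => (E k).P) (fun k => (E k).goodEvent p (est k))
      (fun k => (E k).error (est k)) (fun k => ((n₁ k : ℝ) + n₂ k) ^ (3 / 4 : ℝ)) := by
  rcases Nat.eq_zero_or_pos p.d with hd | hd
  · exact isLittleOInProbOn_of_eq_zero
      (fun k ω hω => error_eq_zero_of_rank (hA k) hd (est k) hω) fun k => by positivity
  have hαh := αh_pos (hB 0) (hC 0)
  have hη := (hB 0).eta_pos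
  have hα := (hS 0).α_pos
  have hζ := (hS 0).ζ_pos
  have hd' : (0 : ℝ) < p.d := by exact_mod_cast hd
  have hcast : Tendsto (fun k => (n₁ k : ℝ) + n₂ k) atTop atTop := by
    have := (tendsto_natCast_atTop_atTop (R := ℝ)).comp hN
    refine this.congr fun k => ?_
    simp
  have hpow : ∀ s : ℝ, 0 < s → Tendsto (fun k => ((n₁ k : ℝ) + n₂ k) ^ s) atTop atTop :=
    fun s hs => (tendsto_rpow_atTop hs).comp hcast
  refine isLittleOInProbOn_of_tail fun C hC0 => ⟨fun k =>
    ((n₁ k : ℝ) + n₂ k) ^ (-(2 * ζ / (16 + ζ))) +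
      8 * Real.exp (-(1 / 10 ^ 10 * (p.αh ^ 2 / (p.η ^ 2 * α ^ 2 * p.d)) *
        (C ^ 2 * ((n₁ k : ℝ) + n₂ k) ^ (ζ / (2 * (16 + ζ)))))), ?_, ?_⟩
  · have h1 := (tendsto_rpow_neg_atTop (by positivity : 0 < 2 * ζ / (16 + ζ))).comp hcast
    have h2 : Tendsto (fun k => 1 / 10 ^ 10 * (p.αh ^ 2 / (p.η ^ 2 * α ^ 2 * p.d)) *
        (C ^ 2 * ((n₁ k : ℝ) + n₂ k) ^ (ζ / (2 * (16 + ζ))))) atTop atTop :=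
      ((hpow _ (by positivity)).const_mul_atTop (by positivity)).const_mul_atTop (by positivity)
    simpa using h1.add ((Real.tendsto_exp_neg_atTop_nhds_zero.comp h2).const_mul 8)
  · filter_upwards [(hpow (3 / 4) (by norm_num)).eventually_ge_atTop (1 / C)] with k hk
    have hN1 := one_le_add_cast (n₂ := n₂ k) (hn₁ k)
    have hN0 : (0 : ℝ) < (n₁ k : ℝ) + n₂ k := by linarith
    have h := tail_of_eightMomentScore (hA k) (hB k) (hC k) (hn₁ k) (est k) (hS k)
      (t := C * ((n₁ k : ℝ) + n₂ k) ^ (3 / 4 : ℝ)) (by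
        rw [div_le_iff₀ hC0] at hk
        have := Real.rpow_le_one_of_one_le_of_nonpos hN1
          (by rw [neg_nonpos]; positivity : -((8 + 5 * ζ) / (32 + 2 * ζ)) ≤ 0)
        linarith)
    have e : (C * ((n₁ k : ℝ) + n₂ k) ^ (3 / 4 : ℝ)) ^ 2 /
        ((n₁ k : ℝ) + n₂ k) ^ (1 + 2 / (4 + ζ / 4)) =
        C ^ 2 * ((n₁ k : ℝ) + n₂ k) ^ (ζ / (2 * (16 + ζ))) := by
      rw [mul_pow, ← Real.rpow_natCast (_ ^ (3 / 4 : ℝ)), ← Real.rpow_mul hN0.le, mul_div_assoc,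
        ← Real.rpow_sub hN0]
      congr 2
      push_cast
      field_simp
      ring
    rw [e] at h
    exact h.trans (add_le_add (cast_mul_div_rpow_le (hn₁ k) _) le_rfl)

theorem isBigOInProbOn_of_fourMomentScore (hn₁ : ∀ k, 0 < n₁ k) (hn₂ : ∀ k, 0 < n₂ k)
    (hN : Tendsto (fun k => n₁ k + n₂ k) atTop atTop)
    (hA : ∀ k, (E k).AssumptionA p) (hB : ∀ k, (E k).AssumptionB p)
    (hC : ∀ k, (E k).AssumptionC p) {α δ : ℝ} (hS : ∀ k, (E k).FourMomentScore p α δ) :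
    IsBigOInProbOn (fun k => (E k).P) (fun k => (E k).goodEvent p (est k))
      (fun k => (E k).error (est k)) (fun k => ((n₁ k : ℝ) + n₂ k) ^ (3 / 4 : ℝ)) := by
  rcases Nat.eq_zero_or_pos p.d with hd | hd
  · exact isBigOInProbOn_of_eq_zero
      (fun k ω hω => error_eq_zero_of_rank (hA k) hd (est k) hω) fun k => by positivity
  rcases (add_nonneg ((hB 0).αm_nonneg (hn₁ 0) (hn₂ 0))
    ((hB 0).αθ_nonneg (hn₁ 0) (hn₂ 0))).eq_or_lt with hα0 | hα0
  · exact isBigOInProbOn_of_eq_zero (fun k ω hω =>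
      error_eq_zero_of_box (hB k) hα0.symm (hn₁ k) (hn₂ k) (est k) hω) fun k => by positivity
  have hαh := αh_pos (hB 0) (hC 0)
  have hδ := (hS 0).δ_pos
  have hd' : (0 : ℝ) < p.d := by exact_mod_cast hd
  have hc : 0 < p.cDelta α := lt_of_lt_of_le one_pos (le_max_right _ _)
  have hcast : Tendsto (fun k => (n₁ k : ℝ) + n₂ k) atTop atTop := by
    have := (tendsto_natCast_atTop_atTop (R := ℝ)).comp hN
    refine this.congr fun k => ?_
    simp
  refine isBigOInProbOn_of_tail (r := fun k => ((n₁ k : ℝ) + n₂ k) ^ (-(δ / 2)))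
    ((tendsto_rpow_neg_atTop (by positivity)).comp hcast)
    (c := 1 / 10 ^ 10 * (p.αh / (p.cDelta α * (p.αm + p.αθ) * (p.d : ℝ) ^ (3 / 2 : ℝ))))
    (by positivity) fun C hC1 => ?_
  filter_upwards [hcast.eventually_gt_atTop 1] with k hk
  have hN0 : (0 : ℝ) < (n₁ k : ℝ) + n₂ k := by linarith
  have h := tail_of_fourMomentScore (hA k) (hB k) (hC k) (hn₁ k) (hn₂ k) (est k) (hS k)
    (t := C * ((n₁ k : ℝ) + n₂ k) ^ (3 / 4 : ℝ)) (by
      have h1 := Real.rpow_lt_one_of_one_lt_of_neg hk (by linarith : -(δ / 2) < 0)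
      have h2 := Real.one_le_rpow hk.le (by norm_num : (0 : ℝ) ≤ 3 / 4)
      nlinarith)
  have e : (C * ((n₁ k : ℝ) + n₂ k) ^ (3 / 4 : ℝ)) ^ 2 / ((n₁ k : ℝ) + n₂ k) ^ (3 / 2 : ℝ) =
      C ^ 2 := by
    rw [mul_pow, ← Real.rpow_natCast (_ ^ (3 / 4 : ℝ)), ← Real.rpow_mul hN0.le, mul_div_assoc,
      ← Real.rpow_sub hN0]
    norm_num
  rw [e] at h
  exact h.trans (add_le_add (cast_mul_div_rpow_le (hn₁ k) _) le_rfl)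

end Sequence

end Experiment

end

end SharedFactor

theorem theorem1 :
    -- nonasymptotic tail bounds, with universal constants
    (∃ C₁ C₂ : ℝ, 0 < C₁ ∧ 0 < C₂ ∧
      ∀ (n₁ n₂ : ℕ) (E : SharedFactor.Experiment.{u} n₁ n₂) (p : SharedFactor.Params)
        (est : E.Estimator), 0 < n₁ → 0 < n₂ →
        E.AssumptionA p → E.AssumptionB p → E.AssumptionC p →
        -- sub-Gaussian score
        (∀ α : ℝ, E.SubGaussianScore α → ∀ t : ℝ, 0 ≤ t →
          E.P.real (E.goodEvent p est ∩ {ω | t ≤ E.error est ω}) ≤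
            C₁ * Real.exp (-(C₂ * (p.αh ^ 2 / (p.cPsi2 α ^ 2 * p.d)) *
              (t ^ 2 / ((n₁ : ℝ) + n₂))))) ∧
        -- sub-exponential score
        (∀ α : ℝ, E.SubExponentialScore p α →
          ∀ t : ℝ, Real.log ((n₁ : ℝ) * n₂) / √((n₁ : ℝ) * n₂) ≤ t →
          E.P.real (E.goodEvent p est ∩ {ω | t ≤ E.error est ω}) ≤
            2 / ((n₁ : ℝ) * n₂) +
            C₁ * Real.exp (-(C₂ * (p.αh ^ 2 / (p.η ^ 2 * α ^ 2 * p.d)) *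
              (t ^ 2 / (((n₁ : ℝ) + n₂) * Real.log ((n₁ : ℝ) * n₂) ^ 2))))) ∧
        -- score with `8 + ζ` moments
        (∀ α ζ : ℝ, E.EightMomentScore p α ζ →
          ∀ t : ℝ, ((n₁ : ℝ) + n₂) ^ (-((8 + 5 * ζ) / (32 + 2 * ζ))) ≤ t →
          E.P.real (E.goodEvent p est ∩ {ω | t ≤ E.error est ω}) ≤
            (n₁ : ℝ) * n₂ / ((n₁ : ℝ) + n₂) ^ (2 + 2 * ζ / (16 + ζ)) +
            C₁ * Real.exp (-(C₂ * (p.αh ^ 2 / (p.η ^ 2 * α ^ 2 * p.d)) *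
              (t ^ 2 / ((n₁ : ℝ) + n₂) ^ (1 + 2 / (4 + ζ / 4)))))) ∧
        -- score with `4 + δ` moments
        (∀ α δ : ℝ, E.FourMomentScore p α δ →
          ∀ t : ℝ, ((n₁ : ℝ) + n₂) ^ (-(δ / 2)) < t →
          E.P.real (E.goodEvent p est ∩ {ω | t ≤ E.error est ω}) ≤
            (n₁ : ℝ) * n₂ / ((n₁ : ℝ) + n₂) ^ (2 + δ / 2) +
            C₁ * Real.exp (-(C₂ *
              (p.αh / (p.cDelta α * (p.αm + p.αθ) * (p.d : ℝ) ^ (3 / 2 : ℝ))) *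
              (t ^ 2 / ((n₁ : ℝ) + n₂) ^ (3 / 2 : ℝ)))))) ∧
    -- the resulting stochastic orders, along experiments of growing size with fixed constants
    (∀ (p : SharedFactor.Params) (n₁ n₂ : ℕ → ℕ)
      (E : ∀ k, SharedFactor.Experiment.{u} (n₁ k) (n₂ k)) (est : ∀ k, (E k).Estimator),
      (∀ k, 0 < n₁ k) → (∀ k, 0 < n₂ k) → Tendsto (fun k => n₁ k + n₂ k) atTop atTop →
      (∀ k, (E k).AssumptionA p) → (∀ k, (E k).AssumptionB p) → (∀ k, (E k).AssumptionC p) →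
      (∀ α : ℝ, (∀ k, (E k).SubGaussianScore α) →
        SharedFactor.IsBigOInProbOn (fun k => (E k).P) (fun k => (E k).goodEvent p (est k))
          (fun k => (E k).error (est k)) (fun k => √((n₁ k : ℝ) + n₂ k))) ∧
      (∀ α : ℝ, (∀ k, (E k).SubExponentialScore p α) →
        SharedFactor.IsBigOInProbOn (fun k => (E k).P) (fun k => (E k).goodEvent p (est k))
          (fun k => (E k).error (est k))
          (fun k => Real.log ((n₁ k : ℝ) * n₂ k) * √((n₁ k : ℝ) + n₂ k))) ∧
      (∀ α ζ : ℝ, (∀ k, (E k).EightMomentScore p α ζ) →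
        SharedFactor.IsLittleOInProbOn (fun k => (E k).P) (fun k => (E k).goodEvent p (est k))
          (fun k => (E k).error (est k)) (fun k => ((n₁ k : ℝ) + n₂ k) ^ (3 / 4 : ℝ))) ∧
      (∀ α δ : ℝ, (∀ k, (E k).FourMomentScore p α δ) →
        SharedFactor.IsBigOInProbOn (fun k => (E k).P) (fun k => (E k).goodEvent p (est k))
          (fun k => (E k).error (est k)) (fun k => ((n₁ k : ℝ) + n₂ k) ^ (3 / 4 : ℝ)))) := by
  refine ⟨⟨8, 1 / 10 ^ 10, by norm_num, by norm_num,
    fun n₁ n₂ E p est hn₁ hn₂ hA hB hC => ⟨fun α hS t ht => ?_, fun α hS t ht => ?_,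
      fun α ζ hS t ht => ?_, fun α δ hS t ht => ?_⟩⟩,
    fun p n₁ n₂ E est hn₁ hn₂ hN hA hB hC => ⟨fun α hS => ?_, fun α hS => ?_,
      fun α ζ hS => ?_, fun α δ hS => ?_⟩⟩
  · exact SharedFactor.Experiment.tail_of_subGaussianScore hA hB hC hn₁ hn₂ est hS ht
  · exact SharedFactor.Experiment.tail_of_subExponentialScore hA hB hC hn₁ hn₂ est hS ht
  · exact SharedFactor.Experiment.tail_of_eightMomentScore hA hB hC hn₁ est hS ht
  · exact SharedFactor.Experiment.tail_of_fourMomentScore hA hB hC hn₁ hn₂ est hS ht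
  · exact SharedFactor.Experiment.isBigOInProbOn_of_subGaussianScore hn₁ hn₂ hA hB hC hS
  · exact SharedFactor.Experiment.isBigOInProbOn_of_subExponentialScore hn₁ hn₂ hN hA hB hC hS
  · exact SharedFactor.Experiment.isLittleOInProbOn_of_eightMomentScore hn₁ hN hA hB hC hS
  · exact SharedFactor.Experiment.isBigOInProbOn_of_fourMomentScore hn₁ hn₂ hN hA hB hC hS
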